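/- Let $Q$ be a finite-dimensional smooth manifold (Hausdorff, second countable, without boundary), with coordinates $(q^i,\dot q^i)$ on $TQ$ and $z$ on $\mathbb{R}$. Let $L:TQ\times\mathbb{R}\to\mathbb{R}$ be a smooth function whose Hessian in the velocities $W_{ij}=\partial^2L/\partial\dot q^i\partial\dot q^j$ is, at each point, positive definite or negative definite (in particular $L$ is regular), and let $\Delta\subseteq TQ$ be a regular distribution on $Q$ (smooth, of constant rank). Let $\eta_L=dz-S^*(dL)=dz-\frac{\partial L}{\partial\dot q^i}\,dq^i$ be the contact form on $TQ\times\mathbb{R}$ defined by $L$, where $S=dq^i\otimes\partial/\partial\dot q^i$ is the canonical endomorphism. Let $\mathcal R_L$ be its Reeb vector field, i.e. $i_{\mathcal R_L}d\eta_L=0$ and $\eta_L(\mathcal R_L)=1$. Let $\flat_L(v)=i_vd\eta_L+\eta_L(v)\,\eta_L$, $\sharp_L=\flat_L^{-1}$, and let $\Lambda_L(\alpha,\beta)=-d\eta_L(\sharp_L\alpha,\sharp_L\beta)$ be the bivector of the associated Jacobi structure $(\Lambda_L,-\mathcal R_L)$. Let $\Delta\times\mathbb{R}=\{(v_q,z)\in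 TQ\times\mathbb{R}: v_q\in\Delta_q\}$, and let $\mathcal S=\sharp_L(\pi^*\Delta^\circ)$, where $\pi:TQ\times\mathbb{R}\to Q$ is the projection and $\Delta^\circ\subseteq T^*Q$ is the annihilator of $\Delta$. Along $\Delta\times\mathbb{R}$ one has $T(TQ\times\mathbb{R})=T(\Delta\times\mathbb{R})\oplus\mathcal S$; let $\mathcal P$ be the projector onto $T(\Delta\times\mathbb{R})$ with kernel $\mathcal S$. Put, along $\Delta\times\mathbb{R}$, $$\mathcal R_{L,\Delta}=\mathcal P(\mathcal R_L),\qquad \Lambda_{L,\Delta}(\alpha,\beta)=\Lambda_L(\mathcal P^*\alpha,\mathcal P^*\beta).$$ The nonholonomic bracket of $f,g\in C^\infty(\Delta\times\mathbb{R})$ is $$\{f,g\}_{L,\Delta}=\Lambda_{L,\Delta}(df,dg)-f\,\mathcal R_{L,\Delta}(g)+g\,\mathcal R_{L,\Delta}(f),$$ computed with arbitrary local smooth extensions of $f,g$ to $TQ\times\mathbb{R}$ (the result does not depend on them). Then the constraint system $(L,\Delta)$ is semiholonomic, i.e. $\Delta$ is involutive, if and only if the nonholonomic bracket satisfies the Jacobi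 identity $$\{f,\{g,h\}_{L,\Delta}\}_{L,\Delta}+\{g,\{h,f\}_{L,\Delta}\}_{L,\Delta}+\{h,\{f,g\}_{L,\Delta}\}_{L,\Delta}=0\qquad\text{for all } f,g,h\in C^\infty(\Delta\times\mathbb{R}).$$ -/

import Mathlib

open scoped Manifold ContDiff Topology

noncomputable section

namespace ContactNonholonomic

/-! ### Contact forms and their Jacobi structure on a manifold without boundary -/

section Contact

variable {F : Type*} [NormedAddCommGroup F] [NormedSpace ℝ F]
  {H : Type*} [TopologicalSpace H] (J : ModelWithCorners ℝ F H)
  {M : Type*} [TopologicalSpace M] [ChartedSpace H M]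

/-- The one-form `α` read in the preferred chart at `x₀`, i.e. its pull-back to the model vector
space by the inverse of that chart. -/
def oneFormInChart (α : ∀ x : M, TangentSpace J x →L[ℝ] ℝ) (x₀ : M) (y : F) : F →L[ℝ] ℝ :=
  (α ((extChartAt J x₀).symm y)).comp (mfderiv 𝓘(ℝ, F) J (extChartAt J x₀).symm y)

/-- The differential at `x` of the preferred chart at `x`. -/
def chartDifferential (x : M) : TangentSpace J x →L[ℝ] F :=
  mfderiv J 𝓘(ℝ, F) (extChartAt J x) x

/-- The exterior derivative `dα` of a one-form, as a bilinear form on `T_x M`; it is computed in the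
preferred chart at `x`, with the convention `d(a_i dx^i) = da_i ∧ dx^i`,
`(β ∧ γ)(u, v) = β u * γ v - β v * γ u`. -/
def dOneForm (α : ∀ x : M, TangentSpace J x →L[ℝ] ℝ) (x : M) :
    TangentSpace J x →ₗ[ℝ] Module.Dual ℝ (TangentSpace J x) :=
  LinearMap.mk₂ ℝ
    (fun u v =>
      fderiv ℝ (oneFormInChart J α x) (extChartAt J x x)
          (chartDifferential J x u) (chartDifferential J x v)
        - fderiv ℝ (oneFormInChart J α x) (extChartAt J x x)
          (chartDifferential J x v) (chartDifferential J x u))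
    (fun u u' v => by simp only [map_add, add_apply]; ring)
    (fun c u v => by simp only [map_smul, smul_apply, smul_eq_mul]; ring)
    (fun u v v' => by simp only [map_add, add_apply]; ring)
    (fun c u v => by simp only [map_smul, smul_apply, smul_eq_mul]; ring)

/-- The map `♭(v) = i_v dη + η(v) η` of a one-form `η`. -/
def flat (η : ∀ x : M, TangentSpace J x →L[ℝ] ℝ) (x : M) :
    TangentSpace J x →ₗ[ℝ] Module.Dual ℝ (TangentSpace J x) :=
  dOneForm J η x + (η x : TangentSpace J x →ₗ[ℝ] ℝ).smulRight (η x : TangentSpace J x →ₗ[ℝ] ℝ)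

open Classical in
/-- The inverse `♯` of `♭` (for a contact form, `♭` is bijective at every point). -/
def sharp (η : ∀ x : M, TangentSpace J x →L[ℝ] ℝ) (x : M) :
    Module.Dual ℝ (TangentSpace J x) →ₗ[ℝ] TangentSpace J x :=
  if h : Function.Bijective (flat J η x) then
    ((LinearEquiv.ofBijective (flat J η x) h).symm :
      Module.Dual ℝ (TangentSpace J x) →ₗ[ℝ] TangentSpace J x)
  else 0

/-- The Reeb vector field of a contact form: the unique `R` with `i_R dη = 0` and `η(R) = 1`. -/
def reeb (η : ∀ x : M, TangentSpace J x →L[ℝ] ℝ) (x : M) : TangentSpace J x :=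
  Classical.epsilon fun R : TangentSpace J x => dOneForm J η x R = 0 ∧ η x R = 1

/-- The bivector `Λ(α, β) = -dη(♯α, ♯β)` of the Jacobi structure `(Λ, -R)` of a contact form. -/
def contactBivector (η : ∀ x : M, TangentSpace J x →L[ℝ] ℝ) (x : M)
    (α β : Module.Dual ℝ (TangentSpace J x)) : ℝ :=
  -dOneForm J η x (sharp J η x α) (sharp J η x β)

/-- The differential of a real function, as a continuous covector. -/
def dFunL (f : M → ℝ) (x : M) : TangentSpace J x →L[ℝ] ℝ :=
  mfderiv J 𝓘(ℝ, ℝ) f x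

/-- The differential of a real function, as an element of the algebraic dual. -/
def dFun (f : M → ℝ) (x : M) : Module.Dual ℝ (TangentSpace J x) :=
  (dFunL J f x : TangentSpace J x →ₗ[ℝ] ℝ)

end Contact

/-! ### Distributions on the configuration manifold -/

section Distribution

variable {E : Type*} [NormedAddCommGroup E] [NormedSpace ℝ E]
  {Q : Type*} [TopologicalSpace Q] [ChartedSpace E Q] [IsManifold 𝓘(ℝ, E) ∞ Q]

/-- Smoothness of a vector field on a subset `U` of `Q`. -/
def SmoothFieldOn (X : ∀ q : Q, TangentSpace 𝓘(ℝ, E) q) (U : Set Q) : Prop :=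
  ContMDiffOn 𝓘(ℝ, E) 𝓘(ℝ, E).tangent ∞
    (fun q => (⟨q, X q⟩ : TangentBundle 𝓘(ℝ, E) Q)) U

/-- A regular distribution: of constant rank, with smooth local frames. -/
def IsRegularDistribution (Δ : ∀ q : Q, Submodule ℝ (TangentSpace 𝓘(ℝ, E) q)) : Prop :=
  ∃ m : ℕ, ∀ q₀ : Q, ∃ U : Set Q, IsOpen U ∧ q₀ ∈ U ∧
    ∃ X : Fin m → ∀ q : Q, TangentSpace 𝓘(ℝ, E) q,
      (∀ a, SmoothFieldOn (X a) U) ∧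
      ∀ q ∈ U, LinearIndependent ℝ (fun a => X a q) ∧
        Submodule.span ℝ (Set.range fun a => X a q) = Δ q

/-- `Δ` is involutive: the Lie bracket of two (local) vector fields in `Δ` is in `Δ`. -/
def IsInvolutive (Δ : ∀ q : Q, Submodule ℝ (TangentSpace 𝓘(ℝ, E) q)) : Prop :=
  ∀ (U : Set Q), IsOpen U → ∀ X Y : (∀ q : Q, TangentSpace 𝓘(ℝ, E) q),
    SmoothFieldOn X U → SmoothFieldOn Y U →
    (∀ q ∈ U, X q ∈ Δ q) → (∀ q ∈ U, Y q ∈ Δ q) →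
    ∀ q ∈ U, VectorField.mlieBracket 𝓘(ℝ, E) X Y q ∈ Δ q

end Distribution

/-! ### Contact Lagrangian systems on `TQ × ℝ` -/

section Lagrangian

/-- The manifold `TQ × ℝ`. -/
abbrev Phase (E : Type*) [NormedAddCommGroup E] [NormedSpace ℝ E]
    (Q : Type*) [TopologicalSpace Q] [ChartedSpace E Q] [IsManifold 𝓘(ℝ, E) ∞ Q] : Type _ :=
  TangentBundle 𝓘(ℝ, E) Q × ℝ

/-- The model with corners of `TQ × ℝ`. -/
abbrev phaseModel (E : Type*) [NormedAddCommGroup E] [NormedSpace ℝ E] :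
    ModelWithCorners ℝ ((E × E) × ℝ) (ModelProd (ModelProd E E) ℝ) :=
  𝓘(ℝ, E).tangent.prod 𝓘(ℝ, ℝ)

variable {E : Type*} [NormedAddCommGroup E] [NormedSpace ℝ E]
  {Q : Type*} [TopologicalSpace Q] [ChartedSpace E Q] [IsManifold 𝓘(ℝ, E) ∞ Q]

/-- The tangent space of `TQ × ℝ`. -/
abbrev PhaseTangent (x : Phase E Q) : Type _ := TangentSpace (phaseModel E) x

/-- The inclusion `v ↦ (v, z)` of the fibre `T_q Q` into `TQ × ℝ`; as a vector space, the tangent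
space `T_q Q` is `E`. -/
def fibreIncl (q : Q) (z : ℝ) (v : E) : Phase E Q :=
  ((⟨q, v⟩ : TangentBundle 𝓘(ℝ, E) Q), z)

/-- The projection `TQ × ℝ → Q`. -/
def baseProj (x : Phase E Q) : Q := x.1.proj

/-- The differential of the projection `TQ × ℝ → Q`. -/
def dBaseProj (x : Phase E Q) : PhaseTangent x →L[ℝ] TangentSpace 𝓘(ℝ, E) x.1.proj :=
  mfderiv (phaseModel E) 𝓘(ℝ, E) (baseProj (E := E) (Q := Q)) x

/-- The vertical lift `T_q Q → T_{(v_q, z)} (TQ × ℝ)`. -/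
def vertLift (x : Phase E Q) : TangentSpace 𝓘(ℝ, E) x.1.proj →L[ℝ] PhaseTangent x :=
  mfderiv 𝓘(ℝ, E) (phaseModel E) (fibreIncl (E := E) x.1.proj x.2) x.1.snd

/-- The canonical (vertical) endomorphism `S = dq^i ⊗ ∂/∂q̇^i`, extended to `TQ × ℝ`. -/
def vertEndo (x : Phase E Q) : PhaseTangent x →L[ℝ] PhaseTangent x :=
  (vertLift x).comp (dBaseProj x)

/-- The contact form `η_L = dz - S^*(dL)`, in coordinates `dz - (∂L/∂q̇^i) dq^i`. -/
def etaL (L : Phase E Q → ℝ) (x : Phase E Q) : PhaseTangent x →L[ℝ] ℝ :=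
  dFunL (phaseModel E) (Prod.snd : Phase E Q → ℝ) x
    - (dFunL (phaseModel E) L x).comp (vertEndo x)

/-- The Hessian `W(u, w) = (∂²L/∂q̇^i ∂q̇^j) u^i w^j` of `L` in the velocities at `x = (v_q, z)`. -/
def velocityHessian (L : Phase E Q → ℝ) (x : Phase E Q) (u w : E) : ℝ :=
  fderiv ℝ (fun v : E => fderiv ℝ (fun v' : E => L (fibreIncl x.1.proj x.2 v')) v)
    x.1.snd u w

/-- At every point the Hessian of `L` in the velocities is positive or negative definite. -/
def HasDefiniteHessian (L : Phase E Q → ℝ) : Prop :=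
  ∀ x : Phase E Q, (∀ u : E, u ≠ 0 → 0 < velocityHessian L x u u) ∨
    (∀ u : E, u ≠ 0 → velocityHessian L x u u < 0)

/-! ### The constraint submanifold, the projector and the nonholonomic bracket -/

/-- The submanifold `Δ × ℝ` of `TQ × ℝ`. -/
def constraintSet (Δ : ∀ q : Q, Submodule ℝ (TangentSpace 𝓘(ℝ, E) q)) : Set (Phase E Q) :=
  {x | x.1.snd ∈ Δ x.1.proj}

/-- `F` is a smooth function on `TQ × ℝ` near `x` that coincides near `x` with the function `f` on
`Δ × ℝ`. -/
def IsLocalExtension (Δ : ∀ q : Q, Submodule ℝ (TangentSpace 𝓘(ℝ, E) q))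
    (f : constraintSet Δ → ℝ) (x : Phase E Q) (F : Phase E Q → ℝ) : Prop :=
  ContMDiffAt (phaseModel E) 𝓘(ℝ, ℝ) ∞ F x ∧
    ∀ᶠ y in 𝓝 x, ∀ hy : y ∈ constraintSet Δ, F y = f ⟨y, hy⟩

/-- Smooth functions on the submanifold `Δ × ℝ`. -/
def IsSmoothOnConstraint (Δ : ∀ q : Q, Submodule ℝ (TangentSpace 𝓘(ℝ, E) q))
    (f : constraintSet Δ → ℝ) : Prop :=
  ∀ x : constraintSet Δ, ∃ F : Phase E Q → ℝ, IsLocalExtension Δ f x F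

/-- The tangent space `T_x (Δ × ℝ)` inside `T_x (TQ × ℝ)`: the vectors killed by the differentials
of the smooth functions near `x` that vanish on `Δ × ℝ`. -/
def constraintTangent (Δ : ∀ q : Q, Submodule ℝ (TangentSpace 𝓘(ℝ, E) q)) (x : Phase E Q) :
    Submodule ℝ (PhaseTangent x) :=
  ⨅ F : {F : Phase E Q → ℝ // IsLocalExtension Δ (fun _ => 0) x F},
    LinearMap.ker (dFun (phaseModel E) F.1 x)

/-- The annihilator of `Δ^l`: the pull-backs to `TQ × ℝ` of the covectors in the annihilator
of `Δ`. -/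
def liftedAnnihilator (Δ : ∀ q : Q, Submodule ℝ (TangentSpace 𝓘(ℝ, E) q)) (x : Phase E Q) :
    Submodule ℝ (Module.Dual ℝ (PhaseTangent x)) :=
  (Δ x.1.proj).dualAnnihilator.map
    (dBaseProj x : PhaseTangent x →ₗ[ℝ] TangentSpace 𝓘(ℝ, E) x.1.proj).dualMap

/-- The distribution `𝒮 = ♯_L((Δ^l)°)`. -/
def distS (L : Phase E Q → ℝ) (Δ : ∀ q : Q, Submodule ℝ (TangentSpace 𝓘(ℝ, E) q))
    (x : Phase E Q) : Submodule ℝ (PhaseTangent x) :=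
  (liftedAnnihilator Δ x).map (sharp (phaseModel E) (etaL L) x)

open Classical in
/-- The projector `𝒫` onto `T(Δ × ℝ)` along `𝒮`, for `T_x(TQ × ℝ) = T_x(Δ × ℝ) ⊕ 𝒮_x`
(this decomposition holds at the points of `Δ × ℝ` when the Hessian is definite). -/
def projP (L : Phase E Q → ℝ) (Δ : ∀ q : Q, Submodule ℝ (TangentSpace 𝓘(ℝ, E) q))
    (x : Phase E Q) : PhaseTangent x →ₗ[ℝ] PhaseTangent x :=
  if h : IsCompl (constraintTangent Δ x) (distS L Δ x) then
    Submodule.projection _ _ h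
  else 0

/-- The vector field `R_{L,Δ} = 𝒫(R_L)`. -/
def reebLΔ (L : Phase E Q → ℝ) (Δ : ∀ q : Q, Submodule ℝ (TangentSpace 𝓘(ℝ, E) q))
    (x : Phase E Q) : PhaseTangent x :=
  projP L Δ x (reeb (phaseModel E) (etaL L) x)

/-- The bivector field `Λ_{L,Δ}(α, β) = Λ_L(𝒫^* α, 𝒫^* β)`. -/
def bivectorLΔ (L : Phase E Q → ℝ) (Δ : ∀ q : Q, Submodule ℝ (TangentSpace 𝓘(ℝ, E) q))
    (x : Phase E Q) (α β : Module.Dual ℝ (PhaseTangent x)) : ℝ :=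
  contactBivector (phaseModel E) (etaL L) x ((projP L Δ x).dualMap α) ((projP L Δ x).dualMap β)

/-- The value at `x` of `Λ_{L,Δ}(dF, dG) - F R_{L,Δ}(G) + G R_{L,Δ}(F)`, for functions on
`TQ × ℝ`. -/
def ambientBracket (L : Phase E Q → ℝ) (Δ : ∀ q : Q, Submodule ℝ (TangentSpace 𝓘(ℝ, E) q))
    (F G : Phase E Q → ℝ) (x : Phase E Q) : ℝ :=
  bivectorLΔ L Δ x (dFun (phaseModel E) F x) (dFun (phaseModel E) G x)
    - F x * dFun (phaseModel E) G x (reebLΔ L Δ x)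
    + G x * dFun (phaseModel E) F x (reebLΔ L Δ x)

/-- The nonholonomic bracket of functions on `Δ × ℝ`: at each point, the bracket of smooth local
extensions. (The value does not depend on the extensions: the bracket of a function that vanishes
on `Δ × ℝ` with any other function is zero at the points of `Δ × ℝ`, since its differential
vanishes on the image of `𝒫`.) -/
def nhBracket (L : Phase E Q → ℝ) (Δ : ∀ q : Q, Submodule ℝ (TangentSpace 𝓘(ℝ, E) q))
    (f g : constraintSet Δ → ℝ) (x : constraintSet Δ) : ℝ :=
  ambientBracket L Δ (Classical.epsilon (IsLocalExtension Δ f x))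
    (Classical.epsilon (IsLocalExtension Δ g x)) x

/-- The nonholonomic bracket satisfies the Jacobi identity on `C^∞(Δ × ℝ)`. -/
def SatisfiesJacobi (L : Phase E Q → ℝ)
    (Δ : ∀ q : Q, Submodule ℝ (TangentSpace 𝓘(ℝ, E) q)) : Prop :=
  ∀ f g h : constraintSet Δ → ℝ,
    IsSmoothOnConstraint Δ f → IsSmoothOnConstraint Δ g → IsSmoothOnConstraint Δ h →
    ∀ x : constraintSet Δ,
      nhBracket L Δ f (nhBracket L Δ g h) x + nhBracket L Δ g (nhBracket L Δ h f) x
        + nhBracket L Δ h (nhBracket L Δ f g) x = 0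

end Lagrangian

end ContactNonholonomic

end

/-! Locally the Legendre map (q, v, z) ↦ (q, p, z), p = ∂L/∂v, turns η_L into dz - p dq, so Λ_L and
R_L become the standard contact structure of E × E* × ℝ, whose bracket satisfies the Jacobi
identity. In these coordinates 𝒮 consists of the vectors (0, μ, 0) with μ in the annihilator of Δ.
For a local frame X_a of Δ it is therefore the kernel of the differential of Θ(q, p, z) = (q,
p(X_a), z). A definite Hessian stays nondegenerate on Δ, so by the inverse function theorem Θ after
the Legendre map restricts to local coordinates on Δ × ℝ (`exists_frame_section`,
`exists_adaptedChart`). If f and g read φ and ψ in these coordinates, then 𝒫^* df = d(φ ∘ Θ), and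
the nonholonomic bracket of f and g is the contact bracket of φ ∘ Θ and ψ ∘ Θ on the Legendre image
of Δ × ℝ (`AdaptedChart.nhBracket_eq`).

That contact bracket depends on p only through Θ, except for the term Σ ∂_aφ ∂_bψ p([X_a, X_b])
(`jetBracket_comp_frameMap`). If Δ is involutive, [X_a, X_b] is a combination of the frame and this
term is a function of Θ as well. The functions φ ∘ Θ are then closed under the contact bracket, and
its Jacobi identity descends to Δ × ℝ (`satisfiesJacobi_of_lieBracket_mem`).

Conversely, let ξ annihilate Δ at q₀ and put ζ = ξ(q - q₀), p_a = p(X_a). Then {p_a, ζ} = ξ(X_a). At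
q₀ the term {ζ, {p_a, p_b}} vanishes, because ζ and the restriction of dζ to Δ vanish there, and the
other two terms of the Jacobi sum add up to ξ([X_a, X_b]). So the Jacobi identity forces [X_a, X_b]
into Δ (`AdaptedChart.lieBracket_mem_of_satisfiesJacobi`), and the Leibniz rule passes from the
frame to all fields in Δ (`mlieBracket_mem_of_frame`). -/

noncomputable section

namespace ContactNonholonomic

/-! ### Jacobi brackets on a vector space -/

section LinearJacobi

variable {V : Type*} [NormedAddCommGroup V] [NormedSpace ℝ V]
  (s : (V →L[ℝ] ℝ) →L[ℝ] V) (δ : V →L[ℝ] V) (R : V)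

/-- The Hamiltonian vector field of `F` for the Jacobi structure on `V` given by the constant
bivector `s`, the linear field `δ` and the constant field `R`. -/
def hamField (F : V → ℝ) (y : V) : V :=
  s (fderiv ℝ F y) + (fderiv ℝ F y (δ y) - F y) • R - (fderiv ℝ F y R) • δ y

/-- The Jacobi bracket on `V`. -/
def linBracket (F G : V → ℝ) (y : V) : ℝ :=
  fderiv ℝ G y (hamField s δ R F y) + fderiv ℝ F y R * G y

variable {s δ R}

theorem contDiffOn_linBracket {F G : V → ℝ} {O : Set V} (hO : IsOpen O)
    (hF : ContDiffOn ℝ ∞ F O) (hG : ContDiffOn ℝ ∞ G O) :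
    ContDiffOn ℝ ∞ (linBracket s δ R F G) O := by
  have hF' : ContDiffOn ℝ ∞ (fderiv ℝ F) O := hF.fderiv_of_isOpen hO (by simp)
  have hG' : ContDiffOn ℝ ∞ (fderiv ℝ G) O := hG.fderiv_of_isOpen hO (by simp)
  unfold linBracket hamField
  fun_prop

theorem linBracket_congr {F F' G G' : V → ℝ} {y : V} (hF : F =ᶠ[𝓝 y] F') (hG : G =ᶠ[𝓝 y] G') :
    linBracket s δ R F G y = linBracket s δ R F' G' y := by
  simp only [linBracket, hamField, hF.fderiv_eq, hG.fderiv_eq, hF.eq_of_nhds, hG.eq_of_nhds]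

theorem fderiv_linBracket {G H : V → ℝ} {y : V} (hG : ContDiffAt ℝ 2 G y)
    (hH : ContDiffAt ℝ 2 H y) (w : V) :
    fderiv ℝ (linBracket s δ R G H) y w =
      fderiv ℝ (fderiv ℝ H) y w (hamField s δ R G y)
      + fderiv ℝ H y (s (fderiv ℝ (fderiv ℝ G) y w)
        + (fderiv ℝ (fderiv ℝ G) y w (δ y) + fderiv ℝ G y (δ w) - fderiv ℝ G y w) • R
        - (fderiv ℝ (fderiv ℝ G) y w R) • δ y - (fderiv ℝ G y R) • δ w)
      + fderiv ℝ (fderiv ℝ G) y w R * H y + fderiv ℝ G y R * fderiv ℝ H y w := by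
  have dG : HasFDerivAt G (fderiv ℝ G y) y := (hG.differentiableAt (by norm_num)).hasFDerivAt
  have dH : HasFDerivAt H (fderiv ℝ H y) y := (hH.differentiableAt (by norm_num)).hasFDerivAt
  have dG' : HasFDerivAt (fderiv ℝ G) (fderiv ℝ (fderiv ℝ G) y) y :=
    ((hG.fderiv_right (m := 1) (by norm_num)).differentiableAt (by norm_num)).hasFDerivAt
  have dH' : HasFDerivAt (fderiv ℝ H) (fderiv ℝ (fderiv ℝ H) y) y :=
    ((hH.fderiv_right (m := 1) (by norm_num)).differentiableAt (by norm_num)).hasFDerivAt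
  have e1 := s.hasFDerivAt.comp y dG'
  have e2 := dG'.clm_apply δ.hasFDerivAt
  have e3 := dG'.clm_apply (hasFDerivAt_const R y)
  have e4 := (e1.add ((e2.sub dG).smul_const R)).sub (e3.smul δ.hasFDerivAt)
  have e5 := (dH'.clm_apply e4).add (e3.mul dH)
  have e6 : fderiv ℝ (linBracket s δ R G H) y = _ := HasFDerivAt.fderiv e5
  rw [e6]
  simp [hamField]
  ring

/-- The Jacobi identity for the bracket of the data `(s, δ, R)`. -/
theorem linBracket_jacobi
    (hs : ∀ α β : V →L[ℝ] ℝ, β (s α) = β (δ (s α)) - α (δ (s β)))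
    (hδ : ∀ v, δ (δ v) = δ v) (hR : δ R = 0) {F G H : V → ℝ} {y : V}
    (hF : ContDiffAt ℝ 2 F y) (hG : ContDiffAt ℝ 2 G y) (hH : ContDiffAt ℝ 2 H y) :
    linBracket s δ R F (linBracket s δ R G H) y + linBracket s δ R G (linBracket s δ R H F) y
      + linBracket s δ R H (linBracket s δ R F G) y = 0 := by
  have symm : ∀ {K : V → ℝ}, ContDiffAt ℝ 2 K y → ∀ u v,
      fderiv ℝ (fderiv ℝ K) y u v = fderiv ℝ (fderiv ℝ K) y v u := fun hK u v =>
    hK.isSymmSndFDerivAt (by simp) u v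
  -- `hs` contains the antisymmetry of s. Given that, it says s = δ s + s δᵀ, that is, the Lie
  -- derivative of s along δ is -s, which is the compatibility required of a Jacobi structure.
  have anti : ∀ α β : V →L[ℝ] ℝ, β (s α) = - α (s β) := fun α β => by
    rw [hs α β, hs β α]; ring
  have e : ∀ (K K' K'' : V → ℝ), linBracket s δ R K (linBracket s δ R K' K'') y =
    fderiv ℝ (linBracket s δ R K' K'') y (hamField s δ R K y)
      + fderiv ℝ K y R * linBracket s δ R K' K'' y := fun _ _ _ => rfl
  rw [e, e, e, fderiv_linBracket hG hH, fderiv_linBracket hH hF, fderiv_linBracket hF hG]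
  simp only [linBracket]
  -- Antisymmetry of s moves every Hessian to the outside, where its symmetry cancels the
  -- second-order terms.
  have key : ∀ {K K' : V → ℝ} (v : V), fderiv ℝ K y (s (fderiv ℝ (fderiv ℝ K') y v)) =
      - fderiv ℝ (fderiv ℝ K') y v (s (fderiv ℝ K y)) := fun v => anti _ _
  simp only [hamField, key, map_add, map_sub, map_smul, smul_eq_mul, add_apply,
    sub_apply, smul_apply, hδ, hR, map_zero, mul_zero, add_zero]
  generalize hf : fderiv ℝ F y = f
  generalize hg : fderiv ℝ G y = g
  generalize hh : fderiv ℝ H y = h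
  have sF := symm hF
  have sG := symm hG
  have sH := symm hH
  generalize fderiv ℝ (fderiv ℝ F) y = F2 at *
  generalize fderiv ℝ (fderiv ℝ G) y = G2 at *
  generalize fderiv ℝ (fderiv ℝ H) y = H2 at *
  -- Both orders g (s f) and f (s g) are expressed through the same numbers g (δ (s f)) and f (δ (s
  -- g)), and the Hessian terms are put in a fixed order of arguments. A polynomial identity
  -- remains.
  simp only [hs f g, hs g f, hs f h, hs h f, hs g h, hs h g, sF (s h) (s g), sG (s h) (s f),
    sH (s g) (s f), sF (δ y), sG (δ y), sH (δ y), sF R (s g), sF R (s h), sG R (s f), sG R (s h),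
    sH R (s f), sH R (s g)]
  ring

end LinearJacobi

/-! ### The contact bracket on `E × E* × ℝ` -/

section Jet

variable {E : Type*} [NormedAddCommGroup E] [NormedSpace ℝ E]

/-- The model contact manifold `E × E* × ℝ`, with coordinates `(q, p, z)`. -/
abbrev Jet (E : Type*) [NormedAddCommGroup E] [NormedSpace ℝ E] : Type _ :=
  E × (E →L[ℝ] ℝ) × ℝ

/-- The inclusion of the directions of `q`. -/
def inQ (E : Type*) [NormedAddCommGroup E] [NormedSpace ℝ E] : E →L[ℝ] Jet E :=
  ContinuousLinearMap.inl ℝ E ((E →L[ℝ] ℝ) × ℝ)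

/-- The inclusion of the directions of `p`. -/
def inP (E : Type*) [NormedAddCommGroup E] [NormedSpace ℝ E] : (E →L[ℝ] ℝ) →L[ℝ] Jet E :=
  (ContinuousLinearMap.inr ℝ E ((E →L[ℝ] ℝ) × ℝ)).comp
    (ContinuousLinearMap.inl ℝ (E →L[ℝ] ℝ) ℝ)

/-- The direction of `z`. -/
def inZ (E : Type*) [NormedAddCommGroup E] [NormedSpace ℝ E] : Jet E := (0, 0, 1)

@[simp] theorem inQ_apply (a : E) : inQ E a = (a, 0, 0) := rfl
@[simp] theorem inP_apply (b : E →L[ℝ] ℝ) : inP E b = (0, b, 0) := rfl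

/-- The Liouville vector field `p_i ∂/∂p_i`. -/
def jetLiouville (E : Type*) [NormedAddCommGroup E] [NormedSpace ℝ E] :
    Jet E →L[ℝ] Jet E :=
  (inP E).comp ((ContinuousLinearMap.fst ℝ (E →L[ℝ] ℝ) ℝ).comp
    (ContinuousLinearMap.snd ℝ E ((E →L[ℝ] ℝ) × ℝ)))

@[simp] theorem jetLiouville_apply (y : Jet E) : jetLiouville E y = (0, y.2.1, 0) := rfl

theorem Jet.map_eq (α : Jet E →L[ℝ] ℝ) (a : E) (b : E →L[ℝ] ℝ) (c : ℝ) :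
    α (a, b, c) = α (a, 0, 0) + α (0, b, 0) + c * α (inZ E) := by
  rw [← smul_eq_mul, ← map_smul, ← map_add, ← map_add]
  simp [inZ]

variable [FiniteDimensional ℝ E]

/-- The inverse of the canonical map of `E` to its bidual. -/
def predual (E : Type*) [NormedAddCommGroup E] [NormedSpace ℝ E] [FiniteDimensional ℝ E] :
    ((E →L[ℝ] ℝ) →L[ℝ] ℝ) →L[ℝ] E :=
  ∑ i, (ContinuousLinearMap.apply ℝ ℝ
    (LinearMap.toContinuousLinearMap ((Module.finBasis ℝ E).coord i))).smulRight
      (Module.finBasis ℝ E i)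

theorem apply_predual (φ : (E →L[ℝ] ℝ) →L[ℝ] ℝ) (β : E →L[ℝ] ℝ) : β (predual E φ) = φ β := by
  have h : β = ∑ i, β (Module.finBasis ℝ E i) •
      LinearMap.toContinuousLinearMap ((Module.finBasis ℝ E).coord i) := by
    ext v
    conv_lhs => rw [← (Module.finBasis ℝ E).sum_repr v]
    simp only [map_sum, map_smul, smul_eq_mul, sum_apply, smul_apply,
      LinearMap.coe_toContinuousLinearMap', Module.Basis.coord_apply, mul_comm]
  conv_rhs => rw [h]
  simp [predual, mul_comm]

theorem predual_eq {φ : (E →L[ℝ] ℝ) →L[ℝ] ℝ} {v : E} (h : ∀ β, φ β = β v) :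
    predual E φ = v := by
  refine (SeparatingDual.eq_iff_forall_dual_eq (R := ℝ)).2 fun β => ?_
  rw [apply_predual, h]

/-- The bivector `∂/∂p_i ∧ ∂/∂q^i`. -/
def jetSharp (E : Type*) [NormedAddCommGroup E] [NormedSpace ℝ E] [FiniteDimensional ℝ E] :
    (Jet E →L[ℝ] ℝ) →L[ℝ] Jet E :=
  ((predual E).comp (ContinuousLinearMap.precomp ℝ (inP E))).prod
    ((ContinuousLinearMap.precomp ℝ (-inQ E)).prod 0)

theorem jetSharp_apply (α : Jet E →L[ℝ] ℝ) :
    jetSharp E α = (predual E (α.comp (inP E)), -α.comp (inQ E), 0) := by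
  rw [← ContinuousLinearMap.comp_neg]
  rfl

/-- The contact bracket on `E × E* × ℝ`. -/
def jetBracket (F G : Jet E → ℝ) : Jet E → ℝ :=
  linBracket (jetSharp E) (jetLiouville E) (inZ E) F G

/-- Here δ is the projection onto the momenta, which kills ∂/∂z, and the bivector pairs positions
with momenta only. So β (s α) is the sum of its momentum part β (δ (s α)) and its position part, and
the latter equals -α (δ (s β)). -/
theorem jetBracket_jacobi {F G H : Jet E → ℝ} {y : Jet E}
    (hF : ContDiffAt ℝ 2 F y) (hG : ContDiffAt ℝ 2 G y) (hH : ContDiffAt ℝ 2 H y) :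
    jetBracket F (jetBracket G H) y + jetBracket G (jetBracket H F) y
      + jetBracket H (jetBracket F G) y = 0 := by
  refine linBracket_jacobi (fun α β => ?_) (fun v => by simp) (by simp [inZ]) hF hG hH
  have h1 := Jet.map_eq β (predual E (α.comp (inP E))) (-α.comp (inQ E)) 0
  have h2 : β (inQ E (predual E (α.comp (inP E)))) = α (0, β.comp (inQ E), 0) :=
    apply_predual (α.comp (inP E)) (β.comp (inQ E))
  have h3 : α (0, -β.comp (inQ E), 0) = - α (0, β.comp (inQ E), 0) := by
    rw [← map_neg]; simp
  simp only [jetSharp_apply, jetLiouville_apply, h1, h3]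
  rw [inQ_apply] at h2
  rw [h2]
  ring

end Jet

/-! ### Reduction along a frame -/

section Frame

variable {E : Type*} [NormedAddCommGroup E] [NormedSpace ℝ E]

/-- The model of `Δ × ℝ`, with coordinates `q`, the momenta along a frame of `Δ`, and `z`. -/
abbrev FrameSpace (E : Type*) (m : ℕ) : Type _ := E × (Fin m → ℝ) × ℝ

variable {m : ℕ} (X : Fin m → E → E)

/-- The map `(q, p, z) ↦ (q, p(X_a), z)`. -/
def frameMap (y : Jet E) : FrameSpace E m := (y.1, fun a => y.2.1 (X a y.1), y.2.2)

/-- The symbol in `Δ` of the derivative of `f` in the momenta. -/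
def frameSymbol (f : FrameSpace E m → ℝ) (w : FrameSpace E m) : E :=
  ∑ a, fderiv ℝ f w (0, Pi.single a 1, 0) • X a w.1

/-- The part of the bracket that involves the Lie brackets of the frame. -/
def frameCurvature (f g : FrameSpace E m → ℝ) (w : FrameSpace E m) : E :=
  ∑ a, ∑ b, (fderiv ℝ f w (0, Pi.single a 1, 0) * fderiv ℝ g w (0, Pi.single b 1, 0)) •
    VectorField.lieBracket ℝ (X a) (X b) w.1

variable {X}

theorem FrameSpace.map_momentum (α : FrameSpace E m →L[ℝ] ℝ) (u : Fin m → ℝ) :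
    α (0, u, 0) = ∑ a, u a * α (0, Pi.single a 1, 0) := by
  let i : (Fin m → ℝ) →ₗ[ℝ] FrameSpace E m :=
    (LinearMap.inr ℝ E ((Fin m → ℝ) × ℝ)).comp (LinearMap.inl ℝ (Fin m → ℝ) ℝ)
  have := LinearMap.pi_apply_eq_sum_univ ((α : FrameSpace E m →ₗ[ℝ] ℝ).comp i) u
  have e : ∀ a : Fin m, (fun j => if a = j then (1 : ℝ) else 0) = Pi.single a 1 := fun a => by
    ext j; simp [Pi.single_apply, eq_comm]
  simpa [i, e] using this

theorem FrameSpace.map_eq (α : FrameSpace E m →L[ℝ] ℝ) (a : E) (u : Fin m → ℝ) (c : ℝ) :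
    α (a, u, c) = α (a, 0, 0) + α (0, u, 0) + c * α (0, 0, 1) := by
  rw [← smul_eq_mul, ← map_smul, ← map_add, ← map_add]
  simp

theorem hasFDerivAt_frameMap {y : Jet E} (hX : ∀ a, DifferentiableAt ℝ (X a) y.1) :
    DifferentiableAt ℝ (frameMap X) y ∧ ∀ v : Jet E, fderiv ℝ (frameMap X) y v =
      (v.1, fun a => v.2.1 (X a y.1) + y.2.1 (fderiv ℝ (X a) y.1 v.1), v.2.2) := by
  have h1 : HasFDerivAt (fun y : Jet E => y.1) (ContinuousLinearMap.fst ℝ _ _) y := hasFDerivAt_fst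
  have h2 : HasFDerivAt (fun y : Jet E => y.2) (ContinuousLinearMap.snd ℝ _ _) y := hasFDerivAt_snd
  have h3 : HasFDerivAt (fun y : Jet E => y.2.1) _ y := hasFDerivAt_fst.comp y h2
  have h4 : HasFDerivAt (fun y : Jet E => y.2.2) _ y := hasFDerivAt_snd.comp y h2
  have h5 : HasFDerivAt (fun y : Jet E => fun a => y.2.1 (X a y.1)) _ y :=
    hasFDerivAt_pi.2 fun a => h3.clm_apply ((hX a).hasFDerivAt.comp y h1)
  have h6 : HasFDerivAt (frameMap X) _ y := h1.prodMk (h5.prodMk h4)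
  refine ⟨h6.differentiableAt, fun v => ?_⟩
  rw [h6.fderiv]
  ext <;> simp [add_comm]

theorem contDiffOn_frameMap {W : Set E} (hX : ∀ a, ContDiffOn ℝ ∞ (X a) W) :
    ContDiffOn ℝ ∞ (frameMap X) {y : Jet E | y.1 ∈ W} := by
  have h : ∀ a, ContDiffOn ℝ ∞ (fun y : Jet E => X a y.1) {y : Jet E | y.1 ∈ W} := fun a =>
    (hX a).comp contDiff_fst.contDiffOn fun y hy => hy
  unfold frameMap
  refine contDiff_fst.contDiffOn.prodMk (ContDiffOn.prodMk (contDiffOn_pi.2 fun a => ?_)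
    contDiff_snd.snd.contDiffOn)
  exact contDiff_snd.fst.contDiffOn.clm_apply (h a)

variable [FiniteDimensional ℝ E]

/-- The bracket of functions of `(q, p(X_a), z)`. -/
theorem jetBracket_comp_frameMap {f g : FrameSpace E m → ℝ} {y : Jet E}
    (hX : ∀ a, DifferentiableAt ℝ (X a) y.1)
    (hf : DifferentiableAt ℝ f (frameMap X y)) (hg : DifferentiableAt ℝ g (frameMap X y)) :
    jetBracket (f ∘ frameMap X) (g ∘ frameMap X) y =
      fderiv ℝ g (frameMap X y) (frameSymbol X f (frameMap X y), 0, 0)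
      - fderiv ℝ f (frameMap X y) (frameSymbol X g (frameMap X y), 0, 0)
      + y.2.1 (frameCurvature X f g (frameMap X y))
      + fderiv ℝ f (frameMap X y) (0, (frameMap X y).2.1, 0) * fderiv ℝ g (frameMap X y) (0, 0, 1)
      - fderiv ℝ g (frameMap X y) (0, (frameMap X y).2.1, 0) * fderiv ℝ f (frameMap X y) (0, 0, 1)
      - f (frameMap X y) * fderiv ℝ g (frameMap X y) (0, 0, 1)
      + g (frameMap X y) * fderiv ℝ f (frameMap X y) (0, 0, 1) := by
  obtain ⟨hΘ, hΘ'⟩ := hasFDerivAt_frameMap hX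
  have hd : ∀ {k : FrameSpace E m → ℝ}, DifferentiableAt ℝ k (frameMap X y) → ∀ v,
      fderiv ℝ (k ∘ frameMap X) y v = fderiv ℝ k (frameMap X y)
        (v.1, fun a => v.2.1 (X a y.1) + y.2.1 (fderiv ℝ (X a) y.1 v.1), v.2.2) := fun hk v => by
    rw [fderiv_comp y hk hΘ, ContinuousLinearMap.comp_apply, hΘ']
  -- The momentum gradient of f ∘ Θ is the combination of the frame whose coefficients are the
  -- partial derivatives of f in the frame momenta.
  have hpre : predual E ((fderiv ℝ (f ∘ frameMap X) y).comp (inP E)) =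
      frameSymbol X f (frameMap X y) := by
    refine predual_eq fun β => ?_
    rw [ContinuousLinearMap.comp_apply, hd hf]
    simp only [inP_apply, map_zero, add_zero, frameSymbol, map_sum, map_smul, smul_eq_mul]
    rw [FrameSpace.map_momentum]
    exact Finset.sum_congr rfl fun a _ => mul_comm _ _
  have hz : ∀ {k : FrameSpace E m → ℝ}, DifferentiableAt ℝ k (frameMap X y) →
      fderiv ℝ (k ∘ frameMap X) y (inZ E) = fderiv ℝ k (frameMap X y) (0, 0, 1) := fun hk => by
    rw [hd hk]; simp [inZ]; rfl
  have hl : ∀ {k : FrameSpace E m → ℝ}, DifferentiableAt ℝ k (frameMap X y) →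
      fderiv ℝ (k ∘ frameMap X) y (0, y.2.1, 0) =
        fderiv ℝ k (frameMap X y) (0, (frameMap X y).2.1, 0) := fun hk => by
    rw [hd hk]; simp [frameMap]
  have hq : ∀ {k : FrameSpace E m → ℝ}, DifferentiableAt ℝ k (frameMap X y) → ∀ a : E,
      fderiv ℝ (k ∘ frameMap X) y (a, 0, 0) = fderiv ℝ k (frameMap X y) (a, 0, 0)
        + ∑ i, fderiv ℝ k (frameMap X y) (0, Pi.single i 1, 0) *
          y.2.1 (fderiv ℝ (X i) y.1 a) := fun hk a => by
    rw [hd hk, FrameSpace.map_eq, FrameSpace.map_momentum _ (fun i => _)]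
    simp [mul_comm]
  have hp : ∀ b : E →L[ℝ] ℝ, fderiv ℝ (g ∘ frameMap X) y (0, b, 0) =
      b (frameSymbol X g (frameMap X y)) := fun b => by
    rw [hd hg]
    simp only [map_zero, add_zero, frameSymbol, map_sum, map_smul, smul_eq_mul]
    rw [FrameSpace.map_momentum]
    exact Finset.sum_congr rfl fun a _ => mul_comm _ _
  -- Differentiating p(X_a(q)) in q produces derivatives of the frame, and the two orders combine
  -- into Lie brackets. This is the only term in which p enters other than through `frameMap`.
  have hcurv : y.2.1 (frameCurvature X f g (frameMap X y)) =
      ∑ i, fderiv ℝ g (frameMap X y) (0, Pi.single i 1, 0) *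
          y.2.1 (fderiv ℝ (X i) y.1 (frameSymbol X f (frameMap X y)))
      - ∑ i, fderiv ℝ f (frameMap X y) (0, Pi.single i 1, 0) *
          y.2.1 (fderiv ℝ (X i) y.1 (frameSymbol X g (frameMap X y))) := by
    simp only [frameCurvature, frameSymbol, map_sum, map_smul, smul_eq_mul,
      VectorField.lieBracket, map_sub, mul_sub, Finset.sum_sub_distrib, Finset.mul_sum]
    congr 1
    · rw [Finset.sum_comm]
      exact Finset.sum_congr rfl fun _ _ => Finset.sum_congr rfl fun _ _ => by simp [frameMap]; ring
    · exact Finset.sum_congr rfl fun _ _ => Finset.sum_congr rfl fun _ _ => by simp [frameMap]; ring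
  rw [hcurv]
  simp only [jetBracket, linBracket, hamField, jetSharp_apply, jetLiouville_apply, map_add, map_sub,
    map_smul, smul_eq_mul, hl hf, hl hg, hz hf, hz hg, hpre, Function.comp_apply]
  rw [Jet.map_eq, hq hg, hp]
  simp only [neg_apply, ContinuousLinearMap.comp_apply, inQ_apply, hq hf]
  ring

/-- All terms of `jetBracket_comp_frameMap` but the curvature are functions of the frame
coordinates. Two momenta with equal frame coordinates agree on the span of the frame, hence on the
curvature when the Lie brackets lie in that span. -/
theorem jetBracket_comp_frameMap_eq {f g : FrameSpace E m → ℝ} {y y' : Jet E}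
    (hX : ∀ a, DifferentiableAt ℝ (X a) y.1)
    (hf : DifferentiableAt ℝ f (frameMap X y)) (hg : DifferentiableAt ℝ g (frameMap X y))
    (hyy' : frameMap X y = frameMap X y')
    (hinv : ∀ a b, VectorField.lieBracket ℝ (X a) (X b) y.1 ∈
      Submodule.span ℝ (Set.range fun c => X c y.1)) :
    jetBracket (f ∘ frameMap X) (g ∘ frameMap X) y =
      jetBracket (f ∘ frameMap X) (g ∘ frameMap X) y' := by
  have h1 : y.1 = y'.1 := congrArg (fun w : FrameSpace E m => w.1) hyy'
  have hspan : ∀ v ∈ Submodule.span ℝ (Set.range fun c => X c y.1), y.2.1 v = y'.2.1 v := by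
    intro v hv
    induction hv using Submodule.span_induction with
    | mem v hv =>
      obtain ⟨c, rfl⟩ := hv
      have h2 := congrFun (congrArg (fun w : FrameSpace E m => w.2.1) hyy') c
      simp only [frameMap] at h2
      rw [h2, h1]
    | zero => simp
    | add u v _ _ hu hv => simp [hu, hv]
    | smul c v _ hv => simp [hv]
  rw [jetBracket_comp_frameMap hX hf hg,
    jetBracket_comp_frameMap (h1 ▸ hX) (hyy' ▸ hf) (hyy' ▸ hg), ← hyy', hspan]
  exact Submodule.sum_mem _ fun a _ => Submodule.sum_mem _ fun b _ =>
    Submodule.smul_mem _ _ (hinv a b)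

end Frame

/-! ### The exterior derivative of `dz - p dq` -/

section DarbouxForm

variable {F : Type*} [NormedAddCommGroup F] [NormedSpace ℝ F]
  {H : Type*} [TopologicalSpace H] {J : ModelWithCorners ℝ F H} [J.Boundaryless]
  {M : Type*} [TopologicalSpace M] [ChartedSpace H M] [IsManifold J ∞ M]

theorem two_le_infty : (2 : WithTop ℕ∞) ≤ ∞ := by
  exact ENat.LEInfty.out

theorem contMDiffAt_extChartAt_symm (x : M) {y : F} (hy : y ∈ (extChartAt J x).target) :
    ContMDiffAt 𝓘(ℝ, F) J ∞ (extChartAt J x).symm y :=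
  (contMDiffOn_extChartAt_symm x).contMDiffAt ((isOpen_extChartAt_target x).mem_nhds hy)

theorem contDiffAt_comp_extChartAt_symm {G : Type*} [NormedAddCommGroup G] [NormedSpace ℝ G]
    {n : WithTop ℕ∞} (hn : n ≤ ∞) {g : M → G} {x : M} (hg : ContMDiffAt J 𝓘(ℝ, G) n g x) :
    ContDiffAt ℝ n (g ∘ (extChartAt J x).symm) (extChartAt J x x) := by
  rw [← contMDiffAt_iff_contDiffAt]
  refine ContMDiffAt.comp _ ?_ ((contMDiffAt_extChartAt_symm x (mem_extChartAt_target x)).of_le hn)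
  rwa [extChartAt_to_inv]

variable (J) in
/-- The derivative of a map to a vector space, as a vector-valued covector. -/
def vecDeriv {G : Type*} [NormedAddCommGroup G] [NormedSpace ℝ G] (g : M → G) (x : M) :
    TangentSpace J x →L[ℝ] G :=
  mfderiv J 𝓘(ℝ, G) g x

omit [J.Boundaryless] [IsManifold J ∞ M] in
theorem vecDeriv_congr {G : Type*} [NormedAddCommGroup G] [NormedSpace ℝ G] {g g' : M → G} {x : M}
    (h : g =ᶠ[𝓝 x] g') (u : TangentSpace J x) : vecDeriv J g x u = vecDeriv J g' x u := by
  have e : vecDeriv J g x = vecDeriv J g' x := h.mfderiv_eq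
  rw [e]

omit [J.Boundaryless] [IsManifold J ∞ M] in
theorem vecDeriv_comp {G G' : Type*} [NormedAddCommGroup G] [NormedSpace ℝ G]
    [NormedAddCommGroup G'] [NormedSpace ℝ G'] {K : G → G'} {g : M → G} {x : M}
    (hK : DifferentiableAt ℝ K (g x)) (hg : MDifferentiableAt J 𝓘(ℝ, G) g x)
    (u : TangentSpace J x) :
    vecDeriv J (K ∘ g) x u = fderiv ℝ K (g x) (vecDeriv J g x u) := by
  have h := mfderiv_comp x hK.mdifferentiableAt hg
  rw [mfderiv_eq_fderiv] at h
  exact congrArg (fun l => l u) h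

omit [J.Boundaryless] [IsManifold J ∞ M] in
theorem vecDeriv_clm_comp {G G' : Type*} [NormedAddCommGroup G] [NormedSpace ℝ G]
    [NormedAddCommGroup G'] [NormedSpace ℝ G'] (l : G →L[ℝ] G') {g : M → G} {x : M}
    (hg : MDifferentiableAt J 𝓘(ℝ, G) g x) (u : TangentSpace J x) :
    vecDeriv J (l ∘ g) x u = l (vecDeriv J g x u) := by
  rw [vecDeriv_comp l.differentiableAt hg, l.fderiv]

theorem fderiv_comp_extChartAt_symm {G : Type*} [NormedAddCommGroup G] [NormedSpace ℝ G]
    {g : M → G} {x : M} {y : F} (hy : y ∈ (extChartAt J x).target)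
    (hg : MDifferentiableAt J 𝓘(ℝ, G) g ((extChartAt J x).symm y)) :
    fderiv ℝ (g ∘ (extChartAt J x).symm) y =
      (vecDeriv J g ((extChartAt J x).symm y)).comp
        (mfderiv 𝓘(ℝ, F) J (extChartAt J x).symm y) := by
  rw [← mfderiv_eq_fderiv]
  exact mfderiv_comp y hg ((contMDiffAt_extChartAt_symm x hy).mdifferentiableAt (by simp))

theorem vecDeriv_eq_comp_chartDifferential {G : Type*} [NormedAddCommGroup G] [NormedSpace ℝ G]
    {g : M → G} {x : M} (hg : MDifferentiableAt J 𝓘(ℝ, G) g x) (u : TangentSpace J x) :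
    vecDeriv J g x u =
      fderiv ℝ (g ∘ (extChartAt J x).symm) (extChartAt J x x) (chartDifferential J x u) := by
  have h : g =ᶠ[𝓝 x] (g ∘ (extChartAt J x).symm) ∘ extChartAt J x := by
    filter_upwards [extChartAt_source_mem_nhds (I := J) x] with y hy
    exact congrArg g ((extChartAt J x).left_inv hy).symm
  have h1 : MDifferentiableAt 𝓘(ℝ, F) 𝓘(ℝ, G) (g ∘ (extChartAt J x).symm) (extChartAt J x x) := by
    refine MDifferentiableAt.comp (I' := J) _ ?_ ((contMDiffAt_extChartAt_symm x
      (mem_extChartAt_target x)).mdifferentiableAt (by simp))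
    rwa [extChartAt_to_inv]
  rw [vecDeriv, h.mfderiv_eq, mfderiv_comp x h1 (mdifferentiableAt_extChartAt (mem_chart_source H x)),
    mfderiv_eq_fderiv]
  rfl

variable {E : Type*} [NormedAddCommGroup E] [NormedSpace ℝ E]

/-- In the chart the derivative of dz - p dq is D²z - p D²q - Dp ⊗ Dq. Antisymmetrization kills the
symmetric second derivatives and leaves dq ∧ dp. -/
theorem dOneForm_of_eq_darboux {η : ∀ x : M, TangentSpace J x →L[ℝ] ℝ} {q : M → E}
    {p : M → E →L[ℝ] ℝ} {z : M → ℝ} {x : M}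
    (hq : ContMDiffAt J 𝓘(ℝ, E) 2 q x) (hp : ContMDiffAt J 𝓘(ℝ, E →L[ℝ] ℝ) 2 p x)
    (hz : ContMDiffAt J 𝓘(ℝ, ℝ) 2 z x)
    (hη : ∀ᶠ y in 𝓝 x, ∀ u : TangentSpace J y,
      η y u = vecDeriv J z y u - p y (vecDeriv J q y u))
    (u v : TangentSpace J x) :
    dOneForm J η x u v =
      vecDeriv J p x v (vecDeriv J q x u)
      - vecDeriv J p x u (vecDeriv J q x v) := by
  set e := (extChartAt J x).symm with he
  set y₀ := extChartAt J x x with hy₀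
  have hq' : ContDiffAt ℝ 2 (q ∘ e) y₀ := contDiffAt_comp_extChartAt_symm two_le_infty hq
  have hp' : ContDiffAt ℝ 2 (p ∘ e) y₀ := contDiffAt_comp_extChartAt_symm two_le_infty hp
  have hz' : ContDiffAt ℝ 2 (z ∘ e) y₀ := contDiffAt_comp_extChartAt_symm two_le_infty hz
  have hey₀ : e y₀ = x := extChartAt_to_inv x
  have hcont : Filter.Tendsto e (𝓝 y₀) (𝓝 x) := by
    have := (contMDiffAt_extChartAt_symm (J := J) x (mem_extChartAt_target x)).continuousAt
    rwa [ContinuousAt, extChartAt_to_inv] at this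
  have hev : oneFormInChart J η x =ᶠ[𝓝 y₀]
      fun y => fderiv ℝ (z ∘ e) y - (p (e y)).comp (fderiv ℝ (q ∘ e) y) := by
    filter_upwards [hcont.eventually hη, hcont.eventually ((contMDiffAt_iff_contMDiffAt_nhds (by simp)).1 hq),
      hcont.eventually ((contMDiffAt_iff_contMDiffAt_nhds (by simp)).1 hz), extChartAt_target_mem_nhds (I := J) x]
      with y hy hyq hyz hyt
    rw [fderiv_comp_extChartAt_symm hyt (hyq.mdifferentiableAt (by simp)),
      fderiv_comp_extChartAt_symm hyt (hyz.mdifferentiableAt (by simp))]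
    ext w
    exact hy _
  have dq : HasFDerivAt (fderiv ℝ (q ∘ e)) (fderiv ℝ (fderiv ℝ (q ∘ e)) y₀) y₀ :=
    ((hq'.fderiv_right (m := 1) (by norm_num)).differentiableAt (by norm_num)).hasFDerivAt
  have dz : HasFDerivAt (fderiv ℝ (z ∘ e)) (fderiv ℝ (fderiv ℝ (z ∘ e)) y₀) y₀ :=
    ((hz'.fderiv_right (m := 1) (by norm_num)).differentiableAt (by norm_num)).hasFDerivAt
  have dp : HasFDerivAt (p ∘ e) (fderiv ℝ (p ∘ e) y₀) y₀ :=
    (hp'.differentiableAt (by norm_num)).hasFDerivAt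
  have hd := dz.sub (dp.clm_comp dq)
  have key : ∀ a b : F, fderiv ℝ (oneFormInChart J η x) y₀ a b =
      fderiv ℝ (fderiv ℝ (z ∘ e)) y₀ a b - p x (fderiv ℝ (fderiv ℝ (q ∘ e)) y₀ a b)
        - (fderiv ℝ (p ∘ e) y₀ a) (fderiv ℝ (q ∘ e) y₀ b) := fun a b => by
    have h : fderiv ℝ (oneFormInChart J η x) y₀ = _ := hev.fderiv_eq.trans hd.fderiv
    rw [h]
    simp [hey₀]
    ring
  have h2 : ∀ w : TangentSpace J x, vecDeriv J q x w =
      fderiv ℝ (q ∘ e) y₀ (chartDifferential J x w) :=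
    vecDeriv_eq_comp_chartDifferential (hq.mdifferentiableAt (by simp))
  have h3 : ∀ w : TangentSpace J x, vecDeriv J p x w =
      fderiv ℝ (p ∘ e) y₀ (chartDifferential J x w) :=
    vecDeriv_eq_comp_chartDifferential (hp.mdifferentiableAt (by simp))
  rw [h2, h2, h3, h3]
  have hsq := hq'.isSymmSndFDerivAt (by simp) (chartDifferential J x u) (chartDifferential J x v)
  have hsz := hz'.isSymmSndFDerivAt (by simp) (chartDifferential J x u) (chartDifferential J x v)
  simp only [dOneForm, LinearMap.mk₂_apply, key, ← hy₀, hsq, hsz]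
  ring

end DarbouxForm

/-! ### The Jacobi structure of a contact form in Darboux coordinates -/

section DarbouxPoint

variable {F : Type*} [NormedAddCommGroup F] [NormedSpace ℝ F]
  {H : Type*} [TopologicalSpace H] {J : ModelWithCorners ℝ F H}
  {M : Type*} [TopologicalSpace M] [ChartedSpace H M]
  {E : Type*} [NormedAddCommGroup E] [NormedSpace ℝ E]

/-- `A` maps `η` and `dη` at `x` to `dz - p dq` and `dq ∧ dp`. -/
structure IsDarbouxAt (η : ∀ x : M, TangentSpace J x →L[ℝ] ℝ) (x : M)
    (A : TangentSpace J x ≃ₗ[ℝ] Jet E) (p : E →L[ℝ] ℝ) : Prop where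
  form_eq : ∀ u, η x u = (A u).2.2 - p (A u).1
  d_eq : ∀ u v, dOneForm J η x u v = (A v).2.1 (A u).1 - (A u).2.1 (A v).1

namespace IsDarbouxAt

variable {η : ∀ x : M, TangentSpace J x →L[ℝ] ℝ} {x : M} {A : TangentSpace J x ≃ₗ[ℝ] Jet E}
  {p : E →L[ℝ] ℝ} (h : IsDarbouxAt η x A p)

/-- A covector at `x` in Darboux coordinates. -/
def pull (A : TangentSpace J x ≃ₗ[ℝ] Jet E) (α : Jet E →L[ℝ] ℝ) :
    Module.Dual ℝ (TangentSpace J x) :=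
  (α : Jet E →ₗ[ℝ] ℝ).comp (A : TangentSpace J x →ₗ[ℝ] Jet E)

theorem pull_apply (α : Jet E →L[ℝ] ℝ) (u : TangentSpace J x) : pull A α u = α (A u) := rfl

include h

theorem flat_apply (u v : TangentSpace J x) : flat J η x u v =
    (A v).2.1 (A u).1 - (A u).2.1 (A v).1
      + ((A u).2.2 - p (A u).1) * ((A v).2.2 - p (A v).1) := by
  rw [← h.d_eq, ← h.form_eq, ← h.form_eq]
  rfl

/-- Since dη is alternating, ♭(u) evaluated on u is η(u)². Once η(u) = 0, testing i_u dη on momentum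
and position directions gives the remaining components. -/
theorem flat_injective : Function.Injective (flat J η x) := by
  rw [← LinearMap.ker_eq_bot, LinearMap.ker_eq_bot']
  intro u hu
  have h0 : ∀ v, flat J η x u v = 0 := fun v => by rw [hu]; rfl
  have h1 : (A u).2.2 - p (A u).1 = 0 := by
    have := h0 u
    rw [h.flat_apply, sub_self, zero_add] at this
    exact mul_self_eq_zero.1 this
  have h2 : (A u).1 = 0 := by
    refine (SeparatingDual.eq_zero_iff_forall_dual_eq_zero (R := ℝ) _).2 fun b => ?_
    have := h0 (A.symm (0, b, 0))
    rw [h.flat_apply, h1] at this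
    simpa using this
  have h3 : (A u).2.1 = 0 := by
    ext a
    have := h0 (A.symm (a, 0, 0))
    rw [h.flat_apply, h1] at this
    simpa using this
  have h4 : (A u).2.2 = 0 := by simpa [h2] using h1
  have : A u = 0 := Prod.ext h2 (Prod.ext h3 h4)
  simpa using this

/-- The two conditions on the Reeb vector say ♭(R) = η, so injectivity of ♭ determines the vector
that `Classical.epsilon` selects. -/
theorem reeb_eq : reeb J η x = A.symm (0, 0, 1) := by
  have h1 : ∃ R : TangentSpace J x, dOneForm J η x R = 0 ∧ η x R = 1 := by
    refine ⟨A.symm (0, 0, 1), ?_, ?_⟩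
    · ext v
      rw [h.d_eq]
      simp
    · rw [h.form_eq]
      simp
  have h2 : dOneForm J η x (reeb J η x) = 0 ∧ η x (reeb J η x) = 1 := Classical.epsilon_spec h1
  apply h.flat_injective
  ext v
  have h3 : flat J η x (reeb J η x) v = dOneForm J η x (reeb J η x) v
      + η x (reeb J η x) * η x v := rfl
  rw [h3, h2.1, h2.2, h.flat_apply, h.form_eq]
  simp

variable [FiniteDimensional ℝ E]

omit h in
theorem exists_eq_pull (α : Module.Dual ℝ (TangentSpace J x)) :
    ∃ α₀ : Jet E →L[ℝ] ℝ, α = pull A α₀ := by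
  refine ⟨LinearMap.toContinuousLinearMap (α.comp (A.symm : Jet E →ₗ[ℝ] TangentSpace J x)), ?_⟩
  ext u
  simp [pull]

/-- For A u = (a, b, c) one has ♭(u) = a dp - b dq + (c - p a)(dz - p dq). Comparing the
coefficients of dp, dz and dq with those of α yields a, c and b. -/
theorem flat_symm (α : Jet E →L[ℝ] ℝ) :
    flat J η x (A.symm (predual E (α.comp (inP E)), -α.comp (inQ E) - α (inZ E) • p,
      α (inZ E) + p (predual E (α.comp (inP E))))) = pull A α := by
  ext v
  rw [h.flat_apply, pull_apply, show α (A v) = _ from Jet.map_eq α (A v).1 (A v).2.1 (A v).2.2]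
  have h1 : (A v).2.1 (predual E (α.comp (inP E))) = α (0, (A v).2.1, 0) :=
    apply_predual _ _
  simp only [LinearEquiv.apply_symm_apply, h1, sub_apply, neg_apply, smul_apply,
    ContinuousLinearMap.comp_apply, inQ_apply, smul_eq_mul]
  ring

theorem flat_bijective : Function.Bijective (flat J η x) := by
  refine ⟨h.flat_injective, fun α => ?_⟩
  obtain ⟨α₀, rfl⟩ := exists_eq_pull (A := A) α
  exact ⟨_, h.flat_symm α₀⟩

theorem flat_sharp (α : Module.Dual ℝ (TangentSpace J x)) :
    flat J η x (sharp J η x α) = α := by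
  rw [sharp, dif_pos h.flat_bijective]
  exact LinearEquiv.apply_symm_apply (LinearEquiv.ofBijective (flat J η x) h.flat_bijective) α

theorem sharp_pull (α : Jet E →L[ℝ] ℝ) :
    sharp J η x (pull A α) = A.symm (predual E (α.comp (inP E)),
      -α.comp (inQ E) - α (inZ E) • p, α (inZ E) + p (predual E (α.comp (inP E)))) := by
  apply h.flat_injective
  rw [h.flat_sharp, h.flat_symm]

/-- Λ is the canonical bivector plus the wedge of the Liouville field p ∂/∂p with ∂/∂z. These are
the first-order terms of `linBracket` for δ = `jetLiouville E` and R = `inZ E`. -/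
theorem contactBivector_pull (α β : Jet E →L[ℝ] ℝ) :
    contactBivector J η x (pull A α) (pull A β) =
      β (jetSharp E α) + α (0, p, 0) * β (inZ E) - β (0, p, 0) * α (inZ E) := by
  have hα : ∀ b : E →L[ℝ] ℝ, b (predual E (α.comp (inP E))) = α (0, b, 0) := apply_predual _
  have hβ : ∀ b : E →L[ℝ] ℝ, b (predual E (β.comp (inP E))) = β (0, b, 0) := apply_predual _
  have hn : ∀ (γ : Jet E →L[ℝ] ℝ) (μ : E →L[ℝ] ℝ) (c : ℝ),
      γ (0, -μ - c • p, 0) = -γ (0, μ, 0) - c * γ (0, p, 0) := fun γ μ c => by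
    have := map_sub (γ.comp (inP E)) (-μ) (c • p)
    rwa [map_neg, map_smul, smul_eq_mul] at this
  have h2 : β (0, -α.comp (inQ E), 0) = -β (0, α.comp (inQ E), 0) := by
    simpa using hn β (α.comp (inQ E)) 0
  have h3 : β (predual E (α.comp (inP E)), 0, 0) = α (0, β.comp (inQ E), 0) :=
    apply_predual (α.comp (inP E)) (β.comp (inQ E))
  rw [contactBivector, h.sharp_pull, h.sharp_pull, h.d_eq, jetSharp_apply,
    Jet.map_eq β (predual E (α.comp (inP E))) (-α.comp (inQ E)) 0]
  simp only [LinearEquiv.apply_symm_apply, hα, hβ, h2, h3, hn]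
  ring

end IsDarbouxAt

end DarbouxPoint

/-! ### Adapted charts -/

section Adapted

variable {E : Type*} [NormedAddCommGroup E] [NormedSpace ℝ E]
  {Q : Type*} [TopologicalSpace Q] [ChartedSpace E Q] [IsManifold 𝓘(ℝ, E) ∞ Q]

/-- Darboux coordinates `(q, p, z)` of `η_L` near a point, a frame `X` of `Δ` in the coordinates `q`
and a parametrization `σ` of `Δ × ℝ` that is inverse to `(q, p(X_a), z)`. -/
structure AdaptedChart (L : Phase E Q → ℝ) (Δ : ∀ q : Q, Submodule ℝ (TangentSpace 𝓘(ℝ, E) q))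
    (x₀ : Phase E Q) where
  m : ℕ
  N : Set (Phase E Q)
  O : Set (FrameSpace E m)
  W : Set E
  q : Phase E Q → E
  p : Phase E Q → E →L[ℝ] ℝ
  X : Fin m → E → E
  σ : FrameSpace E m → Phase E Q
  isOpen_N : IsOpen N
  isOpen_O : IsOpen O
  isOpen_W : IsOpen W
  mem_N : x₀ ∈ N
  q_smooth : ContMDiffOn (phaseModel E) 𝓘(ℝ, E) ∞ q N
  p_smooth : ContMDiffOn (phaseModel E) 𝓘(ℝ, E →L[ℝ] ℝ) ∞ p N
  q_mem : ∀ x ∈ N, q x ∈ W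
  X_smooth : ∀ a, ContDiffOn ℝ ∞ (X a) W
  form_eq : ∀ x ∈ N, ∀ u : PhaseTangent x, etaL L x u =
    vecDeriv (phaseModel E) (Prod.snd : Phase E Q → ℝ) x u - p x (vecDeriv (phaseModel E) q x u)
  deriv_injective : ∀ x ∈ N, ∀ u : PhaseTangent x, vecDeriv (phaseModel E) q x u = 0 →
    vecDeriv (phaseModel E) p x u = 0 →
    vecDeriv (phaseModel E) (Prod.snd : Phase E Q → ℝ) x u = 0 → u = 0
  base_eq : ∀ x ∈ N, ∃ C : TangentSpace 𝓘(ℝ, E) x.1.proj ≃ₗ[ℝ] E,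
    (∀ u : PhaseTangent x, vecDeriv (phaseModel E) q x u = C (dBaseProj x u)) ∧
    (Δ x.1.proj).map (C : TangentSpace 𝓘(ℝ, E) x.1.proj →ₗ[ℝ] E) =
      Submodule.span ℝ (Set.range fun a => X a (q x))
  σ_smooth : ContMDiffOn 𝓘(ℝ, FrameSpace E m) (phaseModel E) ∞ σ O
  σ_mem : ∀ w ∈ O, σ w ∈ N ∧ σ w ∈ constraintSet Δ
  frame_mem : ∀ x ∈ N, frameMap X (q x, p x, x.2) ∈ O
  frame_σ : ∀ w ∈ O, frameMap X (q (σ w), p (σ w), (σ w).2) = w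
  σ_frame : ∀ x ∈ N, x ∈ constraintSet Δ → σ (frameMap X (q x, p x, x.2)) = x

namespace AdaptedChart

variable {L : Phase E Q → ℝ} {Δ : ∀ q : Q, Submodule ℝ (TangentSpace 𝓘(ℝ, E) q)}
  {x₀ : Phase E Q} (c : AdaptedChart L Δ x₀)

/-- The Darboux coordinates. -/
def coord (x : Phase E Q) : Jet E := (c.q x, c.p x, x.2)

/-- The coordinates on `Δ × ℝ`. -/
def frameCoord (x : Phase E Q) : FrameSpace E c.m := frameMap c.X (c.coord x)

theorem contMDiffOn_coord : ContMDiffOn (phaseModel E) 𝓘(ℝ, Jet E) ∞ c.coord c.N :=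
  c.q_smooth.prodMk_space (c.p_smooth.prodMk_space contMDiff_snd.contMDiffOn)

theorem contMDiffAt_coord {x : Phase E Q} (hx : x ∈ c.N) :
    ContMDiffAt (phaseModel E) 𝓘(ℝ, Jet E) ∞ c.coord x :=
  c.contMDiffOn_coord.contMDiffAt (c.isOpen_N.mem_nhds hx)

theorem contDiffAt_frameMap {x : Phase E Q} (hx : x ∈ c.N) :
    ContDiffAt ℝ ∞ (frameMap c.X) (c.coord x) :=
  (contDiffOn_frameMap c.X_smooth).contDiffAt
    ((c.isOpen_W.preimage continuous_fst).mem_nhds (c.q_mem x hx))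

theorem contMDiffAt_frameCoord {x : Phase E Q} (hx : x ∈ c.N) :
    ContMDiffAt (phaseModel E) 𝓘(ℝ, FrameSpace E c.m) ∞ c.frameCoord x :=
  (c.contDiffAt_frameMap hx).contMDiffAt.comp x (c.contMDiffAt_coord hx)

theorem differentiableAt_frame {x : Phase E Q} (hx : x ∈ c.N) (a : Fin c.m) :
    DifferentiableAt ℝ (c.X a) (c.coord x).1 :=
  ((c.X_smooth a).contDiffAt (c.isOpen_W.mem_nhds (c.q_mem x hx))).differentiableAt (by simp)

theorem vecDeriv_coord {x : Phase E Q} (hx : x ∈ c.N) (u : PhaseTangent x) :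
    vecDeriv (phaseModel E) c.coord x u = (vecDeriv (phaseModel E) c.q x u,
      vecDeriv (phaseModel E) c.p x u,
      vecDeriv (phaseModel E) (Prod.snd : Phase E Q → ℝ) x u) := by
  have hd : MDifferentiableAt (phaseModel E) 𝓘(ℝ, Jet E) c.coord x :=
    (c.contMDiffAt_coord hx).mdifferentiableAt (by simp)
  refine Prod.ext ?_ (Prod.ext ?_ ?_)
  · exact (vecDeriv_clm_comp (ContinuousLinearMap.fst ℝ E ((E →L[ℝ] ℝ) × ℝ)) hd u).symm
  · exact (vecDeriv_clm_comp ((ContinuousLinearMap.fst ℝ (E →L[ℝ] ℝ) ℝ).comp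
      (ContinuousLinearMap.snd ℝ E ((E →L[ℝ] ℝ) × ℝ))) hd u).symm
  · exact (vecDeriv_clm_comp ((ContinuousLinearMap.snd ℝ (E →L[ℝ] ℝ) ℝ).comp
      (ContinuousLinearMap.snd ℝ E ((E →L[ℝ] ℝ) × ℝ))) hd u).symm

theorem vecDeriv_comp_coord {G : Type*} [NormedAddCommGroup G] [NormedSpace ℝ G] {K : Jet E → G}
    {x : Phase E Q} (hx : x ∈ c.N) (hK : DifferentiableAt ℝ K (c.coord x)) (u : PhaseTangent x) :
    vecDeriv (phaseModel E) (K ∘ c.coord) x u =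
      fderiv ℝ K (c.coord x) (vecDeriv (phaseModel E) c.coord x u) :=
  vecDeriv_comp hK ((c.contMDiffAt_coord hx).mdifferentiableAt (by simp)) u

variable [FiniteDimensional ℝ E]

theorem finrank_jet : Module.finrank ℝ (Jet E) = Module.finrank ℝ ((E × E) × ℝ) := by
  have h : Module.finrank ℝ (E →L[ℝ] ℝ) = Module.finrank ℝ E :=
    (LinearMap.toContinuousLinearMap (𝕜 := ℝ) (E := E) (F' := ℝ)).finrank_eq.symm.trans
      Subspace.dual_finrank_eq
  simp only [Module.finrank_prod, h]
  ring

/-- The differential of the Darboux coordinates. -/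
def tangentEquiv {x : Phase E Q} (hx : x ∈ c.N) : PhaseTangent x ≃ₗ[ℝ] Jet E :=
  haveI : FiniteDimensional ℝ (PhaseTangent x) :=
    inferInstanceAs (FiniteDimensional ℝ ((E × E) × ℝ))
  LinearEquiv.ofInjectiveOfFinrankEq
    (vecDeriv (phaseModel E) c.coord x : PhaseTangent x →ₗ[ℝ] Jet E)
    (by
      refine LinearMap.ker_eq_bot.1 (LinearMap.ker_eq_bot'.2 fun u hu => ?_)
      have h := (c.vecDeriv_coord hx u).symm.trans hu
      exact c.deriv_injective x hx u (congrArg (fun y : Jet E => y.1) h)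
        (congrArg (fun y : Jet E => y.2.1) h) (congrArg (fun y : Jet E => y.2.2) h))
    finrank_jet.symm

theorem tangentEquiv_apply {x : Phase E Q} (hx : x ∈ c.N) (u : PhaseTangent x) :
    c.tangentEquiv hx u = vecDeriv (phaseModel E) c.coord x u := rfl

theorem isDarbouxAt {x : Phase E Q} (hx : x ∈ c.N) :
    IsDarbouxAt (etaL L) x (c.tangentEquiv hx) (c.p x) where
  form_eq u := by
    rw [c.form_eq x hx, tangentEquiv_apply, c.vecDeriv_coord hx]
  d_eq u v := by
    have hN := c.isOpen_N.mem_nhds hx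
    rw [dOneForm_of_eq_darboux ((c.q_smooth.contMDiffAt hN).of_le two_le_infty)
      ((c.p_smooth.contMDiffAt hN).of_le two_le_infty) contMDiffAt_snd
      (Filter.eventually_of_mem hN c.form_eq), tangentEquiv_apply, tangentEquiv_apply,
      c.vecDeriv_coord hx, c.vecDeriv_coord hx]

theorem dFun_comp {K : Jet E → ℝ} {x : Phase E Q} (hx : x ∈ c.N)
    (hK : DifferentiableAt ℝ K (c.coord x)) :
    dFun (phaseModel E) (K ∘ c.coord) x =
      IsDarbouxAt.pull (c.tangentEquiv hx) (fderiv ℝ K (c.coord x)) := by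
  ext u
  exact c.vecDeriv_comp_coord hx hK u

/-- ♯ sends μ dq to the momentum direction (0, -μ, 0), and μ annihilates Δ exactly when this
direction leaves every p(X_a) unchanged. This makes 𝒫 computable: 𝒮 is what the frame coordinates do
not see. -/
theorem mem_distS {x : Phase E Q} (hx : x ∈ c.N) (u : PhaseTangent x) :
    u ∈ distS L Δ x ↔ vecDeriv (phaseModel E) c.frameCoord x u = 0 := by
  have hframe : vecDeriv (phaseModel E) c.frameCoord x u = _ :=
    (c.vecDeriv_comp_coord hx ((c.contDiffAt_frameMap hx).differentiableAt (by simp)) u).trans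
      ((hasFDerivAt_frameMap (c.differentiableAt_frame hx)).2 _)
  rw [hframe, ← c.tangentEquiv_apply hx]
  obtain ⟨C, hC, hspan⟩ := c.base_eq x hx
  have hq : ∀ v, (c.tangentEquiv hx v).1 = C (dBaseProj x v) := fun v => by
    rw [← hC, tangentEquiv_apply, c.vecDeriv_coord hx]
  have hlift : ∀ ξ : Module.Dual ℝ (TangentSpace 𝓘(ℝ, E) x.1.proj), ∀ μ : E →L[ℝ] ℝ,
      (∀ v, ξ v = μ (C v)) →
      sharp (phaseModel E) (etaL L) x ((dBaseProj x : PhaseTangent x →ₗ[ℝ] _).dualMap ξ) =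
        (c.tangentEquiv hx).symm (0, -μ, 0) := fun ξ μ hμ => by
    have h : (dBaseProj x : PhaseTangent x →ₗ[ℝ] _).dualMap ξ =
        IsDarbouxAt.pull (c.tangentEquiv hx) (μ.comp (ContinuousLinearMap.fst ℝ E _)) := by
      ext v
      rw [IsDarbouxAt.pull_apply, ContinuousLinearMap.comp_apply, ContinuousLinearMap.coe_fst', hq]
      exact hμ _
    have h1 : predual E ((μ.comp (ContinuousLinearMap.fst ℝ E ((E →L[ℝ] ℝ) × ℝ))).comp (inP E)) = 0 :=
      predual_eq fun β => by simp
    have h2 : (μ.comp (ContinuousLinearMap.fst ℝ E ((E →L[ℝ] ℝ) × ℝ))).comp (inQ E) = μ := by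
      ext; simp
    rw [h, (c.isDarbouxAt hx).sharp_pull, h1, h2]
    simp [inZ]
  constructor
  · rintro ⟨_, ⟨ξ, hξ, rfl⟩, rfl⟩
    rw [hlift ξ (LinearMap.toContinuousLinearMap (ξ.comp (C.symm : E →ₗ[ℝ] _))) (fun v => by simp)]
    have hX : ∀ a, ξ (C.symm (c.X a (c.q x))) = 0 := fun a => by
      have : c.X a (c.q x) ∈ (Δ x.1.proj).map (C : TangentSpace 𝓘(ℝ, E) x.1.proj →ₗ[ℝ] E) := by
        rw [hspan]; exact Submodule.subset_span ⟨a, rfl⟩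
      obtain ⟨v, hv, hv'⟩ := this
      rw [← hv']
      simpa using (Submodule.mem_dualAnnihilator _).1 hξ v hv
    simp only [LinearEquiv.apply_symm_apply, map_zero, add_zero]
    refine Prod.ext rfl (Prod.ext (funext fun a => ?_) rfl)
    simpa [coord] using hX a
  · intro hu
    have h1 : (c.tangentEquiv hx u).1 = 0 := congrArg (fun w : FrameSpace E c.m => w.1) hu
    have h2 : ∀ a, (c.tangentEquiv hx u).2.1 (c.X a (c.q x)) = 0 := fun a => by
      have := congrFun (congrArg (fun w : FrameSpace E c.m => w.2.1) hu) a
      simpa [h1, coord] using this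
    have h3 : (c.tangentEquiv hx u).2.2 = 0 := congrArg (fun w : FrameSpace E c.m => w.2.2) hu
    set μ := (c.tangentEquiv hx u).2.1 with hμ
    refine ⟨_, ⟨(-(μ : E →ₗ[ℝ] ℝ)).comp (C : TangentSpace 𝓘(ℝ, E) x.1.proj →ₗ[ℝ] E), ?_, rfl⟩, ?_⟩
    · refine (Submodule.mem_dualAnnihilator _).2 fun v hv => ?_
      have hv' : C v ∈ Submodule.span ℝ (Set.range fun a => c.X a (c.q x)) := by
        rw [← hspan]; exact ⟨v, hv, rfl⟩
      have : Submodule.span ℝ (Set.range fun a => c.X a (c.q x)) ≤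
          LinearMap.ker (μ : E →ₗ[ℝ] ℝ) := Submodule.span_le.2 (by rintro _ ⟨a, rfl⟩; exact h2 a)
      have h4 : μ (C v) = 0 := this hv'
      simp [h4]
    · rw [hlift _ (-μ) (fun v => by simp), neg_neg, LinearEquiv.symm_apply_eq]
      exact Prod.ext h1.symm (Prod.ext rfl h3.symm)

end AdaptedChart

end Adapted

section Adapted

variable {E : Type*} [NormedAddCommGroup E] [NormedSpace ℝ E]
  {Q : Type*} [TopologicalSpace Q] [ChartedSpace E Q] [IsManifold 𝓘(ℝ, E) ∞ Q]

/-! ### The decomposition of the tangent spaces along `Δ × ℝ` -/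

namespace AdaptedChart

variable {L : Phase E Q → ℝ} {Δ : ∀ q : Q, Submodule ℝ (TangentSpace 𝓘(ℝ, E) q)}
  {x₀ : Phase E Q} (c : AdaptedChart L Δ x₀)

theorem frameCoord_mem {x : Phase E Q} (hx : x ∈ c.N) : c.frameCoord x ∈ c.O := c.frame_mem x hx

theorem frameCoord_σ {w : FrameSpace E c.m} (hw : w ∈ c.O) : c.frameCoord (c.σ w) = w :=
  c.frame_σ w hw

theorem σ_frameCoord {x : Phase E Q} (hx : x ∈ c.N) (hx' : x ∈ constraintSet Δ) :
    c.σ (c.frameCoord x) = x := c.σ_frame x hx hx'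

theorem contMDiffAt_σ {w : FrameSpace E c.m} (hw : w ∈ c.O) :
    ContMDiffAt 𝓘(ℝ, FrameSpace E c.m) (phaseModel E) ∞ c.σ w :=
  c.σ_smooth.contMDiffAt (c.isOpen_O.mem_nhds hw)

/-- The differential of `σ`. -/
def dσ (w : FrameSpace E c.m) : FrameSpace E c.m →L[ℝ] PhaseTangent (c.σ w) :=
  mfderiv 𝓘(ℝ, FrameSpace E c.m) (phaseModel E) c.σ w

theorem fderiv_comp_σ {G : Type*} [NormedAddCommGroup G] [NormedSpace ℝ G] {g : Phase E Q → G}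
    {w : FrameSpace E c.m} (hw : w ∈ c.O)
    (hg : MDifferentiableAt (phaseModel E) 𝓘(ℝ, G) g (c.σ w)) (k : FrameSpace E c.m) :
    fderiv ℝ (g ∘ c.σ) w k = vecDeriv (phaseModel E) g (c.σ w) (c.dσ w k) := by
  rw [← mfderiv_eq_fderiv]
  exact congrArg (fun l => l k)
    (mfderiv_comp w hg ((c.contMDiffAt_σ hw).mdifferentiableAt (by simp)))

theorem vecDeriv_frameCoord_dσ {w : FrameSpace E c.m} (hw : w ∈ c.O) (k : FrameSpace E c.m) :
    vecDeriv (phaseModel E) c.frameCoord (c.σ w) (c.dσ w k) = k := by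
  rw [← c.fderiv_comp_σ hw ((c.contMDiffAt_frameCoord (c.σ_mem w hw).1).mdifferentiableAt (by simp))]
  have h : c.frameCoord ∘ c.σ =ᶠ[𝓝 w] id := by
    filter_upwards [c.isOpen_O.mem_nhds hw] with w' hw' using c.frameCoord_σ hw'
  rw [h.fderiv_eq]
  simp

theorem dσ_mem_constraintTangent {w : FrameSpace E c.m} (hw : w ∈ c.O) (k : FrameSpace E c.m) :
    c.dσ w k ∈ constraintTangent Δ (c.σ w) := by
  refine (Submodule.mem_iInf _).2 fun ⟨F, hF, hF0⟩ => ?_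
  have h1 := c.fderiv_comp_σ hw (hF.mdifferentiableAt (by simp)) k
  have h2 : F ∘ c.σ =ᶠ[𝓝 w] fun _ => 0 := by
    filter_upwards [(c.contMDiffAt_σ hw).continuousAt.eventually hF0, c.isOpen_O.mem_nhds hw]
      with w' hw' hwO using hw' (c.σ_mem w' hwO).2
  rw [h2.fderiv_eq, fderiv_fun_const] at h1
  exact h1.symm

/-- The map `c.coord - (c.coord ∘ c.σ) ∘ c.frameCoord` vanishes on Δ × ℝ, so its composites with
linear functionals are admissible test functions for `constraintTangent`. A tangent vector killed by
the frame coordinates is then killed by the Darboux coordinates, whose differential is injective. -/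
theorem eq_zero_of_mem_constraintTangent {w : FrameSpace E c.m} (hw : w ∈ c.O)
    {u : PhaseTangent (c.σ w)} (hu : u ∈ constraintTangent Δ (c.σ w))
    (hu' : vecDeriv (phaseModel E) c.frameCoord (c.σ w) u = 0) : u = 0 := by
  obtain ⟨hN, hΔ⟩ := c.σ_mem w hw
  have hcoord : ContMDiffAt (phaseModel E) 𝓘(ℝ, Jet E) ∞ c.coord (c.σ w) := c.contMDiffAt_coord hN
  have hr : ContMDiffAt 𝓘(ℝ, FrameSpace E c.m) 𝓘(ℝ, Jet E) ∞ (c.coord ∘ c.σ)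
      (c.frameCoord (c.σ w)) := by
    rw [c.frameCoord_σ hw]
    exact hcoord.comp w (c.contMDiffAt_σ hw)
  have hr' : DifferentiableAt ℝ (c.coord ∘ c.σ) (c.frameCoord (c.σ w)) :=
    hr.contDiffAt.differentiableAt (by simp)
  have hfr := c.contMDiffAt_frameCoord hN
  have key : vecDeriv (phaseModel E) c.coord (c.σ w) u = 0 := by
    refine (SeparatingDual.eq_zero_iff_forall_dual_eq_zero (R := ℝ) _).2 fun l => ?_
    have hdiff : ContMDiffAt (phaseModel E) 𝓘(ℝ, Jet E) ∞
        (fun x => c.coord x - (c.coord ∘ c.σ) (c.frameCoord x)) (c.σ w) :=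
      hcoord.sub (hr.comp (c.σ w) hfr)
    have hloc : IsLocalExtension Δ (fun _ => 0) (c.σ w)
        (l ∘ fun x => c.coord x - (c.coord ∘ c.σ) (c.frameCoord x)) := by
      refine ⟨l.contMDiff.contMDiffAt.comp _ hdiff, ?_⟩
      filter_upwards [c.isOpen_N.mem_nhds hN] with x hx hx'
      simp [c.σ_frameCoord hx hx']
    have h1 : vecDeriv (phaseModel E)
        (l ∘ fun x => c.coord x - (c.coord ∘ c.σ) (c.frameCoord x)) (c.σ w) u = 0 :=
      (Submodule.mem_iInf _).1 hu ⟨_, hloc⟩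
    rw [vecDeriv_clm_comp l (hdiff.mdifferentiableAt (by simp))] at h1
    have h2 : vecDeriv (phaseModel E)
        (fun x => c.coord x - (c.coord ∘ c.σ) (c.frameCoord x)) (c.σ w) u =
        vecDeriv (phaseModel E) c.coord (c.σ w) u - vecDeriv (phaseModel E)
          ((c.coord ∘ c.σ) ∘ c.frameCoord) (c.σ w) u :=
      congrArg (fun l => l u) (mfderiv_sub (hcoord.mdifferentiableAt (by simp))
        ((hr.comp (c.σ w) hfr).mdifferentiableAt (by simp)))
    rw [h2, vecDeriv_comp hr' (hfr.mdifferentiableAt (by simp)), hu', map_zero, sub_zero] at h1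
    exact h1
  rw [c.vecDeriv_coord hN] at key
  exact c.deriv_injective _ hN u (congrArg (fun y : Jet E => y.1) key)
    (congrArg (fun y : Jet E => y.2.1) key) (congrArg (fun y : Jet E => y.2.2) key)

theorem isLocalExtension_comp_frameCoord {f : constraintSet Δ → ℝ} {φ : FrameSpace E c.m → ℝ}
    {x : Phase E Q} (hx : x ∈ c.N) (hφ : ContDiffAt ℝ ∞ φ (c.frameCoord x))
    (hf : ∀ᶠ y in 𝓝 x, ∀ hy : y ∈ constraintSet Δ, φ (c.frameCoord y) = f ⟨y, hy⟩) :
    IsLocalExtension Δ f x (φ ∘ c.frameCoord) :=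
  ⟨hφ.contMDiffAt.comp x (c.contMDiffAt_frameCoord hx), hf⟩

variable [FiniteDimensional ℝ E]

/-- The differential of the frame coordinates has kernel 𝒮, is injective on T(Δ × ℝ), and has the
right inverse dσ with values in T(Δ × ℝ). -/
theorem isCompl {x : Phase E Q} (hx : x ∈ c.N) (hx' : x ∈ constraintSet Δ) :
    IsCompl (constraintTangent Δ x) (distS L Δ x) := by
  obtain ⟨w, hw, rfl⟩ : ∃ w ∈ c.O, c.σ w = x := ⟨_, c.frameCoord_mem hx, c.σ_frameCoord hx hx'⟩
  constructor
  · refine Submodule.disjoint_def.2 fun u hu hu' => ?_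
    exact c.eq_zero_of_mem_constraintTangent hw hu ((c.mem_distS hx u).1 hu')
  · refine codisjoint_iff.2 (eq_top_iff.2 fun u _ => ?_)
    set k := vecDeriv (phaseModel E) c.frameCoord (c.σ w) u with hk
    refine Submodule.mem_sup.2 ⟨c.dσ w k, c.dσ_mem_constraintTangent hw k, u - c.dσ w k, ?_,
      add_sub_cancel _ _⟩
    rw [c.mem_distS hx, map_sub, c.vecDeriv_frameCoord_dσ hw, ← hk, sub_self]

/-! ### The nonholonomic bracket in an adapted chart -/

/-- The bracket in the coordinates on `Δ × ℝ`. -/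
def frameBracket (f g : FrameSpace E c.m → ℝ) (w : FrameSpace E c.m) : ℝ :=
  jetBracket (f ∘ frameMap c.X) (g ∘ frameMap c.X) (c.coord (c.σ w))

/-- F and `φ ∘ c.frameCoord` extend the same function, so their differentials agree on T(Δ × ℝ), and
the second one vanishes on 𝒮. Hence it equals 𝒫^* dF. -/
theorem dFun_projP {f : constraintSet Δ → ℝ} {φ : FrameSpace E c.m → ℝ}
    {x : Phase E Q} (hx : x ∈ c.N) (hx' : x ∈ constraintSet Δ)
    (hφ : ContDiffAt ℝ ∞ φ (c.frameCoord x))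
    (hf : ∀ᶠ y in 𝓝 x, ∀ hy : y ∈ constraintSet Δ, φ (c.frameCoord y) = f ⟨y, hy⟩)
    {F : Phase E Q → ℝ} (hF : IsLocalExtension Δ f x F) (u : PhaseTangent x) :
    dFun (phaseModel E) F x (projP L Δ x u) =
      dFun (phaseModel E) (φ ∘ c.frameCoord) x u := by
  have hφF := c.isLocalExtension_comp_frameCoord hx hφ hf
  have hloc : IsLocalExtension Δ (fun _ => 0) x (fun y => F y - (φ ∘ c.frameCoord) y) := by
    refine ⟨hF.1.sub hφF.1, ?_⟩
    filter_upwards [hF.2, hφF.2] with y h1 h2 hy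
    rw [h1 hy, h2 hy, sub_self]
  have h1 : ∀ v ∈ constraintTangent Δ x,
      dFun (phaseModel E) F x v = dFun (phaseModel E) (φ ∘ c.frameCoord) x v := fun v hv => by
    have h2 : dFun (phaseModel E) (fun y => F y - (φ ∘ c.frameCoord) y) x v = 0 :=
      (Submodule.mem_iInf _).1 hv ⟨_, hloc⟩
    have h3 : dFun (phaseModel E) (fun y => F y - (φ ∘ c.frameCoord) y) x v =
        dFun (phaseModel E) F x v - dFun (phaseModel E) (φ ∘ c.frameCoord) x v :=
      congrArg (fun l => l v) (mfderiv_sub (hF.1.mdifferentiableAt (by simp))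
        (hφF.1.mdifferentiableAt (by simp)))
    exact sub_eq_zero.1 (h3.symm.trans h2)
  have hc := c.isCompl hx hx'
  have hP : projP L Δ x = Submodule.projection _ _ hc := dif_pos hc
  have hmem : projP L Δ x u ∈ constraintTangent Δ x := by
    rw [hP]; exact Submodule.projection_apply_mem _ _
  have hker : u - projP L Δ x u ∈ distS L Δ x := by
    rw [hP]; exact Submodule.sub_projection_mem hc u
  have h4 : dFun (phaseModel E) (φ ∘ c.frameCoord) x (u - projP L Δ x u) = 0 := by
    have : vecDeriv (phaseModel E) (φ ∘ c.frameCoord) x (u - projP L Δ x u) = 0 := by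
      rw [vecDeriv_comp (hφ.differentiableAt (by simp))
        ((c.contMDiffAt_frameCoord hx).mdifferentiableAt (by simp)),
        (c.mem_distS hx _).1 hker, map_zero]
    exact this
  rw [map_sub, sub_eq_zero] at h4
  rw [h1 _ hmem, h4]

/-- By `dFun_projP` the projector can be traded for the particular extension `φ ∘ c.frameCoord`,
both in the bivector and in the Reeb terms. The extensions chosen in `nhBracket` disappear, and an
unconstrained contact bracket is left. -/
theorem nhBracket_eq {f g : constraintSet Δ → ℝ} {φ ψ : FrameSpace E c.m → ℝ}
    {x : Phase E Q} (hx : x ∈ c.N) (hx' : x ∈ constraintSet Δ)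
    (hφ : ContDiffAt ℝ ∞ φ (c.frameCoord x)) (hψ : ContDiffAt ℝ ∞ ψ (c.frameCoord x))
    (hf : ∀ᶠ y in 𝓝 x, ∀ hy : y ∈ constraintSet Δ, φ (c.frameCoord y) = f ⟨y, hy⟩)
    (hg : ∀ᶠ y in 𝓝 x, ∀ hy : y ∈ constraintSet Δ, ψ (c.frameCoord y) = g ⟨y, hy⟩) :
    nhBracket L Δ f g ⟨x, hx'⟩ =
      jetBracket (φ ∘ frameMap c.X) (ψ ∘ frameMap c.X) (c.coord x) := by
  have hF : IsLocalExtension Δ f x (Classical.epsilon (IsLocalExtension Δ f x)) :=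
    Classical.epsilon_spec ⟨_, c.isLocalExtension_comp_frameCoord hx hφ hf⟩
  have hG : IsLocalExtension Δ g x (Classical.epsilon (IsLocalExtension Δ g x)) :=
    Classical.epsilon_spec ⟨_, c.isLocalExtension_comp_frameCoord hx hψ hg⟩
  unfold nhBracket
  generalize Classical.epsilon (IsLocalExtension Δ f x) = F at hF ⊢
  generalize Classical.epsilon (IsLocalExtension Δ g x) = G at hG ⊢
  have hdF := c.dFun_projP hx hx' hφ hf hF
  have hdG := c.dFun_projP hx hx' hψ hg hG
  have hFx : F x = φ (c.frameCoord x) :=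
    (hF.2.self_of_nhds hx').trans (hf.self_of_nhds hx').symm
  have hGx : G x = ψ (c.frameCoord x) :=
    (hG.2.self_of_nhds hx').trans (hg.self_of_nhds hx').symm
  have hd : ∀ {χ : FrameSpace E c.m → ℝ}, ContDiffAt ℝ ∞ χ (c.frameCoord x) →
      dFun (phaseModel E) (χ ∘ c.frameCoord) x = IsDarbouxAt.pull (c.tangentEquiv hx)
        (fderiv ℝ (χ ∘ frameMap c.X) (c.coord x)) := fun hχ =>
    c.dFun_comp hx (DifferentiableAt.comp (c.coord x) (hχ.differentiableAt (by simp))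
      ((c.contDiffAt_frameMap hx).differentiableAt (by simp)))
  have hPF : (projP L Δ x).dualMap (dFun (phaseModel E) F x) = _ :=
    (LinearMap.ext hdF).trans (hd hφ)
  have hPG : (projP L Δ x).dualMap (dFun (phaseModel E) G x) = _ :=
    (LinearMap.ext hdG).trans (hd hψ)
  have hR : reeb (phaseModel E) (etaL L) x = _ := (c.isDarbouxAt hx).reeb_eq
  rw [ambientBracket, bivectorLΔ, hPF, hPG, reebLΔ, hdF, hdG, hd hφ, hd hψ, hFx, hGx,
    (c.isDarbouxAt hx).contactBivector_pull, hR, IsDarbouxAt.pull_apply, IsDarbouxAt.pull_apply,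
    LinearEquiv.apply_symm_apply]
  simp only [jetBracket, linBracket, hamField, jetLiouville_apply, map_add, map_sub, map_smul,
    smul_eq_mul, Function.comp_apply]
  have h1 : c.frameCoord x = frameMap c.X (c.coord x) := rfl
  have h2 : (c.coord x).2.1 = c.p x := rfl
  have h3 : ((0, 0, 1) : Jet E) = inZ E := rfl
  rw [h1, h2, h3]
  ring

end AdaptedChart

end Adapted

section Adapted

variable {E : Type*} [NormedAddCommGroup E] [NormedSpace ℝ E]
  {Q : Type*} [TopologicalSpace Q] [ChartedSpace E Q] [IsManifold 𝓘(ℝ, E) ∞ Q]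

/-! ### The Jacobi identity in adapted charts -/

namespace AdaptedChart

variable {L : Phase E Q → ℝ} {Δ : ∀ q : Q, Submodule ℝ (TangentSpace 𝓘(ℝ, E) q)}
  {x₀ : Phase E Q} (c : AdaptedChart L Δ x₀)

open Classical in
/-- A function on `Δ × ℝ` in the coordinates. -/
def read (f : constraintSet Δ → ℝ) (w : FrameSpace E c.m) : ℝ :=
  if h : c.σ w ∈ constraintSet Δ then f ⟨c.σ w, h⟩ else 0

theorem read_apply (f : constraintSet Δ → ℝ) {w : FrameSpace E c.m} (hw : w ∈ c.O) :
    c.read f w = f ⟨c.σ w, (c.σ_mem w hw).2⟩ := dif_pos _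

theorem read_frameCoord (f : constraintSet Δ → ℝ) {x : Phase E Q} (hx : x ∈ c.N)
    (hx' : x ∈ constraintSet Δ) : c.read f (c.frameCoord x) = f ⟨x, hx'⟩ := by
  rw [c.read_apply f (c.frameCoord_mem hx)]
  congr 1
  exact Subtype.ext (c.σ_frameCoord hx hx')

theorem eventually_read (f : constraintSet Δ → ℝ) {x : Phase E Q} (hx : x ∈ c.N) :
    ∀ᶠ y in 𝓝 x, ∀ hy : y ∈ constraintSet Δ, c.read f (c.frameCoord y) = f ⟨y, hy⟩ := by
  filter_upwards [c.isOpen_N.mem_nhds hx] with y hy hy' using c.read_frameCoord f hy hy'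

theorem contDiffOn_read {f : constraintSet Δ → ℝ} (hf : IsSmoothOnConstraint Δ f) :
    ContDiffOn ℝ ∞ (c.read f) c.O := by
  intro w hw
  obtain ⟨F, hF, hFf⟩ := hf ⟨c.σ w, (c.σ_mem w hw).2⟩
  have h1 : ContDiffAt ℝ ∞ (F ∘ c.σ) w := (hF.comp w (c.contMDiffAt_σ hw)).contDiffAt
  refine (h1.congr_of_eventuallyEq ?_).contDiffWithinAt
  filter_upwards [(c.contMDiffAt_σ hw).continuousAt.eventually hFf, c.isOpen_O.mem_nhds hw]
    with w' h hw'
  rw [c.read_apply f hw', Function.comp_apply, h]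

/-- The domain of the coordinates in `E × E* × ℝ`. -/
def jetDomain : Set (Jet E) := {y | y.1 ∈ c.W} ∩ frameMap c.X ⁻¹' c.O

theorem isOpen_jetDomain : IsOpen c.jetDomain :=
  (contDiffOn_frameMap c.X_smooth).continuousOn.isOpen_inter_preimage
    (c.isOpen_W.preimage continuous_fst) c.isOpen_O

theorem coord_mem_jetDomain {x : Phase E Q} (hx : x ∈ c.N) : c.coord x ∈ c.jetDomain :=
  ⟨c.q_mem x hx, c.frame_mem x hx⟩

theorem contDiffOn_comp_frameMap {φ : FrameSpace E c.m → ℝ} (hφ : ContDiffOn ℝ ∞ φ c.O) :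
    ContDiffOn ℝ ∞ (φ ∘ frameMap c.X) c.jetDomain :=
  hφ.comp ((contDiffOn_frameMap c.X_smooth).mono Set.inter_subset_left) Set.inter_subset_right

variable [FiniteDimensional ℝ E]

theorem contDiffOn_frameBracket {φ ψ : FrameSpace E c.m → ℝ} (hφ : ContDiffOn ℝ ∞ φ c.O)
    (hψ : ContDiffOn ℝ ∞ ψ c.O) : ContDiffOn ℝ ∞ (c.frameBracket φ ψ) c.O := by
  have h1 : ContDiffOn ℝ ∞ (c.coord ∘ c.σ) c.O := contMDiffOn_iff_contDiffOn.1
    (c.contMDiffOn_coord.comp c.σ_smooth fun w hw => (c.σ_mem w hw).1)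
  exact (contDiffOn_linBracket c.isOpen_jetDomain (c.contDiffOn_comp_frameMap hφ)
    (c.contDiffOn_comp_frameMap hψ)).comp h1 fun w hw => c.coord_mem_jetDomain (c.σ_mem w hw).1

theorem nhBracket_eq_read {f g : constraintSet Δ → ℝ} (hf : IsSmoothOnConstraint Δ f)
    (hg : IsSmoothOnConstraint Δ g) {x : Phase E Q} (hx : x ∈ c.N) (hx' : x ∈ constraintSet Δ) :
    nhBracket L Δ f g ⟨x, hx'⟩ =
      jetBracket (c.read f ∘ frameMap c.X) (c.read g ∘ frameMap c.X) (c.coord x) := by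
  have hO := c.isOpen_O.mem_nhds (c.frameCoord_mem hx)
  exact c.nhBracket_eq hx hx' ((c.contDiffOn_read hf).contDiffAt hO)
    ((c.contDiffOn_read hg).contDiffAt hO) (c.eventually_read f hx) (c.eventually_read g hx)

theorem read_nhBracket {f g : constraintSet Δ → ℝ} (hf : IsSmoothOnConstraint Δ f)
    (hg : IsSmoothOnConstraint Δ g) {w : FrameSpace E c.m} (hw : w ∈ c.O) :
    c.read (nhBracket L Δ f g) w = c.frameBracket (c.read f) (c.read g) w := by
  rw [c.read_apply _ hw, c.nhBracket_eq_read hf hg (c.σ_mem w hw).1]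
  rfl

/-- The equality is needed on a full neighbourhood in E × E* × ℝ, since an outer contact bracket
differentiates in all momentum directions. A point y and the point of the Legendre image of Δ × ℝ
with the same frame coordinates give the same bracket by involutivity. -/
theorem jetBracket_read_eventuallyEq
    (hinv : ∀ x ∈ c.N, ∀ a b, VectorField.lieBracket ℝ (c.X a) (c.X b) (c.q x) ∈
      Submodule.span ℝ (Set.range fun d => c.X d (c.q x)))
    {f g : constraintSet Δ → ℝ} (hf : IsSmoothOnConstraint Δ f)
    (hg : IsSmoothOnConstraint Δ g) {x : Phase E Q} (hx : x ∈ c.N) :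
    c.read (nhBracket L Δ f g) ∘ frameMap c.X =ᶠ[𝓝 (c.coord x)]
      jetBracket (c.read f ∘ frameMap c.X) (c.read g ∘ frameMap c.X) := by
  filter_upwards [c.isOpen_jetDomain.mem_nhds (c.coord_mem_jetDomain hx)] with y hy
  have hyO : frameMap c.X y ∈ c.O := hy.2
  have hΘ : frameMap c.X (c.coord (c.σ (frameMap c.X y))) = frameMap c.X y := c.frameCoord_σ hyO
  have hN := (c.σ_mem _ hyO).1
  rw [Function.comp_apply, c.read_nhBracket hf hg hyO, frameBracket]
  have hO : c.O ∈ 𝓝 (frameMap c.X (c.coord (c.σ (frameMap c.X y)))) := by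
    rw [hΘ]; exact c.isOpen_O.mem_nhds hyO
  exact jetBracket_comp_frameMap_eq (c.differentiableAt_frame hN)
    (((c.contDiffOn_read hf).contDiffAt hO).differentiableAt (by simp))
    (((c.contDiffOn_read hg).contDiffAt hO).differentiableAt (by simp)) hΘ
    (hinv _ hN)

end AdaptedChart

variable {L : Phase E Q → ℝ} {Δ : ∀ q : Q, Submodule ℝ (TangentSpace 𝓘(ℝ, E) q)}
  [FiniteDimensional ℝ E]

/-- `nhBracket` chooses extensions point by point, and smoothness comes from its expression
`frameBracket`. Involutivity plays no role, so iterated brackets are available in both implications.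
-/
theorem isSmoothOnConstraint_nhBracket
    (hc : ∀ x ∈ constraintSet Δ, Nonempty (AdaptedChart L Δ x)) {f g : constraintSet Δ → ℝ}
    (hf : IsSmoothOnConstraint Δ f) (hg : IsSmoothOnConstraint Δ g) :
    IsSmoothOnConstraint Δ (nhBracket L Δ f g) := by
  intro x
  obtain ⟨c⟩ := hc x x.2
  refine ⟨_, c.isLocalExtension_comp_frameCoord c.mem_N
    ((c.contDiffOn_frameBracket (c.contDiffOn_read hf) (c.contDiffOn_read hg)).contDiffAt
      (c.isOpen_O.mem_nhds (c.frameCoord_mem c.mem_N))) ?_⟩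
  filter_upwards [c.eventually_read (nhBracket L Δ f g) c.mem_N, c.isOpen_N.mem_nhds c.mem_N]
    with y hy hN hy'
  rw [← c.read_nhBracket hf hg (c.frameCoord_mem hN), hy hy']

theorem satisfiesJacobi_of_lieBracket_mem
    (hc : ∀ x ∈ constraintSet Δ, ∃ c : AdaptedChart L Δ x,
      ∀ x ∈ c.N, ∀ a b, VectorField.lieBracket ℝ (c.X a) (c.X b) (c.q x) ∈
        Submodule.span ℝ (Set.range fun d => c.X d (c.q x))) :
    SatisfiesJacobi L Δ := by
  have hc' : ∀ x ∈ constraintSet Δ, Nonempty (AdaptedChart L Δ x) := fun x hx => ⟨(hc x hx).choose⟩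
  intro f g h hf hg hh ⟨x, hx⟩
  obtain ⟨c, hinv⟩ := hc x hx
  have hgh := isSmoothOnConstraint_nhBracket hc' hg hh
  have hhf := isSmoothOnConstraint_nhBracket hc' hh hf
  have hfg := isSmoothOnConstraint_nhBracket hc' hf hg
  have hJ : c.jetDomain ∈ 𝓝 (c.coord x) :=
    c.isOpen_jetDomain.mem_nhds (c.coord_mem_jetDomain c.mem_N)
  have hs : ∀ {k : constraintSet Δ → ℝ}, IsSmoothOnConstraint Δ k →
      ContDiffAt ℝ 2 (c.read k ∘ frameMap c.X) (c.coord x) := fun hk =>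
    ((c.contDiffOn_comp_frameMap (c.contDiffOn_read hk)).contDiffAt hJ).of_le two_le_infty
  -- The inner nonholonomic bracket may be replaced by the contact bracket because `linBracket`
  -- depends only on germs.
  have hcongr : ∀ {k l l' : constraintSet Δ → ℝ}, IsSmoothOnConstraint Δ l →
      IsSmoothOnConstraint Δ l' →
      jetBracket (c.read k ∘ frameMap c.X) (c.read (nhBracket L Δ l l') ∘ frameMap c.X)
        (c.coord x) = jetBracket (c.read k ∘ frameMap c.X)
        (jetBracket (c.read l ∘ frameMap c.X) (c.read l' ∘ frameMap c.X)) (c.coord x) :=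
    fun hl hl' => linBracket_congr Filter.EventuallyEq.rfl
      (c.jetBracket_read_eventuallyEq hinv hl hl' c.mem_N)
  rw [c.nhBracket_eq_read hf hgh c.mem_N, c.nhBracket_eq_read hg hhf c.mem_N,
    c.nhBracket_eq_read hh hfg c.mem_N, hcongr hg hh, hcongr hh hf, hcongr hf hg]
  exact jetBracket_jacobi (hs hf) (hs hg) (hs hh)

/-! ### Cutting off functions on Δ × ℝ -/

omit [IsManifold 𝓘(ℝ, E) ∞ Q] [FiniteDimensional ℝ E] in
-- Needed for bump functions on TQ × ℝ. Vectors over distinct points are separated by the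
-- projection, vectors over the same point by a trivialization.
theorem t2Space_tangentBundle [IsManifold 𝓘(ℝ, E) 1 Q] [T2Space Q] :
    T2Space (TangentBundle 𝓘(ℝ, E) Q) := by
  refine ⟨fun v w hvw => ?_⟩
  by_cases h : v.proj = w.proj
  · have hv : v ∈ (trivializationAt E (TangentSpace 𝓘(ℝ, E)) v.proj).source := by
      simp
    have hw : w ∈ (trivializationAt E (TangentSpace 𝓘(ℝ, E)) v.proj).source := by
      rw [Bundle.Trivialization.mem_source, ← h]; simp
    set e := trivializationAt E (TangentSpace 𝓘(ℝ, E)) v.proj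
    have hne : e v ≠ e w := fun he => hvw (e.injOn hv hw he)
    obtain ⟨A, B, hA, hB, hvA, hwB, hAB⟩ := t2_separation hne
    refine ⟨e.source ∩ e ⁻¹' A, e.source ∩ e ⁻¹' B, e.isOpen_inter_preimage hA,
      e.isOpen_inter_preimage hB, ⟨hv, hvA⟩, ⟨hw, hwB⟩, ?_⟩
    exact Disjoint.mono Set.inter_subset_right Set.inter_subset_right (hAB.preimage e)
  · obtain ⟨A, B, hA, hB, hvA, hwB, hAB⟩ := t2_separation h
    have hcont := FiberBundle.continuous_proj E (TangentSpace 𝓘(ℝ, E) : Q → Type _)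
    exact ⟨_, _, hA.preimage hcont, hB.preimage hcont, hvA, hwB, hAB.preimage _⟩

/-- A smooth function of the coordinates on `Δ × ℝ` agrees near the base point with a smooth
function on `Δ × ℝ`. -/
theorem AdaptedChart.exists_isSmoothOnConstraint [T2Space Q] {x₀ : Phase E Q}
    (c : AdaptedChart L Δ x₀) {φ : FrameSpace E c.m → ℝ} (hφ : ContDiff ℝ ∞ φ) :
    ∃ f : constraintSet Δ → ℝ, IsSmoothOnConstraint Δ f ∧
      ∀ᶠ y in 𝓝 x₀, ∀ hy : y ∈ constraintSet Δ, φ (c.frameCoord y) = f ⟨y, hy⟩ := by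
  have : IsManifold 𝓘(ℝ, E) 1 Q := IsManifold.of_le (n := ∞) (by simp)
  have := t2Space_tangentBundle (E := E) (Q := Q)
  obtain ⟨ρ, -, hρ⟩ := (SmoothBumpFunction.nhds_basis_tsupport (I := phaseModel E) x₀).mem_iff.1
    (c.isOpen_N.mem_nhds c.mem_N)
  -- The frame coordinates are known to be smooth only on `c.N`, which contains the closed support
  -- of ρ.
  have hsm : ContMDiff (phaseModel E) 𝓘(ℝ, ℝ) ∞ fun x => ρ x • (φ ∘ c.frameCoord) x := by
    refine contMDiff_of_tsupport fun x hx => ?_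
    have hxN : x ∈ c.N := hρ (tsupport_smul_subset_left _ _ hx)
    exact ρ.contMDiffAt.smul (hφ.contMDiff.contMDiffAt.comp x (c.contMDiffAt_frameCoord hxN))
  refine ⟨fun x => ρ x • (φ ∘ c.frameCoord) x, fun x => ⟨_, hsm.contMDiffAt,
    Filter.Eventually.of_forall fun y _ => rfl⟩, ?_⟩
  filter_upwards [ρ.eventuallyEq_one] with y hy _
  simp [hy]

end Adapted

/-! ### Brackets of functions of q with the momenta along the frame -/

section FrameExamples

variable {E : Type*} [NormedAddCommGroup E] [NormedSpace ℝ E] [FiniteDimensional ℝ E]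
  {m : ℕ} {X : Fin m → E → E}

omit [FiniteDimensional ℝ E] in
theorem hasFDerivAt_basic {ζ : E → ℝ} {w : FrameSpace E m} (hζ : DifferentiableAt ℝ ζ w.1) :
    HasFDerivAt (fun w : FrameSpace E m => ζ w.1)
      ((fderiv ℝ ζ w.1).comp (ContinuousLinearMap.fst ℝ E ((Fin m → ℝ) × ℝ))) w :=
  hζ.hasFDerivAt.comp w hasFDerivAt_fst

/-- The momentum along the `a`-th vector of the frame. -/
def momentum (E : Type*) [NormedAddCommGroup E] [NormedSpace ℝ E] {m : ℕ} (a : Fin m) :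
    FrameSpace E m →L[ℝ] ℝ :=
  (ContinuousLinearMap.proj a).comp ((ContinuousLinearMap.fst ℝ (Fin m → ℝ) ℝ).comp
    (ContinuousLinearMap.snd ℝ E ((Fin m → ℝ) × ℝ)))

omit [FiniteDimensional ℝ E] in
theorem momentum_apply (a : Fin m) (w : FrameSpace E m) : momentum E a w = w.2.1 a := rfl

/-- A function of q alone has no derivative in the momenta or in z, so the curvature and Liouville
terms drop out. -/
theorem jetBracket_basic {ζ : E → ℝ} {k : FrameSpace E m → ℝ} {y : Jet E}
    (hX : ∀ a, DifferentiableAt ℝ (X a) y.1) (hζ : DifferentiableAt ℝ ζ y.1)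
    (hk : DifferentiableAt ℝ k (frameMap X y)) :
    jetBracket ((fun w : FrameSpace E m => ζ w.1) ∘ frameMap X) (k ∘ frameMap X) y =
      - fderiv ℝ ζ y.1 (frameSymbol X k (frameMap X y))
        - ζ y.1 * fderiv ℝ k (frameMap X y) (0, 0, 1) := by
  have h := hasFDerivAt_basic (m := m) (w := frameMap X y) hζ
  rw [jetBracket_comp_frameMap hX h.differentiableAt hk]
  have h0 : ((0 : E), (0 : Fin m → ℝ), (0 : ℝ)) = 0 := rfl
  have h1 : (frameMap X y).1 = y.1 := rfl
  simp [frameSymbol, frameCurvature, h.fderiv, h0, h1]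

/-- The symbol of a momentum is the frame vector itself. Bracketing with momenta thus differentiates
along the frame, and this makes Lie brackets visible to the Jacobi identity. -/
theorem jetBracket_momentum_basic {ζ : E → ℝ} {y : Jet E} (a : Fin m)
    (hX : ∀ a, DifferentiableAt ℝ (X a) y.1) (hζ : DifferentiableAt ℝ ζ y.1) :
    jetBracket (momentum E a ∘ frameMap X) ((fun w : FrameSpace E m => ζ w.1) ∘ frameMap X) y =
      fderiv ℝ ζ y.1 (X a y.1) := by
  have h := hasFDerivAt_basic (m := m) (w := frameMap X y) hζ
  rw [jetBracket_comp_frameMap hX (momentum E a).differentiableAt h.differentiableAt]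
  have h0 : ((0 : E), (0 : Fin m → ℝ), (0 : ℝ)) = 0 := rfl
  have h1 : (frameMap X y).1 = y.1 := rfl
  simp [frameSymbol, frameCurvature, h.fderiv, h0, h1, (momentum E a).fderiv, momentum_apply,
    Pi.single_apply]

theorem jetBracket_basic_momentum {ζ : E → ℝ} {y : Jet E} (a : Fin m)
    (hX : ∀ a, DifferentiableAt ℝ (X a) y.1) (hζ : DifferentiableAt ℝ ζ y.1) :
    jetBracket ((fun w : FrameSpace E m => ζ w.1) ∘ frameMap X) (momentum E a ∘ frameMap X) y =
      - fderiv ℝ ζ y.1 (X a y.1) := by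
  rw [jetBracket_basic hX hζ (momentum E a).differentiableAt]
  have h1 : (frameMap X y).1 = y.1 := rfl
  simp [frameSymbol, h1, (momentum E a).fderiv, momentum_apply, Pi.single_apply]

end FrameExamples

/-! ### From the Jacobi identity to the Lie brackets of the frame -/

section Adapted

variable {E : Type*} [NormedAddCommGroup E] [NormedSpace ℝ E] [FiniteDimensional ℝ E]
  {Q : Type*} [TopologicalSpace Q] [ChartedSpace E Q] [IsManifold 𝓘(ℝ, E) ∞ Q] [T2Space Q]
  {L : Phase E Q → ℝ} {Δ : ∀ q : Q, Submodule ℝ (TangentSpace 𝓘(ℝ, E) q)}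

/-- The Jacobi identity is applied to a function ζ of q and two frame momenta, where dζ annihilates
Δ at the base point. It leaves X_a(X_b ζ) - X_b(X_a ζ) = 0 there. -/
theorem AdaptedChart.lieBracket_mem_of_satisfiesJacobi (hJ : SatisfiesJacobi L Δ)
    (hc : ∀ x ∈ constraintSet Δ, Nonempty (AdaptedChart L Δ x)) {x₀ : Phase E Q}
    (hx₀ : x₀ ∈ constraintSet Δ) (c : AdaptedChart L Δ x₀) (a b : Fin c.m) :
    VectorField.lieBracket ℝ (c.X a) (c.X b) (c.q x₀) ∈
      Submodule.span ℝ (Set.range fun d => c.X d (c.q x₀)) := by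
  refine (Subspace.forall_mem_dualAnnihilator_apply_eq_zero_iff _ _).1 fun ξ hξ => ?_
  set μ : E →L[ℝ] ℝ := LinearMap.toContinuousLinearMap ξ with hμ
  have hξX : ∀ d, μ (c.X d (c.q x₀)) = 0 := fun d =>
    (Submodule.mem_dualAnnihilator _).1 hξ _ (Submodule.subset_span ⟨d, rfl⟩)
  have hd := c.differentiableAt_frame c.mem_N
  -- The affine function with constant differential μ, normalized to vanish at the base point.
  set ζ : E → ℝ := fun v => μ (v - c.q x₀) with hζ
  have hζd : ∀ v, HasFDerivAt ζ μ v := fun v => by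
    exact μ.hasFDerivAt.comp v ((hasFDerivAt_id v).sub_const (c.q x₀))
  have hζs : ContDiff ℝ ∞ (fun w : FrameSpace E c.m => ζ w.1) :=
    μ.contDiff.comp (contDiff_fst.sub contDiff_const)
  obtain ⟨f, hf, hfζ⟩ := c.exists_isSmoothOnConstraint hζs
  obtain ⟨g, hg, hga⟩ := c.exists_isSmoothOnConstraint (momentum E a).contDiff
  obtain ⟨h, hh, hhb⟩ := c.exists_isSmoothOnConstraint (momentum E b).contDiff
  have hXs : ∀ d, ContDiffAt ℝ ∞ (fun w : FrameSpace E c.m => μ (c.X d w.1)) (c.frameCoord x₀) :=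
    fun d => by
      have h1 : ContDiffAt ℝ ∞ (c.X d) (c.frameCoord x₀).1 :=
        (c.X_smooth d).contDiffAt (c.isOpen_W.mem_nhds (c.q_mem x₀ c.mem_N))
      exact μ.contDiff.contDiffAt.comp _ (h1.comp _ contDiffAt_fst)
  have hXd : ∀ d, HasFDerivAt (fun v => μ (c.X d v)) (μ.comp (fderiv ℝ (c.X d) (c.q x₀)))
      (c.q x₀) := fun d => μ.hasFDerivAt.comp _ (hd d).hasFDerivAt
  -- The inner brackets with ζ are identified on a neighbourhood, since the outer bracket
  -- differentiates them.
  have hhf : ∀ᶠ y in 𝓝 x₀, ∀ hy : y ∈ constraintSet Δ,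
      μ (c.X b (c.frameCoord y).1) = nhBracket L Δ h f ⟨y, hy⟩ := by
    filter_upwards [hhb.eventually_nhds, hfζ.eventually_nhds, c.isOpen_N.mem_nhds c.mem_N]
      with y h1 h2 hyN hy
    rw [c.nhBracket_eq hyN hy (momentum E b).contDiff.contDiffAt hζs.contDiffAt h1 h2,
      jetBracket_momentum_basic b (c.differentiableAt_frame hyN) (hζd _).differentiableAt,
      (hζd _).fderiv]
    rfl
  have hfg : ∀ᶠ y in 𝓝 x₀, ∀ hy : y ∈ constraintSet Δ,
      (-μ) (c.X a (c.frameCoord y).1) = nhBracket L Δ f g ⟨y, hy⟩ := by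
    filter_upwards [hga.eventually_nhds, hfζ.eventually_nhds, c.isOpen_N.mem_nhds c.mem_N]
      with y h1 h2 hyN hy
    rw [c.nhBracket_eq hyN hy hζs.contDiffAt (momentum E a).contDiff.contDiffAt h2 h1,
      jetBracket_basic_momentum a (c.differentiableAt_frame hyN) (hζd _).differentiableAt,
      (hζd _).fderiv]
    rfl
  have hgh := isSmoothOnConstraint_nhBracket hc hg hh
  have hO := c.isOpen_O.mem_nhds (c.frameCoord_mem c.mem_N)
  -- Of {g, h} only smoothness matters: its momentum derivatives are paired with μ(X_d) = 0, and its
  -- z-derivative is multiplied by ζ = 0.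
  have t1 : nhBracket L Δ f (nhBracket L Δ g h) ⟨x₀, hx₀⟩ = 0 := by
    have hr := (c.contDiffOn_read hgh).contDiffAt hO
    rw [c.nhBracket_eq c.mem_N hx₀ hζs.contDiffAt hr hfζ (c.eventually_read _ c.mem_N),
      jetBracket_basic hd (hζd _).differentiableAt (hr.differentiableAt (by simp)), (hζd _).fderiv]
    have h1 : ζ (c.coord x₀).1 = 0 := by simp [hζ, AdaptedChart.coord]
    have h2 : ∀ d, μ (c.X d (frameMap c.X (c.coord x₀)).1) = 0 := hξX
    rw [h1]
    simp [frameSymbol, h2]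
  have t2 : nhBracket L Δ g (nhBracket L Δ h f) ⟨x₀, hx₀⟩ =
      μ (fderiv ℝ (c.X b) (c.q x₀) (c.X a (c.q x₀))) := by
    rw [c.nhBracket_eq c.mem_N hx₀ (momentum E a).contDiff.contDiffAt (hXs b) hga hhf]
    refine (jetBracket_momentum_basic (ζ := fun v => μ (c.X b v)) a hd
      (hXd b).differentiableAt).trans ?_
    exact congrArg (fun l => l (c.X a (c.q x₀))) (hXd b).fderiv
  have t3 : nhBracket L Δ h (nhBracket L Δ f g) ⟨x₀, hx₀⟩ =
      - μ (fderiv ℝ (c.X a) (c.q x₀) (c.X b (c.q x₀))) := by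
    rw [c.nhBracket_eq c.mem_N hx₀ (momentum E b).contDiff.contDiffAt (hXs a).neg hhb hfg]
    refine (jetBracket_momentum_basic (ζ := fun v => -μ (c.X a v)) b hd
      (hXd a).neg.differentiableAt).trans ?_
    exact congrArg (fun l => l (c.X b (c.q x₀))) (hXd a).neg.fderiv
  have hsum := hJ f g h hf hg hh ⟨x₀, hx₀⟩
  rw [t1, t2, t3] at hsum
  change μ (VectorField.lieBracket ℝ (c.X a) (c.X b) (c.q x₀)) = 0
  rw [VectorField.lieBracket, map_sub]
  linarith

end Adapted

/-! ### Frames and the Legendre map in coordinates -/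

section FrameCoefficients

variable {E : Type*} [NormedAddCommGroup E] [NormedSpace ℝ E] {m : ℕ}

/-- The map `u ↦ ∑ u_a X_a(q)`. -/
def frameSum (X : Fin m → E → E) (q : E) : (Fin m → ℝ) →L[ℝ] E :=
  ∑ a, (ContinuousLinearMap.proj a : (Fin m → ℝ) →L[ℝ] ℝ).smulRight (X a q)

theorem frameSum_apply (X : Fin m → E → E) (q : E) (u : Fin m → ℝ) :
    frameSum X q u = ∑ a, u a • X a q := by
  simp [frameSum]

theorem frameSum_mem_span (X : Fin m → E → E) (q : E) (u : Fin m → ℝ) :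
    frameSum X q u ∈ Submodule.span ℝ (Set.range fun a => X a q) := by
  rw [frameSum_apply]
  exact Submodule.sum_mem _ fun a _ => Submodule.smul_mem _ _ (Submodule.subset_span ⟨a, rfl⟩)

theorem exists_frameSum_eq {X : Fin m → E → E} {q v : E}
    (hv : v ∈ Submodule.span ℝ (Set.range fun a => X a q)) : ∃ u, frameSum X q u = v := by
  obtain ⟨u, hu⟩ := (Submodule.mem_span_range_iff_exists_fun ℝ).1 hv
  exact ⟨u, by rw [frameSum_apply, hu]⟩

theorem contDiffOn_frameSum {X : Fin m → E → E} {W : Set E} (hX : ∀ a, ContDiffOn ℝ ∞ (X a) W) :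
    ContDiffOn ℝ ∞ (frameSum X) W := by
  unfold frameSum
  refine ContDiffOn.sum fun a _ => ?_
  exact (ContinuousLinearMap.smulRightL ℝ (Fin m → ℝ) E
    (ContinuousLinearMap.proj a)).contDiff.comp_contDiffOn (hX a)

variable [FiniteDimensional ℝ E]

/-- The coefficients with respect to a smooth frame, extended smoothly to all vectors. -/
theorem exists_frameCoefficients {X : Fin m → E → E} {W : Set E} (hW : IsOpen W)
    (hX : ∀ a, ContDiffOn ℝ ∞ (X a) W) {q₀ : E} (hq₀ : q₀ ∈ W)
    (hli : LinearIndependent ℝ fun a => X a q₀) :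
    ∃ W' ⊆ W, IsOpen W' ∧ q₀ ∈ W' ∧ ∃ κ : E → E →L[ℝ] (Fin m → ℝ),
      ContDiffOn ℝ ∞ κ W' ∧ ∀ q ∈ W', ∀ u, κ q (frameSum X q u) = u := by
  have hinj : LinearMap.ker (frameSum X q₀ : (Fin m → ℝ) →ₗ[ℝ] E) = ⊥ := by
    refine LinearMap.ker_eq_bot'.2 fun u hu => ?_
    have h : ∑ a, u a • X a q₀ = 0 := by rw [← frameSum_apply]; exact hu
    exact funext (Fintype.linearIndependent_iff.1 hli u h)
  -- With R a left inverse of the frame at q₀, `R.comp (frameSum X q)` is the identity at q₀ and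
  -- invertible nearby. Its inverse followed by R in front is κ, that is, κ = (R T_q)⁻¹ R for T_q
  -- the frame map at q.
  obtain ⟨ρ, hρ⟩ := LinearMap.exists_leftInverse_of_injective _ hinj
  set R : E →L[ℝ] (Fin m → ℝ) := LinearMap.toContinuousLinearMap ρ
  have hsm : ContDiffOn ℝ ∞ (fun q => R.comp (frameSum X q)) W :=
    contDiffOn_const.clm_comp (contDiffOn_frameSum hX)
  set S : Set ((Fin m → ℝ) →L[ℝ] (Fin m → ℝ)) :=
    Set.range ((↑) : ((Fin m → ℝ) ≃L[ℝ] (Fin m → ℝ)) → (Fin m → ℝ) →L[ℝ] (Fin m → ℝ))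
  have hS : IsOpen S := ContinuousLinearEquiv.isOpen
  have hR : R.comp (frameSum X q₀) = ContinuousLinearMap.id ℝ _ :=
    ContinuousLinearMap.ext fun u => congrArg (fun l => l u) hρ
  refine ⟨W ∩ (fun q => R.comp (frameSum X q)) ⁻¹' S, Set.inter_subset_left,
    hsm.continuousOn.isOpen_inter_preimage hW hS,
    ⟨hq₀, ⟨ContinuousLinearEquiv.refl ℝ _, hR.symm⟩⟩,
    fun q => (ContinuousLinearMap.inverse (R.comp (frameSum X q))).comp R, ?_, ?_⟩
  · rintro q ⟨hq, A, hA⟩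
    refine ContDiffAt.contDiffWithinAt (ContDiffAt.clm_comp ?_ contDiffAt_const)
    have h1 : ContDiffAt ℝ ∞ ContinuousLinearMap.inverse (R.comp (frameSum X q)) := by
      have hA' : (A : (Fin m → ℝ) →L[ℝ] (Fin m → ℝ)) = R.comp (frameSum X q) := hA
      rw [← hA']; exact contDiffAt_map_inverse A
    exact h1.comp q (hsm.contDiffAt (hW.mem_nhds hq))
  · rintro q ⟨hq, A, hA⟩ u
    have hA' : (A : (Fin m → ℝ) →L[ℝ] (Fin m → ℝ)) = R.comp (frameSum X q) := hA
    have : R (frameSum X q u) = A u := (congrArg (fun l => l u) hA').symm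
    simp only [ContinuousLinearMap.comp_apply, this]
    rw [← hA', ContinuousLinearMap.inverse_equiv]
    exact A.symm_apply_apply u

end FrameCoefficients

section Legendre

variable {E : Type*} [NormedAddCommGroup E] [NormedSpace ℝ E] {m : ℕ}

/-- The inclusion of the velocities. -/
def inV (E : Type*) [NormedAddCommGroup E] [NormedSpace ℝ E] : E →L[ℝ] (E × E) × ℝ :=
  (ContinuousLinearMap.inl ℝ (E × E) ℝ).comp (ContinuousLinearMap.inr ℝ E E)

theorem inV_apply (b : E) : inV E b = ((0, b), 0) := rfl

/-- The momentum `∂ℓ/∂v` of a function on `(E × E) × ℝ`. -/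
def legendre (ℓ : (E × E) × ℝ → ℝ) (ξ : (E × E) × ℝ) : E →L[ℝ] ℝ := (fderiv ℝ ℓ ξ).comp (inV E)

/-- The coordinates `(q, p, z)` as a function of `(q, v, z)`. -/
def legendreMap (ℓ : (E × E) × ℝ → ℝ) (ξ : (E × E) × ℝ) : Jet E := (ξ.1.1, legendre ℓ ξ, ξ.2)

/-- The parametrization `(q, u, z) ↦ (q, ∑ u_a X_a(q), z)`. -/
def frameParam (X : Fin m → E → E) (w : FrameSpace E m) : (E × E) × ℝ :=
  ((w.1, frameSum X w.1 w.2.1), w.2.2)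

theorem contDiffOn_legendre {ℓ : (E × E) × ℝ → ℝ} {W : Set E} (hW : IsOpen W)
    (hℓ : ContDiffOn ℝ ∞ ℓ {ξ | ξ.1.1 ∈ W}) : ContDiffOn ℝ ∞ (legendre ℓ) {ξ | ξ.1.1 ∈ W} :=
  (hℓ.fderiv_of_isOpen (hW.preimage (continuous_fst.comp continuous_fst)) (by simp)).clm_comp
    contDiffOn_const

theorem contDiffOn_frameParam {X : Fin m → E → E} {W : Set E} (hX : ∀ a, ContDiffOn ℝ ∞ (X a) W) :
    ContDiffOn ℝ ∞ (frameParam X) {w : FrameSpace E m | w.1 ∈ W} := by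
  have h : ContDiffOn ℝ ∞ (fun w : FrameSpace E m => frameSum X w.1) {w | w.1 ∈ W} :=
    (contDiffOn_frameSum hX).comp contDiff_fst.contDiffOn fun w hw => hw
  exact (contDiff_fst.contDiffOn.prodMk (h.clm_apply contDiff_snd.fst.contDiffOn)).prodMk
    contDiff_snd.snd.contDiffOn

/-- A kernel vector has no q- or z-component, so it gives v = Σ u_a X_a with W(v, X_a) = 0 for all
a, W being the velocity Hessian. Hence W(v, v) = 0, which definiteness excludes unless v = 0.
Regularity alone would not suffice in general, as a nondegenerate form may degenerate on Δ. -/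
theorem fderiv_frameMap_legendreMap_injective {ℓ : (E × E) × ℝ → ℝ} {X : Fin m → E → E} {W : Set E}
    (hW : IsOpen W) (hℓ : ContDiffOn ℝ ∞ ℓ {ξ | ξ.1.1 ∈ W}) (hX : ∀ a, ContDiffOn ℝ ∞ (X a) W)
    {κ : E → E →L[ℝ] (Fin m → ℝ)} (hκ : ∀ q ∈ W, ∀ u, κ q (frameSum X q u) = u)
    (hH : ∀ ξ : (E × E) × ℝ, ξ.1.1 ∈ W → ∀ b, b ≠ 0 → fderiv ℝ (legendre ℓ) ξ (inV E b) b ≠ 0)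
    {w : FrameSpace E m} (hw : w.1 ∈ W) :
    DifferentiableAt ℝ (fun w => frameMap X (legendreMap ℓ (frameParam X w))) w ∧
    Function.Injective (fderiv ℝ (fun w => frameMap X (legendreMap ℓ (frameParam X w))) w) := by
  have hS : ∀ {k : FrameSpace E m}, k.1 ∈ W → {w : FrameSpace E m | w.1 ∈ W} ∈ 𝓝 k :=
    fun hk => (hW.preimage continuous_fst).mem_nhds hk
  have hS' : {ξ : (E × E) × ℝ | ξ.1.1 ∈ W} ∈ 𝓝 (frameParam X w) :=
    (hW.preimage (continuous_fst.comp continuous_fst)).mem_nhds hw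
  have hXd : ∀ a, DifferentiableAt ℝ (X a) w.1 := fun a =>
    ((hX a).contDiffAt (hW.mem_nhds hw)).differentiableAt (by simp)
  have d1 : HasFDerivAt (fun w : FrameSpace E m => w.1) (ContinuousLinearMap.fst ℝ _ _) w :=
    hasFDerivAt_fst
  have d2 : HasFDerivAt (fun w : FrameSpace E m => w.2) (ContinuousLinearMap.snd ℝ _ _) w :=
    hasFDerivAt_snd
  have d3 : HasFDerivAt (fun w : FrameSpace E m => w.2.1) _ w := hasFDerivAt_fst.comp w d2
  have d4 : HasFDerivAt (fun w : FrameSpace E m => w.2.2) _ w := hasFDerivAt_snd.comp w d2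
  have dT : HasFDerivAt (frameSum X) (fderiv ℝ (frameSum X) w.1) w.1 :=
    (((contDiffOn_frameSum hX).contDiffAt (hW.mem_nhds hw)).differentiableAt
      (by simp)).hasFDerivAt
  have d5 : HasFDerivAt (fun w : FrameSpace E m => frameSum X w.1 w.2.1) _ w :=
    (dT.comp w d1).clm_apply d3
  have dι : HasFDerivAt (frameParam X) _ w := (d1.prodMk d5).prodMk d4
  have dP : HasFDerivAt (legendre ℓ) (fderiv ℝ (legendre ℓ) (frameParam X w)) (frameParam X w) :=
    (((contDiffOn_legendre hW hℓ).contDiffAt hS').differentiableAt (by simp)).hasFDerivAt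
  have dJ : HasFDerivAt (fun w => legendreMap ℓ (frameParam X w)) _ w :=
    d1.prodMk ((dP.comp w dι).prodMk d4)
  obtain ⟨hΘ, hΘ'⟩ := hasFDerivAt_frameMap (y := legendreMap ℓ (frameParam X w)) hXd
  have dg := hΘ.hasFDerivAt.comp w dJ
  have dg' : HasFDerivAt (fun w => frameMap X (legendreMap ℓ (frameParam X w))) _ w := dg
  refine ⟨dg'.differentiableAt, ?_⟩
  rw [dg'.fderiv]
  refine (injective_iff_map_eq_zero _).2 fun k hk => ?_
  rw [ContinuousLinearMap.comp_apply, hΘ'] at hk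
  have k1 : k.1 = 0 := congrArg (fun w : FrameSpace E m => w.1) hk
  have k3 : k.2.2 = 0 := congrArg (fun w : FrameSpace E m => w.2.2) hk
  have k2 := fun a => congrFun (congrArg (fun w : FrameSpace E m => w.2.1) hk) a
  obtain ⟨ka, ku, kc⟩ := k
  simp only at k1 k3
  subst k1 k3
  have k4 : ∀ a, fderiv ℝ (legendre ℓ) (frameParam X w) (inV E (frameSum X w.1 ku)) (X a w.1) = 0 :=
    fun a => by
      have := k2 a
      simpa [inV_apply, legendreMap, frameParam] using this
  have k5 : frameSum X w.1 ku = 0 := by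
    by_contra hne
    refine hH (frameParam X w) hw _ hne ?_
    conv_lhs => enter [2]; rw [frameSum_apply]
    rw [map_sum]
    exact Finset.sum_eq_zero fun a _ => by rw [map_smul, k4, smul_zero]
  have k6 : ku = 0 := by rw [← hκ w.1 hw ku, k5, map_zero]
  rw [k6]
  rfl

variable [FiniteDimensional ℝ E]

/-- The inverse of `(q, p(X_a), z)` on the bundle spanned by the frame. -/
theorem exists_frame_section {ℓ : (E × E) × ℝ → ℝ} {X : Fin m → E → E} {W : Set E}
    (hW : IsOpen W) (hℓ : ContDiffOn ℝ ∞ ℓ {ξ | ξ.1.1 ∈ W}) (hX : ∀ a, ContDiffOn ℝ ∞ (X a) W)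
    {κ : E → E →L[ℝ] (Fin m → ℝ)} (hκs : ContDiffOn ℝ ∞ κ W)
    (hκ : ∀ q ∈ W, ∀ u, κ q (frameSum X q u) = u)
    (hH : ∀ ξ : (E × E) × ℝ, ξ.1.1 ∈ W → ∀ b, b ≠ 0 → fderiv ℝ (legendre ℓ) ξ (inV E b) b ≠ 0)
    {ξ₀ : (E × E) × ℝ} (hξ₀ : ξ₀.1.1 ∈ W)
    (hξ₀' : ξ₀.1.2 ∈ Submodule.span ℝ (Set.range fun a => X a ξ₀.1.1)) :
    ∃ (O : Set (FrameSpace E m)) (N : Set ((E × E) × ℝ)) (σ : FrameSpace E m → (E × E) × ℝ),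
      IsOpen O ∧ IsOpen N ∧ ξ₀ ∈ N ∧ (∀ ξ ∈ N, ξ.1.1 ∈ W) ∧ ContDiffOn ℝ ∞ σ O ∧
      (∀ w ∈ O, σ w ∈ N ∧
        (σ w).1.2 ∈ Submodule.span ℝ (Set.range fun a => X a (σ w).1.1) ∧
        frameMap X (legendreMap ℓ (σ w)) = w) ∧
      (∀ ξ ∈ N, frameMap X (legendreMap ℓ ξ) ∈ O) ∧
      (∀ ξ ∈ N, ξ.1.2 ∈ Submodule.span ℝ (Set.range fun a => X a ξ.1.1) →
        σ (frameMap X (legendreMap ℓ ξ)) = ξ) := by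
  set g : FrameSpace E m → FrameSpace E m :=
    fun w => frameMap X (legendreMap ℓ (frameParam X w)) with hg
  set S : Set (FrameSpace E m) := {w | w.1 ∈ W} with hSdef
  set S' : Set ((E × E) × ℝ) := {ξ | ξ.1.1 ∈ W} with hS'def
  have hS : IsOpen S := hW.preimage continuous_fst
  have hS' : IsOpen S' := hW.preimage (continuous_fst.comp continuous_fst)
  have hleg : ContDiffOn ℝ ∞ (fun ξ => frameMap X (legendreMap ℓ ξ)) S' := by
    have h1 : ContDiffOn ℝ ∞ (legendreMap ℓ) S' := contDiff_fst.fst.contDiffOn.prodMk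
      ((contDiffOn_legendre hW hℓ).prodMk contDiff_snd.contDiffOn)
    exact (contDiffOn_frameMap hX).comp h1 fun ξ hξ => hξ
  have hgs : ContDiffOn ℝ ∞ g S := hleg.comp (contDiffOn_frameParam hX) fun w hw => hw
  -- Invertibility is recorded on all of S, because smoothness of the local inverse is checked at
  -- every point of its domain.
  have hequiv : ∀ w ∈ S, ∃ A : FrameSpace E m ≃L[ℝ] FrameSpace E m,
      HasFDerivAt g (A : FrameSpace E m →L[ℝ] FrameSpace E m) w := fun w hw => by
    obtain ⟨h1, h2⟩ := fderiv_frameMap_legendreMap_injective hW hℓ hX hκ hH hw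
    refine ⟨(LinearEquiv.ofInjectiveEndo (fderiv ℝ g w : FrameSpace E m →ₗ[ℝ] FrameSpace E m)
      h2).toContinuousLinearEquiv, ?_⟩
    convert h1.hasFDerivAt using 1
    rfl
  -- A left inverse of `frameParam` that is defined for all velocities over W, so that it can cut
  -- out open sets of the ambient space.
  set θ : (E × E) × ℝ → FrameSpace E m := fun ξ => (ξ.1.1, κ ξ.1.1 ξ.1.2, ξ.2) with hθ
  have hθc : ContinuousOn θ S' := by
    have h1 : ContinuousOn (fun ξ : (E × E) × ℝ => κ ξ.1.1) S' :=
      hκs.continuousOn.comp continuous_fst.fst.continuousOn fun ξ hξ => hξ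
    exact continuous_fst.fst.continuousOn.prodMk
      ((h1.clm_apply continuous_fst.snd.continuousOn).prodMk continuous_snd.continuousOn)
  have hθι : ∀ w ∈ S, θ (frameParam X w) = w := fun w hw => by
    simp only [hθ, frameParam, hκ w.1 hw]
  have hιθ : ∀ ξ ∈ S', ξ.1.2 ∈ Submodule.span ℝ (Set.range fun a => X a ξ.1.1) →
      frameParam X (θ ξ) = ξ := fun ξ hξ hv => by
    obtain ⟨u, hu⟩ := exists_frameSum_eq hv
    have h1 : frameSum X ξ.1.1 (κ ξ.1.1 ξ.1.2) = ξ.1.2 := by rw [← hu, hκ _ hξ]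
    simp only [hθ, frameParam, h1]
  have hw₀ : θ ξ₀ ∈ S := hξ₀
  obtain ⟨A, hA⟩ := hequiv _ hw₀
  have hg₀ : ContDiffAt ℝ ∞ g (θ ξ₀) := hgs.contDiffAt (hS.mem_nhds hw₀)
  set e := (hg₀.toOpenPartialHomeomorph g hA (by simp)).restr S with he
  have hsrc : ∀ w, w ∈ e.source ↔
      w ∈ (hg₀.toOpenPartialHomeomorph g hA (by simp)).source ∧ w ∈ S := fun w => by
    rw [he, OpenPartialHomeomorph.restr_source, hS.interior_eq]; rfl
  have heg : ∀ w, e w = g w := fun w => rfl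
  have hw₀e : θ ξ₀ ∈ e.source := (hsrc _).2 ⟨hg₀.mem_toOpenPartialHomeomorph_source hA (by simp), hw₀⟩
  have hsymm : ∀ w ∈ e.target, e.symm w ∈ S := fun w hw => ((hsrc _).1 (e.map_target hw)).2
  -- The condition on θ makes `e.symm` invert the coordinates at points of N in the span of the
  -- frame. The second condition puts the frame coordinates of every point of N, in the span or not,
  -- into the domain of σ.
  refine ⟨e.target, (S' ∩ θ ⁻¹' e.source) ∩ (S' ∩ (fun ξ => frameMap X (legendreMap ℓ ξ)) ⁻¹' e.target),
    fun w => frameParam X (e.symm w), e.open_target, ?_, ?_, fun ξ hξ => hξ.1.1, ?_, ?_,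
    fun ξ hξ => hξ.2.2, ?_⟩
  · exact (hθc.isOpen_inter_preimage hS' e.open_source).inter
      (hleg.continuousOn.isOpen_inter_preimage hS' e.open_target)
  · refine ⟨⟨hξ₀, hw₀e⟩, hξ₀, ?_⟩
    have := e.map_source hw₀e
    rw [heg, hg] at this
    simp only [hιθ ξ₀ hξ₀ hξ₀'] at this
    exact this
  · intro w hw
    obtain ⟨B, hB⟩ := hequiv _ (hsymm w hw)
    have h1 : ContDiffAt ℝ ∞ e.symm w :=
      e.contDiffAt_symm hw hB (hgs.contDiffAt (hS.mem_nhds (hsymm w hw)))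
    have h2 : ContDiffAt ℝ ∞ (frameParam X) (e.symm w) :=
      (contDiffOn_frameParam hX).contDiffAt (hS.mem_nhds (hsymm w hw))
    exact (h2.comp w h1).contDiffWithinAt
  · intro w hw
    have h1 : g (e.symm w) = w := by rw [← heg, e.right_inv hw]
    refine ⟨⟨⟨hsymm w hw, ?_⟩, hsymm w hw, ?_⟩, frameSum_mem_span _ _ _, h1⟩
    · rw [Set.mem_preimage, hθι _ (hsymm w hw)]
      exact e.map_target hw
    · have : frameMap X (legendreMap ℓ (frameParam X (e.symm w))) = w := h1
      rw [Set.mem_preimage, this]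
      exact hw
  · intro ξ hξ hv
    have h1 : frameMap X (legendreMap ℓ ξ) = e (θ ξ) := by
      rw [heg, hg]
      simp only [hιθ ξ hξ.1.1 hv]
    simp only [h1, e.left_inv hξ.1.2, hιθ ξ hξ.1.1 hv]

end Legendre

/-! ### The charts of `TQ × ℝ` -/

section PhaseChart

variable {E : Type*} [NormedAddCommGroup E] [NormedSpace ℝ E]
  {Q : Type*} [TopologicalSpace Q] [ChartedSpace E Q] [IsManifold 𝓘(ℝ, E) ∞ Q]

/-- The differential at `q` of the preferred chart at `q₀`. -/
def chartDeriv (q₀ q : Q) : TangentSpace 𝓘(ℝ, E) q →L[ℝ] E :=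
  vecDeriv 𝓘(ℝ, E) (extChartAt 𝓘(ℝ, E) q₀) q

/-- The differential at `q` of the preferred chart at `q₀`, as an endomorphism of `E`. -/
def chartDerivL (q₀ q : Q) : E →L[ℝ] E := chartDeriv q₀ q

theorem chartDeriv_bijective {q₀ q : Q} (hq : q ∈ (extChartAt 𝓘(ℝ, E) q₀).source) :
    Function.Bijective (chartDeriv (E := E) q₀ q) := by
  have : IsManifold 𝓘(ℝ, E) 1 Q := IsManifold.of_le (n := ∞) (by simp)
  obtain ⟨A, hA⟩ := isInvertible_mfderiv_extChartAt (I := 𝓘(ℝ, E)) hq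
  have h : ∀ v, chartDeriv (E := E) q₀ q v = A v := fun v => congrArg (fun l => l v) hA.symm
  rw [show (chartDeriv (E := E) q₀ q : _ → E) = A from funext h]
  exact A.bijective

theorem tangentBundle_extChartAt_apply {v₀ v : TangentBundle 𝓘(ℝ, E) Q}
    (hv : v.proj ∈ (extChartAt 𝓘(ℝ, E) v₀.proj).source) :
    extChartAt 𝓘(ℝ, E).tangent v₀ v =
      (extChartAt 𝓘(ℝ, E) v₀.proj v.proj, chartDeriv v₀.proj v.proj v.snd) := by
  have : IsManifold 𝓘(ℝ, E) 1 Q := IsManifold.of_le (n := ∞) (by simp)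
  rw [extChartAt_source] at hv
  rw [FiberBundle.extChartAt]
  refine Prod.ext ?_ ?_
  · simp
  · have h := TangentBundle.continuousLinearMapAt_trivializationAt (I := 𝓘(ℝ, E)) hv
    have h2 : chartDeriv v₀.proj v.proj v.snd =
        Bundle.Trivialization.continuousLinearMapAt ℝ
          (trivializationAt E (TangentSpace 𝓘(ℝ, E)) v₀.proj) v.proj v.snd :=
      (congrArg (fun l => l v.snd) h).symm
    rw [h2, Bundle.Trivialization.continuousLinearMapAt_apply,
      Bundle.Trivialization.linearMapAt_apply]
    rw [if_pos (by simpa using hv)]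
    rfl

theorem mem_tangentBundle_extChartAt_source {v₀ v : TangentBundle 𝓘(ℝ, E) Q} :
    v ∈ (extChartAt 𝓘(ℝ, E).tangent v₀).source ↔
      v.proj ∈ (extChartAt 𝓘(ℝ, E) v₀.proj).source := by
  rw [extChartAt_source, extChartAt_source, TangentBundle.mem_chart_source_iff]

theorem mem_tangentBundle_extChartAt_target {v₀ : TangentBundle 𝓘(ℝ, E) Q} {ξ : E × E} :
    ξ ∈ (extChartAt 𝓘(ℝ, E).tangent v₀).target ↔ ξ.1 ∈ (extChartAt 𝓘(ℝ, E) v₀.proj).target := by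
  rw [FiberBundle.extChartAt_target]
  simpa using fun h => (chartAt E v₀.proj).map_target h

theorem mem_phase_extChartAt_source {x y : Phase E Q} :
    y ∈ (extChartAt (phaseModel E) x).source ↔
      y.1.proj ∈ (extChartAt 𝓘(ℝ, E) x.1.proj).source := by
  rw [extChartAt_prod, PartialEquiv.prod_source, Set.mem_prod, mem_tangentBundle_extChartAt_source]
  exact and_iff_left (by simp only [mfld_simps]; exact Set.mem_univ _)

theorem mem_phase_extChartAt_target {x : Phase E Q} {ξ : (E × E) × ℝ} :
    ξ ∈ (extChartAt (phaseModel E) x).target ↔ ξ.1.1 ∈ (extChartAt 𝓘(ℝ, E) x.1.proj).target := by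
  rw [extChartAt_prod, PartialEquiv.prod_target, Set.mem_prod, mem_tangentBundle_extChartAt_target]
  exact and_iff_left (by simp only [mfld_simps]; exact Set.mem_univ _)

theorem phase_extChartAt_apply {x y : Phase E Q}
    (hy : y.1.proj ∈ (extChartAt 𝓘(ℝ, E) x.1.proj).source) :
    extChartAt (phaseModel E) x y =
      ((extChartAt 𝓘(ℝ, E) x.1.proj y.1.proj, chartDeriv x.1.proj y.1.proj y.1.snd), y.2) := by
  rw [extChartAt_prod, ← tangentBundle_extChartAt_apply hy]
  rfl

/-- A Lagrangian in the preferred chart at `x₀`. -/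
def lagrangianInChart (L : Phase E Q → ℝ) (x₀ : Phase E Q) (ξ : (E × E) × ℝ) : ℝ :=
  L ((extChartAt (phaseModel E) x₀).symm ξ)

theorem contDiffOn_lagrangianInChart {L : Phase E Q → ℝ}
    (hL : ContMDiff (phaseModel E) 𝓘(ℝ, ℝ) ∞ L) (x₀ : Phase E Q) :
    ContDiffOn ℝ ∞ (lagrangianInChart L x₀)
      {ξ | ξ.1.1 ∈ (extChartAt 𝓘(ℝ, E) x₀.1.proj).target} := by
  refine contMDiffOn_iff_contDiffOn.1 (hL.comp_contMDiffOn
    ((contMDiffOn_extChartAt_symm x₀).mono fun ξ hξ => ?_))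
  exact mem_phase_extChartAt_target.2 hξ

theorem lagrangianInChart_extChartAt (L : Phase E Q → ℝ) {x₀ y : Phase E Q}
    (hy : y ∈ (extChartAt (phaseModel E) x₀).source) :
    lagrangianInChart L x₀ (extChartAt (phaseModel E) x₀ y) = L y := by
  rw [lagrangianInChart, (extChartAt (phaseModel E) x₀).left_inv hy]

theorem mdifferentiableAt_phase_extChartAt {x₀ y : Phase E Q}
    (hy : y ∈ (extChartAt (phaseModel E) x₀).source) :
    MDifferentiableAt (phaseModel E) 𝓘(ℝ, (E × E) × ℝ) (extChartAt (phaseModel E) x₀) y := by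
  have : IsManifold (phaseModel E) 1 (Phase E Q) := IsManifold.of_le (n := ∞) (by simp)
  exact mdifferentiableAt_extChartAt (by rwa [extChartAt_source] at hy)

/-- The differential of the preferred chart at `x₀`. -/
def phaseDeriv (x₀ y : Phase E Q) : PhaseTangent y →L[ℝ] (E × E) × ℝ :=
  vecDeriv (phaseModel E) (extChartAt (phaseModel E) x₀) y

theorem phaseDeriv_injective {x₀ y : Phase E Q}
    (hy : y ∈ (extChartAt (phaseModel E) x₀).source) :
    Function.Injective (phaseDeriv (E := E) x₀ y) := by
  have : IsManifold (phaseModel E) 1 (Phase E Q) := IsManifold.of_le (n := ∞) (by simp)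
  obtain ⟨A, hA⟩ := isInvertible_mfderiv_extChartAt (I := phaseModel E) hy
  have h : ∀ v, phaseDeriv (E := E) x₀ y v = A v := fun v => congrArg (fun l => l v) hA.symm
  rw [show (phaseDeriv (E := E) x₀ y : _ → (E × E) × ℝ) = A from funext h]
  exact A.injective

theorem contMDiff_baseProj :
    ContMDiff (phaseModel E) 𝓘(ℝ, E) ∞ (baseProj (E := E) (Q := Q)) :=
  (Bundle.contMDiff_proj (TangentSpace 𝓘(ℝ, E) : Q → Type _)).comp contMDiff_fst

theorem vecDeriv_chart_baseProj {q₀ : Q} {y : Phase E Q}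
    (hy : y.1.proj ∈ (extChartAt 𝓘(ℝ, E) q₀).source) (u : PhaseTangent y) :
    vecDeriv (phaseModel E) (fun y : Phase E Q => extChartAt 𝓘(ℝ, E) q₀ y.1.proj) y u =
      chartDeriv q₀ y.1.proj (dBaseProj y u) := by
  have : IsManifold 𝓘(ℝ, E) 1 Q := IsManifold.of_le (n := ∞) (by simp)
  have h1 : MDifferentiableAt 𝓘(ℝ, E) 𝓘(ℝ, E) (extChartAt 𝓘(ℝ, E) q₀) (baseProj y) :=
    mdifferentiableAt_extChartAt (by rwa [extChartAt_source] at hy)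
  exact congrArg (fun l => l u) (mfderiv_comp y h1 (contMDiff_baseProj.mdifferentiableAt (by simp)))

theorem phaseDeriv_base {x₀ y : Phase E Q} (hy : y ∈ (extChartAt (phaseModel E) x₀).source)
    (u : PhaseTangent y) :
    (phaseDeriv x₀ y u).1.1 = chartDeriv x₀.1.proj y.1.proj (dBaseProj y u) := by
  have hq := mem_phase_extChartAt_source.1 hy
  rw [← vecDeriv_chart_baseProj hq]
  have h1 := vecDeriv_clm_comp ((ContinuousLinearMap.fst ℝ E E).comp
    (ContinuousLinearMap.fst ℝ (E × E) ℝ)) (mdifferentiableAt_phase_extChartAt hy) u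
  refine h1.symm.trans (vecDeriv_congr ?_ u)
  filter_upwards [(isOpen_extChartAt_source x₀).mem_nhds hy] with y' hy'
  exact congrArg (fun ξ => ξ.1.1) (phase_extChartAt_apply (mem_phase_extChartAt_source.1 hy'))

theorem phaseDeriv_snd {x₀ y : Phase E Q} (hy : y ∈ (extChartAt (phaseModel E) x₀).source)
    (u : PhaseTangent y) :
    (phaseDeriv x₀ y u).2 = vecDeriv (phaseModel E) (Prod.snd : Phase E Q → ℝ) y u := by
  have h1 := vecDeriv_clm_comp (ContinuousLinearMap.snd ℝ (E × E) ℝ)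
    (mdifferentiableAt_phase_extChartAt hy) u
  refine h1.symm.trans (vecDeriv_congr ?_ u)
  filter_upwards [(isOpen_extChartAt_source x₀).mem_nhds hy] with y' hy'
  exact congrArg (fun ξ => ξ.2) (phase_extChartAt_apply (mem_phase_extChartAt_source.1 hy'))

theorem extChartAt_fibreIncl {x₀ : Phase E Q} {q : Q} {z : ℝ}
    (hq : q ∈ (extChartAt 𝓘(ℝ, E) x₀.1.proj).source) (v : E) :
    extChartAt (phaseModel E) x₀ (fibreIncl q z v) =
      ((extChartAt 𝓘(ℝ, E) x₀.1.proj q, chartDerivL x₀.1.proj q v), z) :=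
  phase_extChartAt_apply (y := fibreIncl q z v) hq

/-- The charts of the tangent bundle are linear on fibres, so the inclusion of a fibre reads as an
affine map. -/
theorem mdifferentiableAt_fibreIncl (q : Q) (z : ℝ) (v : E) :
    MDifferentiableAt 𝓘(ℝ, E) (phaseModel E) (fibreIncl (E := E) q z) v := by
  set x₀ : Phase E Q := fibreIncl q z v
  have hq : q ∈ (extChartAt 𝓘(ℝ, E) x₀.1.proj).source := mem_extChartAt_source q
  have h : fibreIncl (E := E) q z = (extChartAt (phaseModel E) x₀).symm ∘ fun v : E =>
      ((extChartAt 𝓘(ℝ, E) x₀.1.proj q, chartDerivL x₀.1.proj q v), z) := by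
    funext v
    rw [Function.comp_apply, ← extChartAt_fibreIncl hq, (extChartAt (phaseModel E) x₀).left_inv]
    exact mem_phase_extChartAt_source.2 hq
  rw [h]
  have h1 : ContDiff ℝ ∞ fun v : E =>
      ((extChartAt 𝓘(ℝ, E) x₀.1.proj q, chartDerivL x₀.1.proj q v), z) :=
    (contDiff_const.prodMk (ContinuousLinearMap.contDiff _)).prodMk contDiff_const
  refine MDifferentiableAt.comp _ ((contMDiffAt_extChartAt_symm x₀
    (mem_phase_extChartAt_target.2 ?_)).mdifferentiableAt (by simp))
    (h1.contMDiff.contMDiffAt.mdifferentiableAt (by simp))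
  exact (extChartAt 𝓘(ℝ, E) x₀.1.proj).map_source hq

omit [IsManifold 𝓘(ℝ, E) ∞ Q] in
theorem hasFDerivAt_fibre (q₀ q : Q) (z : ℝ) (v : E) :
    HasFDerivAt (fun v : E =>
      ((extChartAt 𝓘(ℝ, E) q₀ q, chartDerivL q₀ q v), z))
      ((inV E).comp (chartDerivL q₀ q)) v :=
  (((hasFDerivAt_const _ v).prodMk (chartDerivL q₀ q).hasFDerivAt).prodMk
    (hasFDerivAt_const z v)).congr_fderiv (ContinuousLinearMap.ext fun _ => rfl)

theorem phaseDeriv_vertLift {x₀ y : Phase E Q} (hy : y ∈ (extChartAt (phaseModel E) x₀).source)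
    (v : TangentSpace 𝓘(ℝ, E) y.1.proj) :
    phaseDeriv x₀ y (vertLift y v) = inV E (chartDeriv x₀.1.proj y.1.proj v) := by
  have hq := mem_phase_extChartAt_source.1 hy
  have h1 := mfderiv_comp (I' := phaseModel E) (y.1.snd : E)
    (g := extChartAt (phaseModel E) x₀) (f := fibreIncl (E := E) y.1.proj y.2)
    (mdifferentiableAt_phase_extChartAt hy)
    (mdifferentiableAt_fibreIncl (E := E) y.1.proj y.2 y.1.snd)
  have h2 : extChartAt (phaseModel E) x₀ ∘ fibreIncl (E := E) y.1.proj y.2 = fun v : E =>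
      ((extChartAt 𝓘(ℝ, E) x₀.1.proj y.1.proj,
        chartDerivL x₀.1.proj y.1.proj v), y.2) :=
    funext fun v => extChartAt_fibreIncl hq v
  rw [h2] at h1
  have h3 : mfderiv 𝓘(ℝ, E) 𝓘(ℝ, (E × E) × ℝ) (fun v : E =>
      ((extChartAt 𝓘(ℝ, E) x₀.1.proj y.1.proj, chartDerivL x₀.1.proj y.1.proj v), y.2))
      (y.1.snd : E) = (inV E).comp (chartDerivL x₀.1.proj y.1.proj) :=
    mfderiv_eq_fderiv.trans (hasFDerivAt_fibre _ _ _ _).fderiv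
  exact (congrArg (fun l => l v) (h1.symm.trans h3))

/-- In the chart the vertical endomorphism turns u into the velocity direction dq(u), so S^* dL
reads (∂ℓ/∂v) dq. This identifies the Legendre momentum as the Darboux coordinate p. -/
theorem etaL_eq {L : Phase E Q → ℝ} (hL : ContMDiff (phaseModel E) 𝓘(ℝ, ℝ) ∞ L) {x₀ y : Phase E Q}
    (hy : y ∈ (extChartAt (phaseModel E) x₀).source) (u : PhaseTangent y) :
    etaL L y u = vecDeriv (phaseModel E) (Prod.snd : Phase E Q → ℝ) y u
      - legendre (lagrangianInChart L x₀) (extChartAt (phaseModel E) x₀ y)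
        (vecDeriv (phaseModel E)
          (fun y : Phase E Q => extChartAt 𝓘(ℝ, E) x₀.1.proj y.1.proj) y u) := by
  have hq := mem_phase_extChartAt_source.1 hy
  have hξ : (extChartAt (phaseModel E) x₀ y).1.1 ∈ (extChartAt 𝓘(ℝ, E) x₀.1.proj).target :=
    mem_phase_extChartAt_target.1 ((extChartAt (phaseModel E) x₀).map_source hy)
  have hℓ : DifferentiableAt ℝ (lagrangianInChart L x₀) (extChartAt (phaseModel E) x₀ y) :=
    ((contDiffOn_lagrangianInChart hL x₀).contDiffAt
      (((isOpen_extChartAt_target _).preimage (continuous_fst.comp continuous_fst)).mem_nhds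
        hξ)).differentiableAt (by simp)
  have h1 : ∀ w : PhaseTangent y, vecDeriv (phaseModel E) L y w =
      fderiv ℝ (lagrangianInChart L x₀) (extChartAt (phaseModel E) x₀ y) (phaseDeriv x₀ y w) :=
    fun w => by
      rw [phaseDeriv, ← vecDeriv_comp hℓ (mdifferentiableAt_phase_extChartAt hy)]
      refine vecDeriv_congr ?_ w
      filter_upwards [(isOpen_extChartAt_source x₀).mem_nhds hy] with y' hy'
        using (lagrangianInChart_extChartAt L hy').symm
  have h2 : etaL L y u = vecDeriv (phaseModel E) (Prod.snd : Phase E Q → ℝ) y u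
      - vecDeriv (phaseModel E) L y (vertLift y (dBaseProj y u)) := rfl
  rw [h2, h1, phaseDeriv_vertLift hy, vecDeriv_chart_baseProj hq]
  rfl

/-- The chart is linear on the fibre, so the Hessian transforms as a bilinear form under the chart
differential, with no term from second derivatives of the chart. -/
theorem velocityHessian_eq {L : Phase E Q → ℝ} (hL : ContMDiff (phaseModel E) 𝓘(ℝ, ℝ) ∞ L)
    {x₀ y : Phase E Q} (hy : y ∈ (extChartAt (phaseModel E) x₀).source) (u w : E) :
    velocityHessian L y u w =
      fderiv ℝ (legendre (lagrangianInChart L x₀)) (extChartAt (phaseModel E) x₀ y)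
        (inV E (chartDerivL x₀.1.proj y.1.proj u))
        (chartDerivL x₀.1.proj y.1.proj w) := by
  have hq := mem_phase_extChartAt_source.1 hy
  set D : E →L[ℝ] E := chartDerivL x₀.1.proj y.1.proj with hD
  set ℓ := lagrangianInChart L x₀ with hℓ
  set W := (extChartAt 𝓘(ℝ, E) x₀.1.proj).target with hW
  have hWo : IsOpen W := isOpen_extChartAt_target _
  have hqW : extChartAt 𝓘(ℝ, E) x₀.1.proj y.1.proj ∈ W :=
    (extChartAt 𝓘(ℝ, E) x₀.1.proj).map_source hq
  set κ : E → (E × E) × ℝ := fun v => ((extChartAt 𝓘(ℝ, E) x₀.1.proj y.1.proj, D v), y.2) with hκ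
  have hκ' : ∀ v, HasFDerivAt κ ((inV E).comp D) v := hasFDerivAt_fibre _ _ _
  have hnhds : ∀ v, {ξ : (E × E) × ℝ | ξ.1.1 ∈ W} ∈ 𝓝 (κ v) := fun v =>
    (hWo.preimage (continuous_fst.comp continuous_fst)).mem_nhds hqW
  have hs := contDiffOn_lagrangianInChart hL x₀
  have h1 : (fun v : E => L (fibreIncl y.1.proj y.2 v)) = ℓ ∘ κ := by
    funext v
    have h : κ v = extChartAt (phaseModel E) x₀ (fibreIncl y.1.proj y.2 v) :=
      (extChartAt_fibreIncl hq v).symm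
    rw [Function.comp_apply, h, hℓ, lagrangianInChart_extChartAt]
    exact mem_phase_extChartAt_source.2 hq
  have h2 : (fun v : E => fderiv ℝ (fun v' : E => L (fibreIncl y.1.proj y.2 v')) v) =
      fun v => (legendre ℓ (κ v)).comp D := by
    funext v
    rw [h1, ((hs.contDiffAt (hnhds v)).differentiableAt (by simp)).hasFDerivAt.comp v
      (hκ' v) |>.fderiv]
    rfl
  have hy' : extChartAt (phaseModel E) x₀ y = κ y.1.snd := phase_extChartAt_apply hq
  have h3 : ∀ v : E, HasFDerivAt (fun v => legendre ℓ (κ v))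
      ((fderiv ℝ (legendre ℓ) (κ v)).comp ((inV E).comp D)) v := fun v =>
    (((contDiffOn_legendre hWo hs).contDiffAt (hnhds v)).differentiableAt
      (by simp)).hasFDerivAt.comp v (hκ' v)
  have h4 : ∀ v : E, fderiv ℝ (fun v => (legendre ℓ (κ v)).comp D) v u w =
      fderiv ℝ (legendre ℓ) (κ v) (inV E (D u)) (D w) := fun v => by
    rw [((h3 v).clm_comp (hasFDerivAt_const D v)).fderiv]
    simp
  have h5 : velocityHessian L y u w = fderiv ℝ (fun v => (legendre ℓ (κ v)).comp D)
      (y.1.snd : E) u w := by rw [← h2]; rfl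
  rw [h5, hy']
  exact h4 _

end PhaseChart

/-! ### Vector fields in a chart -/

section ChartField

variable {E : Type*} [NormedAddCommGroup E] [NormedSpace ℝ E]
  {Q : Type*} [TopologicalSpace Q] [ChartedSpace E Q] [IsManifold 𝓘(ℝ, E) ∞ Q]

/-- A vector field in the preferred chart at `q₀`. -/
def chartField (q₀ : Q) (Y : ∀ q : Q, TangentSpace 𝓘(ℝ, E) q) (e : E) : E :=
  chartDeriv q₀ ((extChartAt 𝓘(ℝ, E) q₀).symm e) (Y ((extChartAt 𝓘(ℝ, E) q₀).symm e))

omit [IsManifold 𝓘(ℝ, E) ∞ Q] in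
theorem chartField_extChartAt {q₀ q : Q} (hq : q ∈ (extChartAt 𝓘(ℝ, E) q₀).source)
    (Y : ∀ q : Q, TangentSpace 𝓘(ℝ, E) q) :
    chartField q₀ Y (extChartAt 𝓘(ℝ, E) q₀ q) = chartDeriv q₀ q (Y q) := by
  rw [chartField, (extChartAt 𝓘(ℝ, E) q₀).left_inv hq]

/-- The part of an open set in the domain of the preferred chart at `q₀`, in the chart. -/
def chartSet (q₀ : Q) (U : Set Q) : Set E :=
  (extChartAt 𝓘(ℝ, E) q₀).target ∩ (extChartAt 𝓘(ℝ, E) q₀).symm ⁻¹' U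

omit [IsManifold 𝓘(ℝ, E) ∞ Q] in
theorem isOpen_chartSet (q₀ : Q) {U : Set Q} (hU : IsOpen U) :
    IsOpen (chartSet (E := E) q₀ U) :=
  (continuousOn_extChartAt_symm q₀).isOpen_inter_preimage (isOpen_extChartAt_target q₀) hU

omit [IsManifold 𝓘(ℝ, E) ∞ Q] in
theorem extChartAt_mem_chartSet {q₀ q : Q} {U : Set Q}
    (hq : q ∈ (extChartAt 𝓘(ℝ, E) q₀).source) (hU : q ∈ U) :
    extChartAt 𝓘(ℝ, E) q₀ q ∈ chartSet (E := E) q₀ U :=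
  ⟨(extChartAt 𝓘(ℝ, E) q₀).map_source hq, by
    rwa [Set.mem_preimage, (extChartAt 𝓘(ℝ, E) q₀).left_inv hq]⟩

theorem contDiffOn_chartField {q₀ : Q} {Y : ∀ q : Q, TangentSpace 𝓘(ℝ, E) q} {U : Set Q}
    (hY : SmoothFieldOn Y U) : ContDiffOn ℝ ∞ (chartField q₀ Y) (chartSet q₀ U) := by
  set v₀ : TangentBundle 𝓘(ℝ, E) Q := ⟨q₀, 0⟩
  have h1 : ContMDiffOn 𝓘(ℝ, E) 𝓘(ℝ, E).tangent ∞
      (fun e : E => (⟨(extChartAt 𝓘(ℝ, E) q₀).symm e, Y ((extChartAt 𝓘(ℝ, E) q₀).symm e)⟩ :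
        TangentBundle 𝓘(ℝ, E) Q)) (chartSet q₀ U) :=
    ContMDiffOn.comp (t := U) hY ((contMDiffOn_extChartAt_symm q₀).mono Set.inter_subset_left)
      Set.inter_subset_right
  have h2 := (contMDiffOn_extChartAt (n := ∞) (x := v₀) (I := 𝓘(ℝ, E).tangent)).comp h1
    fun e he => by
      have := (extChartAt 𝓘(ℝ, E) q₀).map_target he.1
      rw [← extChartAt_source 𝓘(ℝ, E).tangent]
      exact mem_tangentBundle_extChartAt_source.2 this
  refine (contMDiffOn_iff_contDiffOn.1 h2).snd.congr fun e he => ?_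
  have h3 := tangentBundle_extChartAt_apply (v₀ := v₀) (v := (⟨(extChartAt 𝓘(ℝ, E) q₀).symm e,
    Y ((extChartAt 𝓘(ℝ, E) q₀).symm e)⟩ : TangentBundle 𝓘(ℝ, E) Q))
    ((extChartAt 𝓘(ℝ, E) q₀).map_target he.1)
  exact (congrArg Prod.snd h3).symm

/-- A vector-valued function on a vector space as a vector field. -/
def asField (V : E → E) (e : E) : TangentSpace 𝓘(ℝ, E) e := V e

theorem mlieBracket_asField (V W : E → E) (e : E) :
    VectorField.mlieBracket 𝓘(ℝ, E) (asField V) (asField W) e =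
      VectorField.lieBracket ℝ V W e := by
  rw [← VectorField.mlieBracketWithin_univ, VectorField.mlieBracketWithin_eq_lieBracketWithin]
  exact congrFun (VectorField.lieBracketWithin_univ (V := V) (W := W)) e

/-- Naturality of the Lie bracket: near q, both fields are the pull-backs by the chart of their
expressions in it. -/
theorem lieBracket_chartField [CompleteSpace E] {q₀ q : Q} {Y Z : ∀ q : Q, TangentSpace 𝓘(ℝ, E) q}
    {U : Set Q} (hU : IsOpen U) (hY : SmoothFieldOn Y U) (hZ : SmoothFieldOn Z U)
    (hq : q ∈ (extChartAt 𝓘(ℝ, E) q₀).source) (hqU : q ∈ U) :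
    VectorField.lieBracket ℝ (chartField q₀ Y) (chartField q₀ Z) (extChartAt 𝓘(ℝ, E) q₀ q) =
      chartDeriv q₀ q (VectorField.mlieBracket 𝓘(ℝ, E) Y Z q) := by
  have : IsManifold 𝓘(ℝ, E) 1 Q := IsManifold.of_le (n := ∞) (by simp)
  have h2 : IsManifold 𝓘(ℝ, E) (minSmoothness ℝ 2) Q :=
    IsManifold.of_le (n := ∞) (by simpa using two_le_infty)
  have hd : ∀ {V : ∀ q : Q, TangentSpace 𝓘(ℝ, E) q}, SmoothFieldOn V U →
      MDifferentiableAt 𝓘(ℝ, E) 𝓘(ℝ, E).tangent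
        (fun e => (⟨e, asField (chartField q₀ V) e⟩ : TangentBundle 𝓘(ℝ, E) E))
        (extChartAt 𝓘(ℝ, E) q₀ q) := fun hV =>
    (contMDiffAt_vectorSpace_iff_contDiffAt.2 ((contDiffOn_chartField hV).contDiffAt
      ((isOpen_chartSet q₀ hU).mem_nhds (extChartAt_mem_chartSet hq hqU)))).mdifferentiableAt
      (n := ∞) (by simp)
  have hp : ∀ V : ∀ q : Q, TangentSpace 𝓘(ℝ, E) q,
      VectorField.mpullback 𝓘(ℝ, E) 𝓘(ℝ, E) (extChartAt 𝓘(ℝ, E) q₀) (asField (chartField q₀ V))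
        =ᶠ[𝓝 q] V := fun V => by
    filter_upwards [(isOpen_extChartAt_source q₀).mem_nhds hq] with q' hq'
    obtain ⟨A, hA⟩ := isInvertible_mfderiv_extChartAt (I := 𝓘(ℝ, E)) hq'
    have h : asField (chartField q₀ V) (extChartAt 𝓘(ℝ, E) q₀ q') = A (V q') :=
      (chartField_extChartAt hq' V).trans (congrArg (fun l => l (V q')) hA.symm)
    rw [VectorField.mpullback_apply, h, ← hA, ContinuousLinearMap.inverse_equiv]
    exact A.symm_apply_apply _
  have h3 := VectorField.mpullback_mlieBracket (hd hY) (hd hZ)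
    (contMDiffAt_extChartAt' (I := 𝓘(ℝ, E)) (n := ∞) (by rwa [extChartAt_source] at hq))
    (by simpa using two_le_infty)
  rw [Filter.EventuallyEq.mlieBracket_vectorField_eq (hp Y) (hp Z), VectorField.mpullback_apply,
    mlieBracket_asField] at h3
  obtain ⟨A, hA⟩ := isInvertible_mfderiv_extChartAt (I := 𝓘(ℝ, E)) hq
  rw [← hA, ContinuousLinearMap.inverse_equiv] at h3
  rw [← h3]
  have hA' : ∀ v, A v = chartDeriv q₀ q v := fun v => congrArg (fun l => l v) hA
  exact (A.apply_symm_apply _).symm.trans (hA' _)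

end ChartField

/-! ### Existence of adapted charts -/

section Existence

variable {E : Type*} [NormedAddCommGroup E] [NormedSpace ℝ E]
  {Q : Type*} [TopologicalSpace Q] [ChartedSpace E Q] [IsManifold 𝓘(ℝ, E) ∞ Q]

/-- The differential at `q` of the preferred chart at `q₀`, as a linear equivalence. -/
def chartEquiv {q₀ q : Q} (hq : q ∈ (extChartAt 𝓘(ℝ, E) q₀).source) :
    TangentSpace 𝓘(ℝ, E) q ≃ₗ[ℝ] E :=
  LinearEquiv.ofBijective (chartDeriv q₀ q).toLinearMap (chartDeriv_bijective hq)

theorem map_chartEquiv_eq_span {Δ : ∀ q : Q, Submodule ℝ (TangentSpace 𝓘(ℝ, E) q)} {m : ℕ}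
    {Y : Fin m → ∀ q : Q, TangentSpace 𝓘(ℝ, E) q} {q₀ q : Q}
    (hq : q ∈ (extChartAt 𝓘(ℝ, E) q₀).source)
    (hY : Submodule.span ℝ (Set.range fun a => Y a q) = Δ q) :
    (Δ q).map (chartEquiv hq : TangentSpace 𝓘(ℝ, E) q →ₗ[ℝ] E) =
      Submodule.span ℝ (Set.range fun a =>
        chartField q₀ (Y a) (extChartAt 𝓘(ℝ, E) q₀ q)) := by
  rw [← hY, Submodule.map_span, ← Set.range_comp]
  refine congrArg (fun f => Submodule.span ℝ (Set.range f)) (funext fun a => ?_)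
  exact (chartField_extChartAt hq (Y a)).symm

theorem chartDeriv_mem_span_iff {Δ : ∀ q : Q, Submodule ℝ (TangentSpace 𝓘(ℝ, E) q)} {m : ℕ}
    {Y : Fin m → ∀ q : Q, TangentSpace 𝓘(ℝ, E) q} {q₀ q : Q}
    (hq : q ∈ (extChartAt 𝓘(ℝ, E) q₀).source)
    (hY : Submodule.span ℝ (Set.range fun a => Y a q) = Δ q) (v : TangentSpace 𝓘(ℝ, E) q) :
    chartDeriv q₀ q v ∈ Submodule.span ℝ (Set.range fun a =>
        chartField q₀ (Y a) (extChartAt 𝓘(ℝ, E) q₀ q)) ↔ v ∈ Δ q := by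
  rw [← map_chartEquiv_eq_span hq hY]
  refine ⟨fun ⟨v', hv', h⟩ => ?_, fun hv => ⟨v, hv, rfl⟩⟩
  rwa [← (chartEquiv hq).injective h]

theorem linearIndependent_chartField {m : ℕ} {Y : Fin m → ∀ q : Q, TangentSpace 𝓘(ℝ, E) q}
    {q₀ q : Q} (hq : q ∈ (extChartAt 𝓘(ℝ, E) q₀).source)
    (hY : LinearIndependent ℝ fun a => Y a q) :
    LinearIndependent ℝ fun a => chartField q₀ (Y a) (extChartAt 𝓘(ℝ, E) q₀ q) := by
  have h : (fun a => chartField q₀ (Y a) (extChartAt 𝓘(ℝ, E) q₀ q)) =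
      fun a => chartEquiv hq (Y a q) := funext fun a => chartField_extChartAt hq (Y a)
  rw [h]
  exact hY.map' (chartEquiv hq : TangentSpace 𝓘(ℝ, E) q →ₗ[ℝ] E) (chartEquiv hq).ker

variable [FiniteDimensional ℝ E]

/-- The frame is read in a chart of Q, and `exists_frame_section` is transported to TQ × ℝ. The
equivalence e relates the rank stored in the adapted chart to m. -/
theorem exists_adaptedChart {L : Phase E Q → ℝ} (hL : ContMDiff (phaseModel E) 𝓘(ℝ, ℝ) ∞ L)
    (hLdef : HasDefiniteHessian L) {Δ : ∀ q : Q, Submodule ℝ (TangentSpace 𝓘(ℝ, E) q)} {m : ℕ}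
    {Y : Fin m → ∀ q : Q, TangentSpace 𝓘(ℝ, E) q} {U : Set Q} (hU : IsOpen U)
    (hYs : ∀ a, SmoothFieldOn (Y a) U)
    (hY : ∀ q ∈ U, LinearIndependent ℝ (fun a => Y a q) ∧
        Submodule.span ℝ (Set.range fun a => Y a q) = Δ q)
    {x₀ : Phase E Q} (hx₀U : x₀.1.proj ∈ U) (hx₀ : x₀ ∈ constraintSet Δ) :
    ∃ c : AdaptedChart L Δ x₀, ∃ e : Fin c.m ≃ Fin m,
      (∀ a, c.X a = chartField x₀.1.proj (Y (e a))) ∧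
      ∀ x ∈ c.N, x.1.proj ∈ U ∧ x.1.proj ∈ (extChartAt 𝓘(ℝ, E) x₀.1.proj).source ∧
        c.q x = extChartAt 𝓘(ℝ, E) x₀.1.proj x.1.proj := by
  set q₀ : Q := x₀.1.proj with hq₀
  set φ := extChartAt (phaseModel E) x₀ with hφ
  set χ := extChartAt 𝓘(ℝ, E) q₀ with hχ
  set X : Fin m → E → E := fun a => chartField q₀ (Y a) with hX
  set ℓ := lagrangianInChart L x₀ with hℓ
  have hq₀s : q₀ ∈ χ.source := mem_extChartAt_source q₀
  have hX₁ : ∀ a, ContDiffOn ℝ ∞ (X a) (chartSet q₀ U) := fun a => contDiffOn_chartField (hYs a)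
  have hli : LinearIndependent ℝ fun a => X a (χ q₀) :=
    linearIndependent_chartField hq₀s (hY q₀ hx₀U).1
  obtain ⟨W, hWU, hW, hq₀W, κ, hκs, hκ⟩ := exists_frameCoefficients (isOpen_chartSet q₀ hU) hX₁
    (extChartAt_mem_chartSet hq₀s hx₀U) hli
  have hXW : ∀ a, ContDiffOn ℝ ∞ (X a) W := fun a => (hX₁ a).mono hWU
  have hℓs : ContDiffOn ℝ ∞ ℓ {ξ | ξ.1.1 ∈ W} :=
    (contDiffOn_lagrangianInChart hL x₀).mono fun ξ hξ => (hWU hξ).1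
  -- Only W(b, b) ≠ 0 is retained, so the sign of the Hessian at the point does not matter.
  have hH : ∀ ξ : (E × E) × ℝ, ξ.1.1 ∈ W → ∀ b, b ≠ 0 →
      fderiv ℝ (legendre ℓ) ξ (inV E b) b ≠ 0 := by
    intro ξ hξ b hb
    have hξt : ξ ∈ φ.target := mem_phase_extChartAt_target.2 (hWU hξ).1
    have hs := φ.map_target hξt
    have hs' := mem_phase_extChartAt_source.1 hs
    have hsurj : Function.Surjective (chartDerivL (E := E) q₀ (φ.symm ξ).1.proj) :=
      (chartDeriv_bijective hs').2
    obtain ⟨u, hu⟩ := hsurj b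
    have h := velocityHessian_eq hL hs u u
    rw [← hq₀, hu, ← hφ, φ.right_inv hξt] at h
    rw [← h]
    have hu0 : u ≠ 0 := fun h0 => hb (by rw [← hu, h0, map_zero])
    rcases hLdef (φ.symm ξ) with hd | hd
    · exact (hd u hu0).ne'
    · exact (hd u hu0).ne
  have hφ₁ : ∀ {y}, y ∈ φ.source → φ y = ((χ y.1.proj, chartDeriv q₀ y.1.proj y.1.snd), y.2) :=
    fun hy => phase_extChartAt_apply (mem_phase_extChartAt_source.1 hy)
  have hspan : ∀ {y}, y ∈ φ.source → y.1.proj ∈ U → ((φ y).1.2 ∈ Submodule.span ℝ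
      (Set.range fun a => X a (φ y).1.1) ↔ y ∈ constraintSet Δ) := fun {y} hy hyU => by
    rw [hφ₁ hy]
    exact chartDeriv_mem_span_iff (mem_phase_extChartAt_source.1 hy) (hY _ hyU).2 _
  have hx₀s : x₀ ∈ φ.source := mem_extChartAt_source x₀
  have hξ₀ : (φ x₀).1.1 ∈ W := by rw [hφ₁ hx₀s]; exact hq₀W
  obtain ⟨O, N, σ, hO, hN, hξ₀N, hNW, hσ, hσ₁, hO₁, hσ₂⟩ :=
    exists_frame_section hW hℓs hXW hκs hκ hH hξ₀ ((hspan hx₀s hx₀U).2 hx₀)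
  have hNU : ∀ y ∈ φ.source ∩ φ ⁻¹' N, y.1.proj ∈ χ.source ∧ χ y.1.proj ∈ W ∧ y.1.proj ∈ U := by
    intro y hy
    have h1 := mem_phase_extChartAt_source.1 hy.1
    have h2 := hNW _ hy.2
    rw [hφ₁ hy.1] at h2
    have h3 := (hWU h2).2
    rw [Set.mem_preimage, χ.left_inv h1] at h3
    exact ⟨h1, h2, h3⟩
  have hσt : ∀ w ∈ O, σ w ∈ φ.target := fun w hw =>
    mem_phase_extChartAt_target.2 (hWU (hNW _ (hσ₁ w hw).1)).1
  have hσN : ∀ w ∈ O, φ.symm (σ w) ∈ φ.source ∩ φ ⁻¹' N := fun w hw =>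
    ⟨φ.map_target (hσt w hw), by
      rw [Set.mem_preimage, φ.right_inv (hσt w hw)]; exact (hσ₁ w hw).1⟩
  have hcoord : ∀ y ∈ φ.source, frameMap X (χ y.1.proj, legendre ℓ (φ y), y.2) =
      frameMap X (legendreMap ℓ (φ y)) := fun y hy => by rw [legendreMap, hφ₁ hy]
  have hφs : ContMDiffOn (phaseModel E) 𝓘(ℝ, (E × E) × ℝ) ∞ φ φ.source := by
    rw [hφ, extChartAt_source]; exact contMDiffOn_extChartAt
  refine ⟨⟨m, φ.source ∩ φ ⁻¹' N, O, W, fun y => χ y.1.proj, fun y => legendre ℓ (φ y), X,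
    fun w => φ.symm (σ w), ?_, hO, hW, ⟨hx₀s, hξ₀N⟩, ?_, ?_, fun y hy => (hNU y hy).2.1, hXW,
    fun y hy u => etaL_eq hL hy.1 u, ?_, ?_, ?_, ?_, ?_, ?_, ?_⟩, Equiv.refl _, fun _ => rfl,
    fun y hy => ⟨(hNU y hy).2.2, (hNU y hy).1, rfl⟩⟩
  · exact (continuousOn_extChartAt x₀).isOpen_inter_preimage (isOpen_extChartAt_source x₀) hN
  · refine (contDiff_fst.fst.contMDiff.comp_contMDiffOn
      (hφs.mono Set.inter_subset_left)).congr fun y hy => ?_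
    rw [Function.comp_apply, hφ₁ hy.1]
  · exact (contDiffOn_legendre hW hℓs).contMDiffOn.comp (hφs.mono Set.inter_subset_left)
      fun y hy => hNW _ hy.2
  · intro y hy u h1 h2 h3
    have hd := mdifferentiableAt_phase_extChartAt hy.1
    have hW' : {ξ : (E × E) × ℝ | ξ.1.1 ∈ W} ∈ 𝓝 (φ y) :=
      (hW.preimage (continuous_fst.comp continuous_fst)).mem_nhds (hNW _ hy.2)
    have h4 := vecDeriv_comp (((contDiffOn_legendre hW hℓs).contDiffAt hW').differentiableAt
      (by simp)) hd u
    -- Since dq and dz vanish on u, it is vertical. Then dp(u) is the Hessian applied to its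
    -- velocity part, which must vanish.
    have h5 : phaseDeriv x₀ y u = inV E (phaseDeriv x₀ y u).1.2 := by
      refine Prod.ext (Prod.ext ?_ rfl) ?_
      · rw [phaseDeriv_base hy.1, ← vecDeriv_chart_baseProj (hNU y hy).1]; exact h1
      · rw [phaseDeriv_snd hy.1]; exact h3
    have h6 : fderiv ℝ (legendre ℓ) (φ y) (phaseDeriv x₀ y u) = 0 := h4.symm.trans h2
    rw [h5] at h6
    have h7 : (phaseDeriv x₀ y u).1.2 = 0 := by
      by_contra hb
      exact hH _ (hNW _ hy.2) _ hb (by rw [h6]; rfl)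
    rw [h7, map_zero] at h5
    exact phaseDeriv_injective hy.1 (h5.trans (map_zero _).symm)
  · intro y hy
    exact ⟨chartEquiv (hNU y hy).1, fun u => vecDeriv_chart_baseProj (hNU y hy).1 u,
      map_chartEquiv_eq_span (hNU y hy).1 (hY _ (hNU y hy).2.2).2⟩
  · exact (contMDiffOn_extChartAt_symm x₀).comp hσ.contMDiffOn hσt
  · intro w hw
    refine ⟨hσN w hw, (hspan (hσN w hw).1 (hNU _ (hσN w hw)).2.2).1 ?_⟩
    rw [φ.right_inv (hσt w hw)]
    exact (hσ₁ w hw).2.1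
  · intro y hy
    have h := hcoord y hy.1
    exact h ▸ hO₁ _ hy.2
  · intro w hw
    refine (hcoord _ (hσN w hw).1).trans ?_
    rw [φ.right_inv (hσt w hw)]
    exact (hσ₁ w hw).2.2
  · intro y hy hyΔ
    have h := hσ₂ _ hy.2 ((hspan hy.1 (hNU y hy).2.2).2 hyΔ)
    refine (congrArg (fun w => φ.symm (σ w)) (hcoord y hy.1)).trans ?_
    exact (congrArg φ.symm h).trans (φ.left_inv hy.1)

end Existence

/-! ### Involutivity in terms of a frame -/

section Involutive

variable {E : Type*} [NormedAddCommGroup E] [NormedSpace ℝ E] {m : ℕ}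

/-- Leibniz rule for vector fields that are combinations of a frame. -/
theorem lieBracket_mem_span_of_frame {X : Fin m → E → E} {V V' : E → E} {x y : E → Fin m → ℝ}
    {q : E} (hX : ∀ a, DifferentiableAt ℝ (X a) q) (hx : DifferentiableAt ℝ x q)
    (hy : DifferentiableAt ℝ y q) (hV : V =ᶠ[𝓝 q] fun q => ∑ a, x q a • X a q)
    (hV' : V' =ᶠ[𝓝 q] fun q => ∑ a, y q a • X a q)
    (h : ∀ a b, VectorField.lieBracket ℝ (X a) (X b) q ∈
      Submodule.span ℝ (Set.range fun d => X d q)) :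
    VectorField.lieBracket ℝ V V' q ∈ Submodule.span ℝ (Set.range fun d => X d q) := by
  set S := Submodule.span ℝ (Set.range fun d => X d q)
  have hmem : ∀ a, X a q ∈ S := fun a => Submodule.subset_span ⟨a, rfl⟩
  have hd : ∀ {x : E → Fin m → ℝ}, DifferentiableAt ℝ x q →
      HasFDerivAt (fun q => ∑ a, x q a • X a q)
        (∑ a, (x q a • fderiv ℝ (X a) q +
          (fderiv ℝ (fun q => x q a) q).smulRight (X a q))) q := fun hx =>
    HasFDerivAt.fun_sum fun a _ =>
      ((differentiableAt_pi.1 hx a).hasFDerivAt.smul (hX a).hasFDerivAt)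
  rw [Filter.EventuallyEq.lieBracket_vectorField_eq hV hV', VectorField.lieBracket,
    (hd hx).fderiv, (hd hy).fderiv]
  -- Terms in which a coefficient is differentiated are multiples of the X_a. Only the terms without
  -- such derivatives form brackets of the frame.
  have key : (∑ a, (y q a • fderiv ℝ (X a) q +
        (fderiv ℝ (fun q => y q a) q).smulRight (X a q))) (∑ a, x q a • X a q) -
      (∑ a, (x q a • fderiv ℝ (X a) q +
        (fderiv ℝ (fun q => x q a) q).smulRight (X a q))) (∑ a, y q a • X a q) =
      (∑ a, ∑ b, (x q a * y q b) • VectorField.lieBracket ℝ (X a) (X b) q) +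
      ((∑ a, fderiv ℝ (fun q => y q a) q (∑ a, x q a • X a q) • X a q) -
        ∑ a, fderiv ℝ (fun q => x q a) q (∑ a, y q a • X a q) • X a q) := by
    have h1 : ∀ x y : E → Fin m → ℝ, (∑ a, y q a • fderiv ℝ (X a) q) (∑ a, x q a • X a q) =
        ∑ a, ∑ b, (x q a * y q b) • fderiv ℝ (X b) q (X a q) := fun x y => by
      rw [map_sum]
      refine Finset.sum_congr rfl fun a _ => ?_
      simp [Finset.smul_sum, smul_smul]
    rw [Finset.sum_add_distrib, Finset.sum_add_distrib, add_apply, add_apply, h1, h1]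
    have h2 : ∑ a, ∑ b, (y q a * x q b) • fderiv ℝ (X b) q (X a q) =
        ∑ a, ∑ b, (x q a * y q b) • fderiv ℝ (X a) q (X b q) := by
      rw [Finset.sum_comm]
      simp only [mul_comm]
    rw [h2]
    simp only [VectorField.lieBracket, smul_sub, Finset.sum_sub_distrib, sum_apply,
      ContinuousLinearMap.smulRight_apply]
    abel
  rw [key]
  refine S.add_mem (S.sum_mem fun a _ => S.sum_mem fun b _ => S.smul_mem _ (h a b))
    (S.sub_mem (S.sum_mem fun a _ => S.smul_mem _ (hmem a))
      (S.sum_mem fun a _ => S.smul_mem _ (hmem a)))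

variable {Q : Type*} [TopologicalSpace Q] [ChartedSpace E Q] [IsManifold 𝓘(ℝ, E) ∞ Q]
  [FiniteDimensional ℝ E]

/-- Fields in Δ have smooth coefficients in the frame, supplied by κ, so in the chart the Leibniz
rule reduces the claim to the frame. -/
theorem mlieBracket_mem_of_frame {Δ : ∀ q : Q, Submodule ℝ (TangentSpace 𝓘(ℝ, E) q)}
    {Y : Fin m → ∀ q : Q, TangentSpace 𝓘(ℝ, E) q} {U U' : Set Q} (hU : IsOpen U)
    (hYs : ∀ a, SmoothFieldOn (Y a) U)
    (hY : ∀ q ∈ U, LinearIndependent ℝ (fun a => Y a q) ∧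
        Submodule.span ℝ (Set.range fun a => Y a q) = Δ q)
    {q₀ : Q} (hq₀ : q₀ ∈ U)
    (h : ∀ a b, VectorField.lieBracket ℝ (chartField q₀ (Y a)) (chartField q₀ (Y b))
      (extChartAt 𝓘(ℝ, E) q₀ q₀) ∈ Submodule.span ℝ (Set.range fun d =>
        chartField q₀ (Y d) (extChartAt 𝓘(ℝ, E) q₀ q₀)))
    {V V' : ∀ q : Q, TangentSpace 𝓘(ℝ, E) q} (hU' : IsOpen U') (hq₀' : q₀ ∈ U')
    (hV : SmoothFieldOn V U') (hV' : SmoothFieldOn V' U')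
    (hVΔ : ∀ q ∈ U', V q ∈ Δ q) (hVΔ' : ∀ q ∈ U', V' q ∈ Δ q) :
    VectorField.mlieBracket 𝓘(ℝ, E) V V' q₀ ∈ Δ q₀ := by
  have hs : q₀ ∈ (extChartAt 𝓘(ℝ, E) q₀).source := mem_extChartAt_source q₀
  have hX : ∀ a, ContDiffOn ℝ ∞ (chartField q₀ (Y a)) (chartSet q₀ U) :=
    fun a => contDiffOn_chartField (hYs a)
  obtain ⟨W, hWU, hW, hqW, κ, hκs, hκ⟩ := exists_frameCoefficients (isOpen_chartSet q₀ hU) hX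
    (extChartAt_mem_chartSet hs hq₀) (linearIndependent_chartField hs (hY q₀ hq₀).1)
  set e₀ := extChartAt 𝓘(ℝ, E) q₀ q₀ with he₀
  have hW' : W ∩ chartSet q₀ U' ∈ 𝓝 e₀ :=
    (hW.inter (isOpen_chartSet q₀ hU')).mem_nhds ⟨hqW, extChartAt_mem_chartSet hs hq₀'⟩
  have hcoef : ∀ {V : ∀ q : Q, TangentSpace 𝓘(ℝ, E) q}, SmoothFieldOn V U' →
      (∀ q ∈ U', V q ∈ Δ q) →
      DifferentiableAt ℝ (fun e => κ e (chartField q₀ V e)) e₀ ∧ chartField q₀ V =ᶠ[𝓝 e₀]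
        fun e => ∑ a, κ e (chartField q₀ V e) a • chartField q₀ (Y a) e := by
    intro V hV hVΔ
    constructor
    · exact (((hκs.mono Set.inter_subset_left).clm_apply
        ((contDiffOn_chartField hV).mono Set.inter_subset_right)).contDiffAt hW').differentiableAt
        (by simp)
    · filter_upwards [hW'] with e he
      have hqs := (extChartAt 𝓘(ℝ, E) q₀).map_target he.2.1
      have h1 := (chartDeriv_mem_span_iff hqs (hY _ (hWU he.1).2).2 _).2 (hVΔ _ he.2.2)
      rw [(extChartAt 𝓘(ℝ, E) q₀).right_inv he.2.1] at h1
      obtain ⟨u, hu⟩ := exists_frameSum_eq h1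
      have hu' : frameSum (fun a => chartField q₀ (Y a)) e u = chartField q₀ V e := hu
      rw [← hu', hκ e he.1, frameSum_apply]
  have hmem := lieBracket_mem_span_of_frame
    (fun a => ((hX a).contDiffAt ((isOpen_chartSet q₀ hU).mem_nhds
      (extChartAt_mem_chartSet hs hq₀))).differentiableAt (by simp))
    (hcoef hV hVΔ).1 (hcoef hV' hVΔ').1 (hcoef hV hVΔ).2 (hcoef hV' hVΔ').2 h
  have : CompleteSpace E := FiniteDimensional.complete ℝ E
  rw [lieBracket_chartField hU' hV hV' hs hq₀'] at hmem
  exact (chartDeriv_mem_span_iff hs (hY q₀ hq₀).2 _).1 hmem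

end Involutive

end ContactNonholonomic

end


/-! ### Equivalence of involutivity and the Jacobi identity -/

theorem mainTheorem3
    {E : Type*} [NormedAddCommGroup E] [NormedSpace ℝ E] [FiniteDimensional ℝ E]
    {Q : Type*} [TopologicalSpace Q] [ChartedSpace E Q] [IsManifold 𝓘(ℝ, E) ∞ Q]
    [T2Space Q] [SigmaCompactSpace Q]
    (L : ContactNonholonomic.Phase E Q → ℝ)
    (hL : ContMDiff (ContactNonholonomic.phaseModel E) 𝓘(ℝ, ℝ) ∞ L)
    (hLdef : ContactNonholonomic.HasDefiniteHessian L)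
    (Δ : ∀ q : Q, Submodule ℝ (TangentSpace 𝓘(ℝ, E) q))
    (hΔ : ContactNonholonomic.IsRegularDistribution Δ) :
    ContactNonholonomic.IsInvolutive Δ ↔ ContactNonholonomic.SatisfiesJacobi L Δ := by
  have : CompleteSpace E := FiniteDimensional.complete ℝ E
  obtain ⟨m, hm⟩ := hΔ
  constructor
  · intro hinv
    refine ContactNonholonomic.satisfiesJacobi_of_lieBracket_mem fun x₀ hx₀ => ?_
    obtain ⟨U, hU, hx₀U, Y, hYs, hY⟩ := hm x₀.1.proj
    obtain ⟨c, e, hcX, hcN⟩ :=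
      ContactNonholonomic.exists_adaptedChart hL hLdef hU hYs hY hx₀U hx₀
    refine ⟨c, fun x hx a b => ?_⟩
    obtain ⟨hxU, hxs, hxq⟩ := hcN x hx
    have hYΔ : ∀ a, ∀ q ∈ U, Y a q ∈ Δ q := fun a q hq => by
      rw [← (hY q hq).2]; exact Submodule.subset_span ⟨a, rfl⟩
    have h := (ContactNonholonomic.chartDeriv_mem_span_iff hxs (hY _ hxU).2 _).2
      (hinv U hU _ _ (hYs (e a)) (hYs (e b)) (hYΔ _) (hYΔ _) _ hxU)
    rw [← ContactNonholonomic.lieBracket_chartField hU (hYs (e a)) (hYs (e b)) hxs hxU,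
      ← hxq, ← e.surjective.range_comp] at h
    rw [hcX a, hcX b]
    simp only [hcX]
    exact h
  · intro hJ U' hU' V V' hV hV' hVΔ hVΔ' q₀ hq₀'
    obtain ⟨U, hU, hq₀, Y, hYs, hY⟩ := hm q₀
    have hc : ∀ x ∈ ContactNonholonomic.constraintSet Δ,
        Nonempty (ContactNonholonomic.AdaptedChart L Δ x) := fun x hx => by
      obtain ⟨U, hU, hxU, Y, hYs, hY⟩ := hm x.1.proj
      exact ⟨(ContactNonholonomic.exists_adaptedChart hL hLdef hU hYs hY hxU hx).choose⟩
    -- The zero vector lies in Δ at every point of Q, so each q₀ is the projection of a point of Δ ×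
    -- ℝ at which the Jacobi identity can be used.
    let x₀ : ContactNonholonomic.Phase E Q := (⟨q₀, 0⟩, 0)
    have hx₀ : x₀ ∈ ContactNonholonomic.constraintSet Δ := (Δ q₀).zero_mem
    obtain ⟨c, e, hcX, hcN⟩ :=
      ContactNonholonomic.exists_adaptedChart hL hLdef (x₀ := x₀) hU hYs hY hq₀ hx₀
    refine ContactNonholonomic.mlieBracket_mem_of_frame hU hYs hY hq₀ (fun a b => ?_) hU' hq₀'
      hV hV' hVΔ hVΔ'
    have h := c.lieBracket_mem_of_satisfiesJacobi hJ hc hx₀ (e.symm a) (e.symm b)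
    simp only [hcX, Equiv.apply_symm_apply, (hcN x₀ c.mem_N).2.2] at h
    have hr := e.surjective.range_comp fun d => ContactNonholonomic.chartField q₀ (Y d)
      (extChartAt 𝓘(ℝ, E) q₀ q₀)
    rw [← hr]
    exact h
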